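/- Let $\mathbb D$ be the open unit disc in $\mathbb C$ and $\mathbb T$ its boundary. Let $1<p<\infty$ and $0<s<1$. Let $\mathcal Q^p_s(\mathbb D)$ be the space of all analytic functions $f$ in $\mathbb D$ such that $$\sup_{a\in\mathbb D}\int_{\mathbb D}|(f\circ\sigma_a)'(z)|^p\,(1-|z|^2)^{p-2+s}\,dA(z)<\infty,\qquad \sigma_a(z)=\frac{a-z}{1-\overline a z},$$ where $dA$ is Lebesgue measure on $\mathbb D$. Let $\mathcal Q^p_s(\mathbb T)$ be the space of all $g\in L^p(\mathbb T)$ such that $$\sup_{I\subseteq\mathbb T}\frac1{|I|^s}\int_I\int_I\frac{|g(\zeta)-g(\eta)|^p}{|\zeta-\eta|^{2-s}}\,|d\zeta|\,|d\eta|<\infty,$$ where the supremum is over all arcs $I$ of $\mathbb T$ and $|I|$ is the length of $I$. Suppose that $f$ belongs to the Hardy space $H^1$, that is, $f$ is analytic in $\mathbb D$ and $\sup_{0<r<1}\frac1{2\pi}\int_0^{2\pi}|f(re^{i\theta})|\,d\theta<\infty$. Then the non-tangential limit $f(\zeta)$, i.e. the common limit of $f(z)$ as $z\to\zeta$ inside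 each Stolz angle $\{z\in\mathbb D:|1-\overline\zeta z|<\alpha(1-|z|)\}$, $\alpha>1$, exists for almost every $\zeta\in\mathbb T$, and $f\in\mathcal Q^p_s(\mathbb D)$ if and only if the boundary function $\zeta\mapsto f(\zeta)$ belongs to $\mathcal Q^p_s(\mathbb T)$. -/

import Mathlib

open MeasureTheory Set Filter Topology

noncomputable section

/-- The open unit disc `𝔻`. A function on the disc is a map `ℂ → ℂ` of which only the values on
`unitDisc` matter. -/
def unitDisc : Set ℂ := Metric.ball 0 1

/-- The integral mean `M_p(r, f) = ((1 / 2π) ∫_0^{2π} |f(r e^{iθ})|^p dθ)^{1/p}`. -/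
def integralMean (p r : ℝ) (f : ℂ → ℂ) : ℝ :=
  ((2 * Real.pi)⁻¹ *
    ∫ θ in (0 : ℝ)..(2 * Real.pi), ‖f ((r : ℂ) * (Circle.exp θ : ℂ))‖ ^ p) ^ (1 / p)

/-- The Hardy space `H^p`: `f` is analytic in the disc and `sup_{0<r<1} M_p(r, f) < ∞`. -/
def MemHardy (p : ℝ) (f : ℂ → ℂ) : Prop :=
  DifferentiableOn ℂ f unitDisc ∧ ∃ C : ℝ, ∀ r ∈ Ioo (0 : ℝ) 1, integralMean p r f ≤ C

/-- The Möbius transformation `σ_a(z) = (a - z) / (1 - conj(a) z)` of the disc. -/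
def mobiusDisc (a z : ℂ) : ℂ := (a - z) / (1 - starRingEnd ℂ a * z)

/-- The `p`-th power of the seminorm of the analytic Besov type space `B_p(s)`:
`∫_𝔻 |f'(z)|^p (1 - |z|^2)^{p-2+s} dA(z)`, possibly infinite. -/
def besovEnergy (p s : ℝ) (f : ℂ → ℂ) : ENNReal :=
  ∫⁻ z in unitDisc, ENNReal.ofReal (‖deriv f z‖ ^ p * (1 - ‖z‖ ^ 2) ^ (p - 2 + s))

/-- The Möbius invariant space `Q^p_s(𝔻)`: `f` is analytic in the disc and
`sup_{a ∈ 𝔻} ‖f ∘ σ_a‖^p_{B_p(s)} < ∞`. -/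
def MemQDisc (p s : ℝ) (f : ℂ → ℂ) : Prop :=
  DifferentiableOn ℂ f unitDisc ∧
    (⨆ a ∈ unitDisc, besovEnergy p s (f ∘ mobiusDisc a)) < ⊤

/-- The double integral of `|g(ζ) - g(η)|^p / |ζ - η|^{2-s}` with respect to `|dζ| |dη|`, both
variables running over the arc `{e^{iθ} : a < θ ≤ a + l}` of length `l`, where `0 < l ≤ 2π`. -/
def arcEnergy (p s : ℝ) (g : Circle → ℂ) (a l : ℝ) : ENNReal :=
  ∫⁻ θ in Ioc a (a + l), ∫⁻ t in Ioc a (a + l),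
    ENNReal.ofReal (‖g (Circle.exp θ) - g (Circle.exp t)‖ ^ p /
      ‖(Circle.exp θ : ℂ) - (Circle.exp t : ℂ)‖ ^ (2 - s))

/-- The space `Q^p_s(𝕋)`: `g ∈ L^p(𝕋)` and the supremum over all arcs `I` of
`|I|^{-s} ∫_I ∫_I |g(ζ) - g(η)|^p / |ζ - η|^{2-s} |dζ| |dη|` is finite. -/
def MemQCircle (p s : ℝ) (g : Circle → ℂ) : Prop :=
  MemLp (fun θ : ℝ => g (Circle.exp θ)) (ENNReal.ofReal p)
      (volume.restrict (Ioc 0 (2 * Real.pi))) ∧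
    (⨆ (a : ℝ) (l : ℝ) (_ : l ∈ Ioc 0 (2 * Real.pi)),
      arcEnergy p s g a l / ENNReal.ofReal (l ^ s)) < ⊤

/-- The Stolz angle `Γ_α(ζ) = {z ∈ 𝔻 : |1 - conj(ζ) z| < α (1 - |z|)}` with vertex `ζ`. -/
def stolzAngle (α : ℝ) (ζ : Circle) : Set ℂ :=
  {z | z ∈ unitDisc ∧ ‖1 - starRingEnd ℂ (ζ : ℂ) * z‖ < α * (1 - ‖z‖)}

/-- `f` has the non-tangential limit `L` at `ζ`: it tends to `L` inside every Stolz angle. -/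
def HasNontangentialLimit (f : ℂ → ℂ) (ζ : Circle) (L : ℂ) : Prop :=
  ∀ α : ℝ, 1 < α → Tendsto f (𝓝[stolzAngle α ζ] (ζ : ℂ)) (𝓝 L)

/-- `g` is (a representative of) the boundary function of `f`: at almost every point `ζ` of the
circle, `g(ζ)` is the non-tangential limit of `f` at `ζ`. -/
def IsBoundaryFunction (f : ℂ → ℂ) (g : Circle → ℂ) : Prop :=
  ∀ᵐ θ : ℝ, HasNontangentialLimit f (Circle.exp θ) (g (Circle.exp θ))

end

/-!
Boundary values of functions in `H^1`, and their membership in the spaces `Q^p_s`.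

**Existence of boundary values.** A function holomorphic on the closed disc is a product `k l`
where `|k|^2` and `|l|^2` have a common continuous majorant that equals `|f|` on the circle: the
zeros are exchanged for Blaschke factors and the zero-free part has a square root
(`hasSquareFactors_of_analyticOnNhd`). For the dilates of `f` in `H^1` this bounds the `ℓ^2` norms
of the Taylor coefficients of both factors, and along a subsequence the factors converge; hence
`f` is itself a product of two power series with square summable coefficients
(`MemHardy.exists_coeff`). Parseval's identity shows that the restrictions of `f` to the circles
of radius `r < 1` converge in `L^1` as `r → 1` (`MemHardy.exists_boundary_lintegral`), and
Poisson's formula gives non-tangential limits at all Lebesgue points of the limit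
(`isBoundaryFunction_of_tendsto_lintegral`).

**From the disc to the circle** (`memQCircle_of_memQDisc`). A change of variables turns the energy
of `f ∘ σ_a` into `∫ |f'|^p (1 - |z|^2)^{p-2} (1 - |σ_a|^2)^s dA` (`besovEnergy_comp_mobiusDisc`),
so that `|f'|^p (1 - |z|)^{p-2+s} dA` has mass at most `C l^s` on the Carleson box below an arc of
length `l` (`carlesonBox_le`). The increment of the boundary values from `θ` to `θ + u` is bounded
by the integral of `|f'|` along the path that descends from `θ` to a depth proportional to `u`,
follows the circle at that depth and ascends to `θ + u`. Hardy's inequality (`hardy_inequality`)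
takes care of the radial parts.

**From the circle to the disc** (`memQDisc_of_memQCircle`). By Cauchy's formula, `|f'|` at depth
`x` below the angle `θ` is at most a multiple of the integral of `|g(θ + u) - g(θ)| (x +
|u|)^{-2}` over `u` (`depthDeriv_le_lintegral`). Taking `p`-th powers and integrating over `x`
reduces the energy of `f ∘ σ_a` to the integral of `∫ |g(θ + u) - g(θ)|^p |u|^{s-2} du` over `θ`
against a weight which is concentrated on the arc of length comparable to `1 - |a|` around the
direction of `a`. The main point is that the integral over all `u` and over `θ` in an arc `I` is
`O(|I|^s)`, although the hypothesis on `g` involves only pairs of points in the same arc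
(`lintegral_dyadicArc_increment_le`): the mean oscillation between `I` and the concentric arc of
length `2^k |I|` is `O(lam^k)` for every `lam > 1`, by convexity of `x ^ p`, and `s < 1` permits
`lam < 2^{1-s}`, so that the sum over `k` converges. A summation over the dyadic arcs around the
direction of `a` concludes (`lintegral_mobiusWeight_mul_le`).
-/

/-! ### Inequalities for integrals and chords -/

/-- Hölder's inequality for the measure with density `w`, which need not have total mass one. -/
theorem lintegral_mul_rpow_le {α : Type*} [MeasurableSpace α] (μ : Measure α) {p : ℝ} (hp : 1 < p)
    {φ w : α → ENNReal} (hφ : AEMeasurable φ μ) (hw : AEMeasurable w μ) :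
    (∫⁻ x, φ x * w x ∂μ) ^ p ≤ (∫⁻ x, w x ∂μ) ^ (p - 1) * ∫⁻ x, φ x ^ p * w x ∂μ := by
  have hp0 : 0 < p := by linarith
  have hpq := Real.HolderConjugate.conjExponent hp
  set q := p.conjExponent with hq
  have hq0 : 0 < q := hpq.symm.pos
  have h := ENNReal.lintegral_mul_le_Lp_mul_Lq μ hpq (f := fun x => φ x * w x ^ (1 / p))
    (g := fun x => w x ^ (1 / q)) (hφ.mul (hw.pow_const _)) (hw.pow_const _)
  have e1 : ∀ x, ((fun x => φ x * w x ^ (1 / p)) * fun x => w x ^ (1 / q)) x = φ x * w x := by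
    intro x
    simp only [Pi.mul_apply, mul_assoc]
    rw [← ENNReal.rpow_add_of_nonneg _ _ (by positivity) (by positivity)]
    have : 1 / p + 1 / q = 1 := by simpa using hpq.inv_add_inv_eq_one
    rw [this, ENNReal.rpow_one]
  have e2 : ∀ x, (φ x * w x ^ (1 / p)) ^ p = φ x ^ p * w x := by
    intro x
    rw [ENNReal.mul_rpow_of_nonneg _ _ hp0.le, ← ENNReal.rpow_mul, one_div_mul_cancel hp0.ne',
      ENNReal.rpow_one]
  have e3 : ∀ x, (w x ^ (1 / q)) ^ q = w x := by
    intro x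
    rw [← ENNReal.rpow_mul, one_div_mul_cancel hq0.ne', ENNReal.rpow_one]
  simp only [e1, e2, e3] at h
  calc _ ≤ ((∫⁻ x, φ x ^ p * w x ∂μ) ^ (1 / p) * (∫⁻ x, w x ∂μ) ^ (1 / q)) ^ p := by
        gcongr
    _ = _ := by
        rw [ENNReal.mul_rpow_of_nonneg _ _ hp0.le, ← ENNReal.rpow_mul, ← ENNReal.rpow_mul,
          one_div_mul_cancel hp0.ne', ENNReal.rpow_one, mul_comm]
        congr 2
        rw [hq, Real.conjExponent]
        field_simp

theorem setLIntegral_rpow_le {p : ℝ} (hp : 1 < p) {a b : ℝ} (hab : a ≤ b) {φ : ℝ → ENNReal}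
    (hφ : Measurable φ) :
    (∫⁻ x in Ioc a b, φ x) ^ p ≤ ENNReal.ofReal ((b - a) ^ (p - 1)) * ∫⁻ x in Ioc a b, φ x ^ p := by
  have := lintegral_mul_rpow_le (volume.restrict (Ioc a b)) hp hφ.aemeasurable
    (w := fun _ => 1) aemeasurable_const
  simp only [mul_one, lintegral_const, Measure.restrict_apply MeasurableSet.univ, univ_inter,
    Real.volume_Ioc, one_mul] at this
  rwa [ENNReal.ofReal_rpow_of_nonneg (by linarith) (by linarith)] at this

theorem lintegral_Ioc_rpow {r : ℝ} (hr : -1 < r) {y : ℝ} (hy : 0 ≤ y) :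
    ∫⁻ x in Ioc 0 y, ENNReal.ofReal (x ^ r) = ENNReal.ofReal (y ^ (r + 1) / (r + 1)) := by
  rw [← ofReal_integral_eq_lintegral_ofReal, ← intervalIntegral.integral_of_le hy,
    integral_rpow (Or.inl hr), Real.zero_rpow (by linarith), sub_zero]
  · exact (intervalIntegrable_iff_integrableOn_Ioc_of_le hy).1
      (intervalIntegral.intervalIntegrable_rpow' hr)
  · filter_upwards [ae_restrict_mem measurableSet_Ioc] with x hx
    exact Real.rpow_nonneg hx.1.le _

theorem lintegral_Ioi_rpow {r : ℝ} (hr : r < -1) {y : ℝ} (hy : 0 < y) :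
    ∫⁻ x in Ioi y, ENNReal.ofReal (x ^ r) = ENNReal.ofReal (y ^ (r + 1) / (-(r + 1))) := by
  rw [← ofReal_integral_eq_lintegral_ofReal, integral_Ioi_rpow_of_lt hr hy, div_neg, neg_div]
  · exact integrableOn_Ioi_rpow_of_lt hr hy
  · filter_upwards [ae_restrict_mem measurableSet_Ioi] with x hx
    exact Real.rpow_nonneg (hy.trans hx).le _

/-- Hardy's inequality for the integration operator, with a power weight and a dilation `c`. It
holds by Hölder's inequality with the auxiliary weight `x ^ (τ - 1)` and an interchange of the
integrals. -/
theorem hardy_inequality {p s c : ℝ} (hp : 1 < p) (hs1 : s < 1) (hc : 0 < c) :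
    ∃ C : NNReal, ∀ (A : ℝ) (φ : ℝ → ENNReal), Measurable φ →
      ∫⁻ y in Ioc 0 A, (∫⁻ x in Ioc 0 (c * y), φ x) ^ p * ENNReal.ofReal (y ^ (s - 2)) ≤
        C * ∫⁻ x in Ioc 0 (c * A), φ x ^ p * ENNReal.ofReal (x ^ (p - 2 + s)) := by
  -- `τ` is small enough that `y ^ (s - 2 + τ (p - 1))` is integrable at infinity
  set τ : ℝ := (1 - s) / (2 * (p - 1)) with hτ
  have hp1 : 0 < p - 1 := by linarith
  have hτ0 : 0 < τ := div_pos (by linarith) (by linarith)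
  have hτp : τ * (p - 1) = (1 - s) / 2 := by rw [hτ]; field_simp
  set e : ℝ := s - 2 + τ * (p - 1) with he
  have he1 : e < -1 := by rw [he, hτp]; linarith
  set K : ℝ := (c ^ τ / τ) ^ (p - 1) * (c ^ (-(e + 1)) / (-(e + 1))) with hK
  have hK0 : 0 ≤ K := by
    have : 0 < -(e + 1) := by linarith
    positivity
  refine ⟨K.toNNReal, fun A φ hφ => ?_⟩
  have step1 : ∀ y ∈ Ioc (0 : ℝ) A,
      (∫⁻ x in Ioc 0 (c * y), φ x) ^ p * ENNReal.ofReal (y ^ (s - 2)) ≤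
      ENNReal.ofReal ((c ^ τ / τ) ^ (p - 1)) * (∫⁻ x in Ioc 0 (c * A), (Iic (c * y)).indicator
        (fun x => φ x ^ p * ENNReal.ofReal (x ^ ((1 - τ) * (p - 1)))) x *
          ENNReal.ofReal (y ^ e)) := by
    intro y hy
    have hy0 : 0 < y := hy.1
    have h1 := lintegral_mul_rpow_le (volume.restrict (Ioc 0 (c * y))) hp
      (φ := fun x => φ x * ENNReal.ofReal (x ^ (1 - τ)))
      (w := fun x => ENNReal.ofReal (x ^ (τ - 1)))
      (by fun_prop) (by fun_prop)
    have e1 : ∫⁻ x in Ioc 0 (c * y), φ x * ENNReal.ofReal (x ^ (1 - τ)) *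
        ENNReal.ofReal (x ^ (τ - 1)) = ∫⁻ x in Ioc 0 (c * y), φ x := by
      refine setLIntegral_congr_fun measurableSet_Ioc fun x hx => ?_
      have hx0 : 0 < x := hx.1
      rw [mul_assoc, ← ENNReal.ofReal_mul (by positivity), ← Real.rpow_add hx0]
      simp
    have e2 : ∫⁻ x in Ioc 0 (c * y), (φ x * ENNReal.ofReal (x ^ (1 - τ))) ^ p *
        ENNReal.ofReal (x ^ (τ - 1)) =
        ∫⁻ x in Ioc 0 (c * y), φ x ^ p * ENNReal.ofReal (x ^ ((1 - τ) * (p - 1))) := by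
      refine setLIntegral_congr_fun measurableSet_Ioc fun x hx => ?_
      have hx0 : 0 < x := hx.1
      rw [ENNReal.mul_rpow_of_nonneg _ _ (by linarith),
        ENNReal.ofReal_rpow_of_nonneg (by positivity) (by linarith), mul_assoc,
        ← ENNReal.ofReal_mul (by positivity), ← Real.rpow_mul hx0.le, ← Real.rpow_add hx0]
      congr 3
      ring
    rw [e1, e2, lintegral_Ioc_rpow (by linarith) (by positivity), sub_add_cancel,
      ENNReal.ofReal_rpow_of_nonneg (by positivity) (by linarith)] at h1
    have e3 : ∫⁻ x in Ioc 0 (c * A), (Iic (c * y)).indicator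
        (fun x => φ x ^ p * ENNReal.ofReal (x ^ ((1 - τ) * (p - 1)))) x *
          ENNReal.ofReal (y ^ e) = (∫⁻ x in Ioc 0 (c * y), φ x ^ p *
            ENNReal.ofReal (x ^ ((1 - τ) * (p - 1)))) * ENNReal.ofReal (y ^ e) := by
      rw [lintegral_mul_const' _ _ ENNReal.ofReal_ne_top, setLIntegral_indicator measurableSet_Iic]
      congr 3
      ext x
      simp only [mem_inter_iff, mem_Iic, mem_Ioc]
      have : c * y ≤ c * A := by gcongr; exact hy.2
      constructor
      · rintro ⟨a, b, -⟩; exact ⟨b, a⟩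
      · rintro ⟨a, b⟩; exact ⟨b, a, b.trans this⟩
    rw [e3]
    have e4 : ((c * y) ^ τ / τ) ^ (p - 1) * y ^ (s - 2) = (c ^ τ / τ) ^ (p - 1) * y ^ e := by
      rw [he, Real.rpow_add hy0, Real.mul_rpow hc.le hy0.le, mul_div_right_comm,
        Real.mul_rpow (by positivity) (by positivity), ← Real.rpow_mul hy0.le]
      ring
    calc _ ≤ ENNReal.ofReal (((c * y) ^ τ / τ) ^ (p - 1)) * (∫⁻ x in Ioc 0 (c * y),
          φ x ^ p * ENNReal.ofReal (x ^ ((1 - τ) * (p - 1)))) * ENNReal.ofReal (y ^ (s - 2)) := by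
            gcongr
      _ = ENNReal.ofReal (((c * y) ^ τ / τ) ^ (p - 1) * y ^ (s - 2)) * (∫⁻ x in Ioc 0 (c * y),
          φ x ^ p * ENNReal.ofReal (x ^ ((1 - τ) * (p - 1)))) := by
            rw [ENNReal.ofReal_mul (by positivity)]; ring
      _ = _ := by rw [e4, ENNReal.ofReal_mul (by positivity)]; ring
  have hmeas : Measurable fun z : ℝ × ℝ => (Iic (c * z.1)).indicator
        (fun x => φ x ^ p * ENNReal.ofReal (x ^ ((1 - τ) * (p - 1)))) z.2 *
          ENNReal.ofReal (z.1 ^ e) := by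
    have : (fun z : ℝ × ℝ => (Iic (c * z.1)).indicator
        (fun x => φ x ^ p * ENNReal.ofReal (x ^ ((1 - τ) * (p - 1)))) z.2) =
        {z : ℝ × ℝ | z.2 ≤ c * z.1}.indicator
          (fun z => φ z.2 ^ p * ENNReal.ofReal (z.2 ^ ((1 - τ) * (p - 1)))) := by
      ext z; simp [indicator]
    refine Measurable.mul ?_ (by fun_prop)
    rw [this]
    exact Measurable.indicator (by fun_prop) (measurableSet_le (by fun_prop) (by fun_prop))
  calc _ ≤ ∫⁻ y in Ioc 0 A, ENNReal.ofReal ((c ^ τ / τ) ^ (p - 1)) * (∫⁻ x in Ioc 0 (c * A),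
          (Iic (c * y)).indicator
          (fun x => φ x ^ p * ENNReal.ofReal (x ^ ((1 - τ) * (p - 1)))) x *
          ENNReal.ofReal (y ^ e)) := setLIntegral_mono' measurableSet_Ioc step1
    _ = ENNReal.ofReal ((c ^ τ / τ) ^ (p - 1)) * ∫⁻ x in Ioc 0 (c * A), ∫⁻ y in Ioc 0 A,
          (Iic (c * y)).indicator
          (fun x => φ x ^ p * ENNReal.ofReal (x ^ ((1 - τ) * (p - 1)))) x *
          ENNReal.ofReal (y ^ e) := by
        rw [lintegral_const_mul' _ _ ENNReal.ofReal_ne_top, lintegral_lintegral_swap]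
        exact hmeas.aemeasurable
    _ ≤ ENNReal.ofReal ((c ^ τ / τ) ^ (p - 1)) * ∫⁻ x in Ioc 0 (c * A),
          ENNReal.ofReal (c ^ (-(e + 1)) / (-(e + 1))) *
            (φ x ^ p * ENNReal.ofReal (x ^ (p - 2 + s))) := by
        gcongr ENNReal.ofReal ((c ^ τ / τ) ^ (p - 1)) * ?_
        refine setLIntegral_mono' measurableSet_Ioc fun x hx => ?_
        have hx0 : 0 < x := hx.1
        calc _ ≤ ∫⁻ y in Ioc 0 A, φ x ^ p * ENNReal.ofReal (x ^ ((1 - τ) * (p - 1))) *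
              (Ici (x / c)).indicator (fun y => ENNReal.ofReal (y ^ e)) y := by
              refine lintegral_mono fun y => ?_
              by_cases hxy : x ≤ c * y
              · have : x / c ≤ y := by rwa [div_le_iff₀' hc]
                simp [indicator, hxy, this]
              · simp [indicator, hxy]
          _ ≤ φ x ^ p * ENNReal.ofReal (x ^ ((1 - τ) * (p - 1))) *
                ∫⁻ y in Ioi (x / c), ENNReal.ofReal (y ^ e) := by
              rw [lintegral_const_mul _ ((by fun_prop : Measurable fun y : ℝ =>
                ENNReal.ofReal (y ^ e)).indicator measurableSet_Ici)]
              gcongr _ * ?_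
              rw [setLIntegral_indicator measurableSet_Ici, setLIntegral_congr Ioi_ae_eq_Ici]
              exact lintegral_mono_set inter_subset_left
          _ = _ := by
              rw [lintegral_Ioi_rpow he1 (by positivity)]
              have : x ^ ((1 - τ) * (p - 1)) * ((x / c) ^ (e + 1) / -(e + 1)) =
                  c ^ (-(e + 1)) / (-(e + 1)) * x ^ (p - 2 + s) := by
                rw [Real.div_rpow hx0.le hc.le, Real.rpow_neg hc.le]
                have : x ^ (p - 2 + s) = x ^ ((1 - τ) * (p - 1)) * x ^ (e + 1) := by
                  rw [← Real.rpow_add hx0, he]; congr 1; ring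
                rw [this]; field_simp
              have hpos : 0 < -(e + 1) := by linarith
              rw [mul_assoc, ← ENNReal.ofReal_mul (by positivity), this,
                ENNReal.ofReal_mul (by positivity)]
              ring
    _ = _ := by
        rw [lintegral_const_mul' _ _ ENNReal.ofReal_ne_top, ← mul_assoc,
          ← ENNReal.ofReal_mul (by positivity)]
        rfl

/-- A chord of the unit circle is at most as long as its arc. -/
theorem norm_circleExp_sub_one_le (u : ℝ) : ‖(Circle.exp u : ℂ) - 1‖ ≤ |u| := by
  have := Real.norm_exp_I_mul_ofReal_sub_one_le (x := u)
  simpa [Circle.coe_exp, mul_comm] using this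

/-- Jordan's inequality: a chord is at least `2 / π` times as long as the shorter arc. -/
theorem le_norm_circleExp_sub_one {u : ℝ} (hu : |u| ≤ Real.pi) :
    2 / Real.pi * |u| ≤ ‖(Circle.exp u : ℂ) - 1‖ := by
  have h1 : ‖(Circle.exp u : ℂ) - 1‖ = |2 * Real.sin (u / 2)| := by
    have := Complex.norm_exp_I_mul_ofReal_sub_one u
    rw [← Real.norm_eq_abs, ← this, Circle.coe_exp, mul_comm]
  rw [h1, abs_mul, abs_two, Real.abs_sin_eq_sin_abs_of_abs_le_pi (by
    rw [abs_div, abs_two]; linarith [Real.pi_pos]), abs_div, abs_two]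
  have := Real.mul_le_sin (x := |u| / 2) (by positivity) (by linarith)
  linarith

/-! ### Polar coordinates and the Möbius invariant form of the energy -/

theorem setLIntegral_Ioc_comp_add_right (f : ℝ → ENNReal) (a b u : ℝ) :
    ∫⁻ x in Ioc a b, f (x + u) = ∫⁻ x in Ioc (a + u) (b + u), f x := by
  have := (measurePreserving_add_right (volume : Measure ℝ) u).setLIntegral_comp_preimage_emb
    (MeasurableEquiv.addRight u).measurableEmbedding f (Ioc (a + u) (b + u))
  simpa using this

theorem setLIntegral_Ioc_comp_neg (f : ℝ → ENNReal) (a b : ℝ) :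
    ∫⁻ x in Ioc a b, f (-x) = ∫⁻ x in Ioc (-b) (-a), f x := by
  have := (Measure.measurePreserving_neg (volume : Measure ℝ)).setLIntegral_comp_preimage_emb
    (MeasurableEquiv.neg ℝ).measurableEmbedding f (Ico (-b) (-a))
  rw [← setLIntegral_congr (Ico_ae_eq_Ioc (a := -b))]
  simpa using this

theorem setLIntegral_Ioc_comp_mul {c : ℝ} (hc : 0 < c) (f : ℝ → ENNReal) (A : ℝ) :
    ∫⁻ x in Ioc 0 (c * A), f x = ENNReal.ofReal c * ∫⁻ x in Ioc 0 A, f (c * x) := by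
  have h : Ioc 0 (c * A) = (fun x => c * x) '' Ioc 0 A := by
    rw [image_mul_left_Ioc hc, mul_zero]
  rw [h, lintegral_image_eq_lintegral_abs_deriv_mul measurableSet_Ioc
    (fun x _ => (hasDerivAt_const_mul c).hasDerivWithinAt)
    (mul_right_injective₀ hc.ne').injOn]
  simp only [abs_of_pos hc]
  rw [lintegral_const_mul' _ _ ENNReal.ofReal_ne_top]

theorem Function.Periodic.setLIntegral_Ioc_eq {f : ℝ → ENNReal} {T : ℝ}
    (hf : Function.Periodic f T) (hT : 0 < T) (a b : ℝ) :
    ∫⁻ x in Ioc a (a + T), f x = ∫⁻ x in Ioc b (b + T), f x :=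
  (isAddFundamentalDomain_Ioc hT a).setLIntegral_eq (isAddFundamentalDomain_Ioc hT b) f
    hf.map_vadd_zmultiples

theorem mem_unitDisc {z : ℂ} : z ∈ unitDisc ↔ ‖z‖ < 1 := by simp [unitDisc]

theorem isOpen_unitDisc : IsOpen unitDisc := Metric.isOpen_ball

/-- The integral over the disc in the polar coordinates `z = (1 - x) e^{iθ}`. -/
theorem setLIntegral_unitDisc_eq {h : ℂ → ENNReal} (hh : Measurable h) (c : ℝ) :
    ∫⁻ z in unitDisc, h z = ∫⁻ x in Ioo (0 : ℝ) 1, ∫⁻ θ in Ioc c (c + 2 * Real.pi),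
      ENNReal.ofReal (1 - x) * h (((1 - x : ℝ) : ℂ) * (Circle.exp θ : ℂ)) := by
  set P : ℝ → ℝ → ENNReal := fun r θ => ENNReal.ofReal r * h ((r : ℂ) * (Circle.exp θ : ℂ)) with hP
  have hPm : Measurable (Function.uncurry P) := by
    have : Measurable fun z : ℝ × ℝ => (z.1 : ℂ) * (Circle.exp z.2 : ℂ) := by fun_prop
    exact (by fun_prop : Measurable fun z : ℝ × ℝ => ENNReal.ofReal z.1).mul (hh.comp this)
  have h1 : ∫⁻ z in unitDisc, h z = ∫⁻ r in Ioo (0 : ℝ) 1, ∫⁻ θ in Ioo (-Real.pi) Real.pi, P r θ := by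
    rw [← lintegral_indicator isOpen_unitDisc.measurableSet,
      ← Complex.lintegral_comp_polarCoord_symm, polarCoord_target,
      Measure.volume_eq_prod, ← Measure.prod_restrict, lintegral_prod]
    · rw [← lintegral_indicator measurableSet_Ioi, ← lintegral_indicator measurableSet_Ioo]
      refine lintegral_congr fun r => ?_
      by_cases hr0 : 0 < r
      · by_cases hr1 : r < 1
        · simp only [indicator, mem_Ioi, hr0, if_true, mem_Ioo, hr1, and_self, hP]
          refine lintegral_congr fun θ => ?_
          have : ‖(r : ℂ) * (Circle.exp θ : ℂ)‖ < 1 := by simp [abs_of_pos hr0, hr1]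
          have e : Complex.polarCoord.symm (r, θ) = (r : ℂ) * (Circle.exp θ : ℂ) := by
            rw [Complex.polarCoord_symm_apply, Circle.coe_exp, Complex.exp_mul_I]
            simp
          rw [e, if_pos (mem_unitDisc.2 this), smul_eq_mul]
        · simp only [indicator, mem_Ioi, hr0, if_true, mem_Ioo, hr1, and_false, if_false]
          rw [lintegral_eq_zero_of_ae_eq_zero]
          refine Eventually.of_forall fun θ => ?_
          have : ¬ Complex.polarCoord.symm (r, θ) ∈ unitDisc := by
            rw [mem_unitDisc, Complex.norm_polarCoord_symm, abs_of_pos hr0]; exact hr1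
          simp only [if_neg this, smul_zero, Pi.zero_apply]
      · simp [indicator, hr0]
    · refine Measurable.aemeasurable ?_
      refine Measurable.mul (by fun_prop : Measurable fun z : ℝ × ℝ => ENNReal.ofReal z.1) ?_
      refine (hh.indicator isOpen_unitDisc.measurableSet).comp ?_
      have : (Complex.polarCoord.symm : ℝ × ℝ → ℂ) =
          fun z => (z.1 : ℂ) * (Real.cos z.2 + Real.sin z.2 * Complex.I) := by
        ext z; rw [Complex.polarCoord_symm_apply]
      rw [this]
      fun_prop
  have h2 : ∀ r, ∫⁻ θ in Ioo (-Real.pi) Real.pi, P r θ = ∫⁻ θ in Ioc c (c + 2 * Real.pi), P r θ := by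
    intro r
    rw [setLIntegral_congr Ioo_ae_eq_Ioc]
    have hper : Function.Periodic (P r) (2 * Real.pi) := by
      intro θ
      simp only [hP, Circle.periodic_exp θ]
    have := hper.setLIntegral_Ioc_eq Real.two_pi_pos (-Real.pi) c
    rwa [show -Real.pi + 2 * Real.pi = Real.pi by ring] at this
  rw [h1]
  simp only [h2]
  have e := (Measure.measurePreserving_sub_left (volume : Measure ℝ) 1).setLIntegral_comp_preimage_emb
    (MeasurableEquiv.subLeft (1 : ℝ)).measurableEmbedding
    (fun r => ∫⁻ θ in Ioc c (c + 2 * Real.pi), P r θ) (Ioo 0 1)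
  simp only [preimage_const_sub_Ioo, sub_self, sub_zero] at e
  rw [← e]

section Mobius

variable {a z : ℂ}

theorem one_sub_conj_mul_ne_zero (ha : a ∈ unitDisc) (hz : z ∈ unitDisc) :
    1 - starRingEnd ℂ a * z ≠ 0 := by
  rw [mem_unitDisc] at ha hz
  intro h
  have : ‖starRingEnd ℂ a * z‖ = 1 := by rw [← sub_eq_zero.1 h, norm_one]
  rw [norm_mul, RCLike.norm_conj] at this
  nlinarith [norm_nonneg a, norm_nonneg z]

theorem one_sub_norm_sq_mobiusDisc (ha : a ∈ unitDisc) (hz : z ∈ unitDisc) :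
    1 - ‖mobiusDisc a z‖ ^ 2 =
      (1 - ‖a‖ ^ 2) * (1 - ‖z‖ ^ 2) / ‖1 - starRingEnd ℂ a * z‖ ^ 2 := by
  have h := one_sub_conj_mul_ne_zero ha hz
  have h' : ‖1 - starRingEnd ℂ a * z‖ ^ 2 ≠ 0 := by simpa using h
  rw [mobiusDisc, norm_div, div_pow, eq_div_iff h', sub_mul, div_mul_cancel₀ _ h']
  simp only [← Complex.normSq_eq_norm_sq, Complex.normSq_apply, Complex.sub_re, Complex.sub_im,
    Complex.mul_re, Complex.mul_im, Complex.conj_re, Complex.conj_im, Complex.one_re,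
    Complex.one_im]
  ring

theorem one_sub_norm_sq_pos (hz : z ∈ unitDisc) : 0 < 1 - ‖z‖ ^ 2 := by
  rw [mem_unitDisc] at hz
  nlinarith [norm_nonneg z]

theorem mobiusDisc_mem (ha : a ∈ unitDisc) (hz : z ∈ unitDisc) : mobiusDisc a z ∈ unitDisc := by
  have h := one_sub_norm_sq_mobiusDisc ha hz
  have h' : 0 < ‖1 - starRingEnd ℂ a * z‖ := norm_pos_iff.2 (one_sub_conj_mul_ne_zero ha hz)
  have : 0 < 1 - ‖mobiusDisc a z‖ ^ 2 := by
    rw [h]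
    have := one_sub_norm_sq_pos ha
    have := one_sub_norm_sq_pos hz
    positivity
  rw [mem_unitDisc]
  nlinarith [norm_nonneg (mobiusDisc a z)]

theorem mobiusDisc_mobiusDisc (ha : a ∈ unitDisc) (hz : z ∈ unitDisc) :
    mobiusDisc a (mobiusDisc a z) = z := by
  have h1 := one_sub_conj_mul_ne_zero ha hz
  have h2 := one_sub_conj_mul_ne_zero ha (mobiusDisc_mem ha hz)
  have hm : mobiusDisc a z * (1 - starRingEnd ℂ a * z) = a - z := div_mul_cancel₀ _ h1
  rw [mobiusDisc, div_eq_iff h2]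
  linear_combination -hm

theorem image_mobiusDisc (ha : a ∈ unitDisc) : mobiusDisc a '' unitDisc = unitDisc := by
  ext z
  constructor
  · rintro ⟨w, hw, rfl⟩; exact mobiusDisc_mem ha hw
  · exact fun hz => ⟨mobiusDisc a z, mobiusDisc_mem ha hz, mobiusDisc_mobiusDisc ha hz⟩

theorem injOn_mobiusDisc (ha : a ∈ unitDisc) : InjOn (mobiusDisc a) unitDisc := by
  intro z hz w hw h
  rw [← mobiusDisc_mobiusDisc ha hz, h, mobiusDisc_mobiusDisc ha hw]

theorem hasDerivAt_mobiusDisc (ha : a ∈ unitDisc) (hz : z ∈ unitDisc) :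
    HasDerivAt (mobiusDisc a) (-(1 - starRingEnd ℂ a * a) / (1 - starRingEnd ℂ a * z) ^ 2) z := by
  have h := one_sub_conj_mul_ne_zero ha hz
  have h1 : HasDerivAt (fun z => a - z) (-1) z := by simpa using (hasDerivAt_id z).const_sub a
  have h2 : HasDerivAt (fun z => 1 - starRingEnd ℂ a * z) (-starRingEnd ℂ a) z := by
    simpa using ((hasDerivAt_id z).const_mul (starRingEnd ℂ a)).const_sub 1
  have := h1.div h2 h
  convert! this using 1
  congr 1
  ring

theorem norm_deriv_mobiusDisc_mul (ha : a ∈ unitDisc) (hz : z ∈ unitDisc) :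
    ‖-(1 - starRingEnd ℂ a * a) / (1 - starRingEnd ℂ a * z) ^ 2‖ * (1 - ‖z‖ ^ 2) =
      1 - ‖mobiusDisc a z‖ ^ 2 := by
  have h : ‖1 - starRingEnd ℂ a * a‖ = 1 - ‖a‖ ^ 2 := by
    rw [← Complex.normSq_eq_conj_mul_self, ← Complex.ofReal_one, ← Complex.ofReal_sub,
      Complex.norm_real, Complex.normSq_eq_norm_sq, Real.norm_of_nonneg (one_sub_norm_sq_pos ha).le]
  rw [norm_div, norm_neg, h, norm_pow, one_sub_norm_sq_mobiusDisc ha hz]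
  ring

end Mobius

/-- The density of the invariant form of the energy of `f ∘ σ_a`, see
`besovEnergy_comp_mobiusDisc`. -/
noncomputable def invariantDensity (p s : ℝ) (f : ℂ → ℂ) (a z : ℂ) : ENNReal :=
  ENNReal.ofReal (‖deriv f z‖ ^ p * (1 - ‖z‖ ^ 2) ^ (p - 2) * (1 - ‖mobiusDisc a z‖ ^ 2) ^ s)

theorem measurable_mobiusDisc (a : ℂ) : Measurable (mobiusDisc a) := by
  unfold mobiusDisc; fun_prop

theorem measurable_invariantDensity (p s : ℝ) (f : ℂ → ℂ) (a : ℂ) :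
    Measurable (invariantDensity p s f a) := by
  have := measurable_mobiusDisc a
  have := measurable_deriv f
  unfold invariantDensity
  fun_prop

/-- The change of variables `w = σ_a(z)`. Since `|σ_a'(z)| (1 - |z|^2) = 1 - |σ_a(z)|^2` and `σ_a`
is an involution, the powers `p - 2` of the weight and the Jacobian cancel those of `σ_a'`, and
the Möbius transformation is left over in the factor with exponent `s` only. -/
theorem besovEnergy_comp_mobiusDisc {p s : ℝ} {f : ℂ → ℂ} (hf : DifferentiableOn ℂ f unitDisc)
    {a : ℂ} (ha : a ∈ unitDisc) :
    besovEnergy p s (f ∘ mobiusDisc a) = ∫⁻ z in unitDisc, invariantDensity p s f a z := by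
  have hd : ∀ z ∈ unitDisc, HasFDerivWithinAt (mobiusDisc a)
      ((ContinuousLinearMap.toSpanSingleton ℂ
        (-(1 - starRingEnd ℂ a * a) / (1 - starRingEnd ℂ a * z) ^ 2)).restrictScalars ℝ)
        unitDisc z :=
    fun z hz => ((hasDerivAt_mobiusDisc ha hz).hasFDerivAt.restrictScalars ℝ).hasFDerivWithinAt
  conv_rhs => rw [← image_mobiusDisc ha]
  rw [lintegral_image_eq_lintegral_abs_det_fderiv_mul volume isOpen_unitDisc.measurableSet hd
    (injOn_mobiusDisc ha), besovEnergy]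
  refine setLIntegral_congr_fun isOpen_unitDisc.measurableSet fun z hz => ?_
  set d := -(1 - starRingEnd ℂ a * a) / (1 - starRingEnd ℂ a * z) ^ 2 with hdd
  have hdet : ((ContinuousLinearMap.toSpanSingleton ℂ d).restrictScalars ℝ).det = ‖d‖ ^ 2 := by
    simp [ContinuousLinearMap.det, LinearMap.det_restrictScalars, Algebra.norm_complex_eq,
      Complex.normSq_eq_norm_sq]
  have hderiv : deriv (f ∘ mobiusDisc a) z = deriv f (mobiusDisc a z) * d :=
    ((hf.differentiableAt (isOpen_unitDisc.mem_nhds (mobiusDisc_mem ha hz))).hasDerivAt.comp z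
      (hasDerivAt_mobiusDisc ha hz)).deriv
  have hd0 : 0 < ‖d‖ := by
    have h1 := norm_deriv_mobiusDisc_mul ha hz
    have h2 := one_sub_norm_sq_pos (mobiusDisc_mem ha hz)
    rw [← h1] at h2
    exact pos_of_mul_pos_left h2 (one_sub_norm_sq_pos hz).le
  have hz1 := one_sub_norm_sq_pos hz
  rw [hdet, abs_of_nonneg (by positivity), invariantDensity, ← ENNReal.ofReal_mul (by positivity),
    mobiusDisc_mobiusDisc ha hz, ← norm_deriv_mobiusDisc_mul ha hz, hderiv, norm_mul, ← hdd,
    Real.mul_rpow (by positivity) (by positivity), Real.mul_rpow hd0.le hz1.le,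
    Real.rpow_add hz1, Real.rpow_sub hd0, Real.rpow_two]
  congr 1
  field_simp

/-! ### Energy in Carleson boxes and increments of `f` -/

/-- The size `|f'(z)|` at the point `z = (1 - x) e^{iθ}` at depth `x` below the circle. -/
noncomputable def depthDeriv (f : ℂ → ℂ) (x θ : ℝ) : ENNReal :=
  ‖deriv f (((1 - x : ℝ) : ℂ) * (Circle.exp θ : ℂ))‖ₑ

theorem measurable_depthDeriv (f : ℂ → ℂ) : Measurable fun z : ℝ × ℝ => depthDeriv f z.1 z.2 := by
  have h : Measurable fun z : ℝ × ℝ => ((1 - z.1 : ℝ) : ℂ) * (Circle.exp z.2 : ℂ) := by fun_prop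
  exact ((measurable_deriv f).comp h).enorm

theorem Real.rpow_le_two_rpow_abs {t q : ℝ} (h1 : 1 / 2 ≤ t) (h2 : t ≤ 2) : t ^ q ≤ 2 ^ |q| := by
  rcases le_or_gt 0 q with hq | hq
  · rw [abs_of_nonneg hq]
    exact Real.rpow_le_rpow (by linarith) h2 hq
  · rw [abs_of_neg hq, ← inv_inv t, Real.inv_rpow (by positivity), ← Real.rpow_neg (by positivity)]
    refine Real.rpow_le_rpow (by positivity) ?_ (by linarith)
    rw [inv_le_comm₀ (by linarith) two_pos]
    linarith

theorem Real.rpow_le_two_rpow_abs_mul {x y q : ℝ} (hx : 0 < x) (h1 : y ≤ 2 * x) (h2 : x ≤ 2 * y) :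
    x ^ q ≤ 2 ^ |q| * y ^ q := by
  have hy : 0 < y := by linarith
  have : (x / y) ^ q ≤ 2 ^ |q| :=
    Real.rpow_le_two_rpow_abs (by rw [le_div_iff₀ hy]; linarith) (by rw [div_le_iff₀ hy]; linarith)
  rwa [Real.div_rpow hx.le hy.le, div_le_iff₀ (by positivity)] at this

theorem conj_mul_polar (ρ m r θ : ℝ) :
    starRingEnd ℂ ((ρ : ℂ) * (Circle.exp m : ℂ)) * ((r : ℂ) * (Circle.exp θ : ℂ)) =
      ((ρ * r : ℝ) : ℂ) * (Circle.exp (θ - m) : ℂ) := by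
  rw [map_mul, Complex.conj_ofReal, ← Circle.coe_inv_eq_conj, Circle.exp_sub, div_eq_mul_inv,
    Circle.coe_mul]
  push_cast
  ring

theorem norm_one_sub_mul_circleExp_le {κ u : ℝ} (h0 : 0 ≤ κ) (h1 : κ ≤ 1) :
    ‖1 - (κ : ℂ) * (Circle.exp u : ℂ)‖ ≤ (1 - κ) + |u| := by
  have e : 1 - (κ : ℂ) * (Circle.exp u : ℂ) =
      ((1 - κ : ℝ) : ℂ) - κ * ((Circle.exp u : ℂ) - 1) := by
    push_cast; ring
  rw [e]
  refine (norm_sub_le _ _).trans ?_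
  rw [Complex.norm_real, Real.norm_of_nonneg (by linarith), norm_mul, Complex.norm_real,
    Real.norm_of_nonneg h0]
  have := norm_circleExp_sub_one_le u
  have := mul_le_mul h1 this (norm_nonneg _) zero_le_one
  linarith

theorem norm_real_mul_circle (r : ℝ) (ζ : Circle) : ‖(r : ℂ) * (ζ : ℂ)‖ = |r| := by
  simp [Circle.norm_coe]

/-- The energies of all `f ∘ σ_a` control `|f'|^p (1 - |z|)^{p-2+s}` on Carleson boxes: for `a`
below the middle of an arc of length `l`, at depth `l / 8`, the factor `1 - |σ_a|^2` is at least a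
multiple of `(1 - |z|) / l` in the box. -/
theorem carlesonBox_le {p s : ℝ} (hp : 1 < p) (hs0 : 0 < s) :
    ∃ C : NNReal, ∀ (f : ℂ → ℂ) (M : ENNReal),
      (∀ a ∈ unitDisc, ∫⁻ z in unitDisc, invariantDensity p s f a z ≤ M) →
      ∀ b l : ℝ, l ∈ Ioc 0 (2 * Real.pi) →
        ∫⁻ x in Ioc 0 (1 / (4 * Real.pi) * l), ∫⁻ θ in Ioc b (b + l),
          depthDeriv f x θ ^ p * ENNReal.ofReal (x ^ (p - 2 + s)) ≤
            C * M * ENNReal.ofReal (l ^ s) := by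
  refine ⟨(2 * 2 ^ |p - 2| * 8 ^ s : ℝ).toNNReal, fun f M hM b l hl => ?_⟩
  have hl0 : 0 < l := hl.1
  have hπ := Real.pi_gt_three
  have hπ' := Real.pi_lt_four
  set m := b + l / 2 with hm
  set a : ℂ := ((1 - l / 8 : ℝ) : ℂ) * (Circle.exp m : ℂ) with ha
  have hna : ‖a‖ = 1 - l / 8 := by
    rw [ha, norm_real_mul_circle, abs_of_nonneg]; linarith [hl.2]
  have haD : a ∈ unitDisc := by rw [mem_unitDisc, hna]; linarith
  have hx1 : 1 / (4 * Real.pi) * l ≤ 1 / 2 := by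
    rw [one_div_mul_eq_div, div_le_iff₀ (by positivity)]; linarith [hl.2]
  have hx2 : 1 / (4 * Real.pi) * l ≤ l / 12 := by
    rw [one_div_mul_eq_div, div_le_div_iff₀ (by positivity) (by norm_num)]; nlinarith
  have key : ∀ x ∈ Ioc 0 (1 / (4 * Real.pi) * l), ∀ θ ∈ Ioc b (b + l),
      depthDeriv f x θ ^ p * ENNReal.ofReal (x ^ (p - 2 + s)) ≤
        ENNReal.ofReal (2 * 2 ^ |p - 2| * 8 ^ s * l ^ s) * (ENNReal.ofReal (1 - x) *
          invariantDensity p s f a (((1 - x : ℝ) : ℂ) * (Circle.exp θ : ℂ))) := by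
    intro x hx θ hθ
    have hx0 : 0 < x := hx.1
    have hxh : x ≤ 1 / 2 := hx.2.trans hx1
    set z : ℂ := ((1 - x : ℝ) : ℂ) * (Circle.exp θ : ℂ) with hz
    have hnz : ‖z‖ = 1 - x := by rw [hz, norm_real_mul_circle, abs_of_nonneg]; linarith
    have hzD : z ∈ unitDisc := by rw [mem_unitDisc, hnz]; linarith
    have hden : ‖1 - starRingEnd ℂ a * z‖ ≤ l := by
      rw [ha, hz, conj_mul_polar]
      refine (norm_one_sub_mul_circleExp_le ?_ ?_).trans ?_
      · nlinarith [hl.2]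
      · nlinarith [hl.2]
      · have : |θ - m| ≤ l / 2 := by
          rw [abs_le]; constructor <;> linarith [hθ.1, hθ.2]
        have := hx.2.trans hx2
        nlinarith
    have hden0 : 0 < ‖1 - starRingEnd ℂ a * z‖ := norm_pos_iff.2 (one_sub_conj_mul_ne_zero haD hzD)
    have hσ : x ≤ 8 * l * (1 - ‖mobiusDisc a z‖ ^ 2) := by
      rw [one_sub_norm_sq_mobiusDisc haD hzD, mul_div_assoc', le_div_iff₀ (by positivity)]
      have h1 : ‖1 - starRingEnd ℂ a * z‖ ^ 2 ≤ l ^ 2 := by gcongr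
      have h2 : l / 8 ≤ 1 - ‖a‖ ^ 2 := by rw [hna]; nlinarith [hl.2]
      have h3 : x ≤ 1 - ‖z‖ ^ 2 := by rw [hnz]; nlinarith
      calc x * ‖1 - starRingEnd ℂ a * z‖ ^ 2 ≤ x * l ^ 2 := by gcongr
        _ = 8 * l * (l / 8 * x) := by ring
        _ ≤ _ := by gcongr; linarith
    have hσ0 : 0 < 1 - ‖mobiusDisc a z‖ ^ 2 := one_sub_norm_sq_pos (mobiusDisc_mem haD hzD)
    have hσs : x ^ s ≤ 8 ^ s * l ^ s * (1 - ‖mobiusDisc a z‖ ^ 2) ^ s := by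
      rw [← Real.mul_rpow (by norm_num) hl0.le, ← Real.mul_rpow (by positivity) hσ0.le]
      exact Real.rpow_le_rpow hx0.le hσ hs0.le
    have hzx : x ^ (p - 2) ≤ 2 ^ |p - 2| * (1 - ‖z‖ ^ 2) ^ (p - 2) := by
      refine Real.rpow_le_two_rpow_abs_mul hx0 ?_ ?_ <;> rw [hnz] <;> nlinarith
    have hz0 := one_sub_norm_sq_pos hzD
    rw [depthDeriv, ← hz, ← ofReal_norm, ENNReal.ofReal_rpow_of_nonneg (norm_nonneg _)
      (by linarith), invariantDensity, ← ENNReal.ofReal_mul (by positivity),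
      ← ENNReal.ofReal_mul (by linarith), ← ENNReal.ofReal_mul (by positivity)]
    refine ENNReal.ofReal_le_ofReal ?_
    rw [Real.rpow_add hx0]
    calc ‖deriv f z‖ ^ p * (x ^ (p - 2) * x ^ s)
        ≤ ‖deriv f z‖ ^ p * ((2 ^ |p - 2| * (1 - ‖z‖ ^ 2) ^ (p - 2)) *
          (8 ^ s * l ^ s * (1 - ‖mobiusDisc a z‖ ^ 2) ^ s)) * (2 * (1 - x)) := by
          have hx2' : 1 ≤ 2 * (1 - x) := by linarith
          refine le_trans ?_ (le_mul_of_one_le_right (by positivity) hx2')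
          gcongr
      _ = _ := by ring
  calc _ ≤ ∫⁻ x in Ioc 0 (1 / (4 * Real.pi) * l), ∫⁻ θ in Ioc b (b + l),
        ENNReal.ofReal (2 * 2 ^ |p - 2| * 8 ^ s * l ^ s) * (ENNReal.ofReal (1 - x) *
          invariantDensity p s f a (((1 - x : ℝ) : ℂ) * (Circle.exp θ : ℂ))) :=
        setLIntegral_mono' measurableSet_Ioc fun x hx =>
          setLIntegral_mono' measurableSet_Ioc fun θ hθ => key x hx θ hθ
    _ = ENNReal.ofReal (2 * 2 ^ |p - 2| * 8 ^ s * l ^ s) *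
        ∫⁻ x in Ioc 0 (1 / (4 * Real.pi) * l), ∫⁻ θ in Ioc b (b + l), ENNReal.ofReal (1 - x) *
          invariantDensity p s f a (((1 - x : ℝ) : ℂ) * (Circle.exp θ : ℂ)) := by
        simp only [lintegral_const_mul' _ _ ENNReal.ofReal_ne_top]
    _ ≤ ENNReal.ofReal (2 * 2 ^ |p - 2| * 8 ^ s * l ^ s) *
        ∫⁻ x in Ioo 0 1, ∫⁻ θ in Ioc b (b + 2 * Real.pi), ENNReal.ofReal (1 - x) *
          invariantDensity p s f a (((1 - x : ℝ) : ℂ) * (Circle.exp θ : ℂ)) := by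
        gcongr ENNReal.ofReal (2 * 2 ^ |p - 2| * 8 ^ s * l ^ s) * ?_
        have hsub : Ioc 0 (1 / (4 * Real.pi) * l) ⊆ Ioo 0 1 :=
          fun x hx => ⟨hx.1, by linarith [hx.2]⟩
        exact (lintegral_mono_set hsub).trans (lintegral_mono fun x =>
          lintegral_mono_set (Ioc_subset_Ioc_right (by linarith [hl.2])))
    _ ≤ ENNReal.ofReal (2 * 2 ^ |p - 2| * 8 ^ s * l ^ s) * M := by
        rw [← setLIntegral_unitDisc_eq (measurable_invariantDensity p s f a)]
        gcongr
        exact hM a haD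
    _ = _ := by
        rw [ENNReal.ofReal_mul (by positivity), mul_right_comm]; rfl

/-- The radial limit `L` at the angle `θ` is reached along the radius from depth `h`. -/
theorem enorm_sub_le_lintegral_depthDeriv_radial {f : ℂ → ℂ} (hf : DifferentiableOn ℂ f unitDisc)
    {θ : ℝ} {L : ℂ} (hL : Tendsto (fun r : ℝ => f ((r : ℂ) * (Circle.exp θ : ℂ))) (𝓝[<] 1) (𝓝 L))
    {h : ℝ} (h0 : 0 < h) (h1 : h < 1) :
    ‖L - f (((1 - h : ℝ) : ℂ) * (Circle.exp θ : ℂ))‖ₑ ≤ ∫⁻ x in Ioc 0 h, depthDeriv f x θ := by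
  have hT : Tendsto (fun x : ℝ => ‖f (((1 - x : ℝ) : ℂ) * (Circle.exp θ : ℂ)) -
      f (((1 - h : ℝ) : ℂ) * (Circle.exp θ : ℂ))‖ₑ) (𝓝[>] 0)
      (𝓝 ‖L - f (((1 - h : ℝ) : ℂ) * (Circle.exp θ : ℂ))‖ₑ) := by
    have h2 : Tendsto (fun x : ℝ => 1 - x) (𝓝[>] 0) (𝓝[<] 1) := by
      refine tendsto_nhdsWithin_iff.2 ⟨?_, ?_⟩
      · have : Tendsto (fun x : ℝ => 1 - x) (𝓝 0) (𝓝 (1 - 0)) :=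
          (continuous_const.sub continuous_id).tendsto 0
        rw [sub_zero] at this
        exact this.mono_left nhdsWithin_le_nhds
      · filter_upwards [self_mem_nhdsWithin] with x hx
        simpa using hx
    exact ((hL.comp h2).sub_const _).enorm
  refine le_of_tendsto hT ?_
  filter_upwards [Ioo_mem_nhdsGT h0] with x hx
  set γ : ℝ → ℂ := fun y => f (((1 - y : ℝ) : ℂ) * (Circle.exp θ : ℂ)) with hγ
  have hmem : ∀ y ∈ Icc x h, ((1 - y : ℝ) : ℂ) * (Circle.exp θ : ℂ) ∈ unitDisc := by
    intro y hy
    rw [mem_unitDisc, norm_real_mul_circle, abs_of_nonneg] <;> linarith [hy.1, hy.2, hx.1]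
  have hpath : ∀ y, HasDerivAt (fun y : ℝ => ((1 - y : ℝ) : ℂ) * (Circle.exp θ : ℂ))
      (-(Circle.exp θ : ℂ)) y := by
    intro y
    have := (((hasDerivAt_id y).const_sub 1).ofReal_comp).mul_const (Circle.exp θ : ℂ)
    simpa using this
  have hcd : ContDiffOn ℝ 1 γ (Icc x h) := by
    have h3 : ContDiffOn ℝ 1 f unitDisc := (hf.contDiffOn isOpen_unitDisc).restrict_scalars ℝ
    refine h3.comp (ContDiff.contDiffOn ?_) hmem
    have : ContDiff ℝ 1 (fun y : ℝ => ((1 - y : ℝ) : ℂ)) :=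
      Complex.ofRealCLM.contDiff.comp (contDiff_const.sub contDiff_id)
    exact this.mul contDiff_const
  have := enorm_sub_le_lintegral_deriv_of_contDiffOn_Icc hcd hx.2.le
  rw [enorm_sub_rev]
  refine this.trans ?_
  calc _ = ∫⁻ y in Icc x h, depthDeriv f y θ := by
        refine setLIntegral_congr_fun measurableSet_Icc fun y hy => ?_
        have h4 := (hf.differentiableAt (isOpen_unitDisc.mem_nhds (hmem y hy))).hasDerivAt.scomp y
          (hpath y)
        have h5 : deriv γ y = _ := h4.deriv
        rw [h5, smul_eq_mul, enorm_mul, depthDeriv]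
        have : ‖-(Circle.exp θ : ℂ)‖ₑ = 1 := by rw [← ofReal_norm, norm_neg, Circle.norm_coe]; simp
        rw [this, one_mul]
    _ ≤ _ := lintegral_mono_set (show Icc x h ⊆ Ioc 0 h from
        fun y hy => ⟨hx.1.trans_le hy.1, hy.2⟩)

theorem enorm_sub_le_lintegral_depthDeriv_angular {f : ℂ → ℂ} (hf : DifferentiableOn ℂ f unitDisc)
    (θ : ℝ) {u h : ℝ} (hu : 0 ≤ u) (h0 : 0 < h) (h1 : h < 1) :
    ‖f (((1 - h : ℝ) : ℂ) * (Circle.exp (θ + u) : ℂ)) -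
      f (((1 - h : ℝ) : ℂ) * (Circle.exp θ : ℂ))‖ₑ ≤ ∫⁻ v in Ioc θ (θ + u), depthDeriv f h v := by
  set γ : ℝ → ℂ := fun v => f (((1 - h : ℝ) : ℂ) * (Circle.exp v : ℂ)) with hγ
  have hmem : ∀ v, ((1 - h : ℝ) : ℂ) * (Circle.exp v : ℂ) ∈ unitDisc := by
    intro v
    rw [mem_unitDisc, norm_real_mul_circle, abs_of_nonneg] <;> linarith
  have hpath : ∀ v, HasDerivAt (fun v : ℝ => ((1 - h : ℝ) : ℂ) * (Circle.exp v : ℂ))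
      (((1 - h : ℝ) : ℂ) * ((Circle.exp v : ℂ) * Complex.I)) v := by
    intro v
    have h2 : HasDerivAt (fun v : ℝ => Complex.exp (v * Complex.I))
        (Complex.exp (v * Complex.I) * Complex.I) v := by
      simpa using ((hasDerivAt_id v).ofReal_comp.mul_const Complex.I).cexp
    simp only [Circle.coe_exp]
    exact h2.const_mul _
  have hcd : ContDiff ℝ 1 γ := by
    have h3 : ContDiffOn ℝ 1 f unitDisc := (hf.contDiffOn isOpen_unitDisc).restrict_scalars ℝ
    refine h3.comp_contDiff ?_ hmem
    simp only [Circle.coe_exp]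
    have : ContDiff ℝ 1 (fun y : ℝ => (y : ℂ) * Complex.I) :=
      Complex.ofRealCLM.contDiff.mul contDiff_const
    exact contDiff_const.mul this.cexp
  refine (enorm_sub_le_lintegral_deriv_of_contDiffOn_Icc (f := γ) hcd.contDiffOn
    (by linarith)).trans ?_
  rw [setLIntegral_congr Ioc_ae_eq_Icc]
  refine lintegral_mono fun v => ?_
  have h4 := (hf.differentiableAt (isOpen_unitDisc.mem_nhds (hmem v))).hasDerivAt.scomp v (hpath v)
  have h5 : deriv γ v = _ := h4.deriv
  rw [h5, depthDeriv, ← ofReal_norm, ← ofReal_norm]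
  refine ENNReal.ofReal_le_ofReal ?_
  rw [smul_eq_mul, norm_mul, norm_mul, norm_mul, Complex.norm_real, Circle.norm_coe, Complex.norm_I,
    Real.norm_of_nonneg (by linarith)]
  exact mul_le_of_le_one_left (norm_nonneg _) (by linarith)

/-! ### Increments of the boundary values -/

theorem ENNReal.add_add_rpow_le {p : ℝ} (hp : 1 ≤ p) (x y z : ENNReal) :
    (x + y + z) ^ p ≤ 4 ^ (p - 1) * (x ^ p + y ^ p + z ^ p) := by
  have h2 : (1 : ENNReal) ≤ 2 ^ (p - 1) := by
    simpa using ENNReal.rpow_le_rpow (z := p - 1) (by norm_num : (1 : ENNReal) ≤ 2) (by linarith)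
  have h4 : (4 : ENNReal) ^ (p - 1) = 2 ^ (p - 1) * 2 ^ (p - 1) := by
    rw [← ENNReal.mul_rpow_of_nonneg _ _ (by linarith)]; norm_num
  calc (x + y + z) ^ p ≤ 2 ^ (p - 1) * ((x + y) ^ p + z ^ p) :=
        ENNReal.rpow_add_le_mul_rpow_add_rpow _ _ hp
    _ ≤ 2 ^ (p - 1) * (2 ^ (p - 1) * (x ^ p + y ^ p) + 2 ^ (p - 1) * z ^ p) := by
        gcongr
        · exact ENNReal.rpow_add_le_mul_rpow_add_rpow _ _ hp
        · exact le_mul_of_one_le_left zero_le h2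
    _ = _ := by rw [h4]; ring

/-- The `p`-th power of the increment of `G` from `θ` to `θ + u`. -/
noncomputable def increment (p : ℝ) (G : ℝ → ℂ) (θ u : ℝ) : ENNReal := ‖G (θ + u) - G θ‖ₑ ^ p

theorem measurable_increment {p : ℝ} {G : ℝ → ℂ} (hG : Measurable G) :
    Measurable fun z : ℝ × ℝ => increment p G z.1 z.2 := by
  unfold increment; fun_prop

theorem lintegral_lintegral_window_le {ψ : ℝ → ENNReal} (hψ : Measurable ψ) (b l u : ℝ) :
    ∫⁻ θ in Ioc b (b + l), ∫⁻ v in Ioc θ (θ + u), ψ v ≤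
      ENNReal.ofReal u * ∫⁻ v in Ioc b (b + l + u), ψ v := by
  have h1 : ∀ θ, ∫⁻ v in Ioc θ (θ + u), ψ v = ∫⁻ w in Ioc 0 u, ψ (w + θ) := by
    intro θ
    rw [setLIntegral_Ioc_comp_add_right, zero_add, add_comm u]
  simp only [h1]
  rw [lintegral_lintegral_swap (by fun_prop)]
  calc _ ≤ ∫⁻ _w in Ioc 0 u, ∫⁻ v in Ioc b (b + l + u), ψ v := by
        refine setLIntegral_mono' measurableSet_Ioc fun w hw => ?_
        simp only [add_comm w]
        rw [setLIntegral_Ioc_comp_add_right]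
        exact lintegral_mono_set (Ioc_subset_Ioc (by linarith [hw.1]) (by linarith [hw.2]))
    _ = _ := by simp [mul_comm]

theorem measurable_depthDeriv_left (f : ℂ → ℂ) (θ : ℝ) : Measurable fun x => depthDeriv f x θ :=
  (measurable_depthDeriv f).comp (f := fun x => (x, θ)) (by fun_prop)

theorem measurable_depthDeriv_right (f : ℂ → ℂ) (x : ℝ) : Measurable (depthDeriv f x) :=
  (measurable_depthDeriv f).comp (f := fun θ => (x, θ)) (by fun_prop)

/-- The length of the image under `f` of the radial segment of depth `h` below the angle `θ`. -/
noncomputable def radialLength (f : ℂ → ℂ) (h θ : ℝ) : ENNReal := ∫⁻ x in Ioc 0 h, depthDeriv f x θ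

theorem measurable_radialLength (f : ℂ → ℂ) :
    Measurable fun z : ℝ × ℝ => radialLength f z.1 z.2 := by
  have h : ∀ z : ℝ × ℝ, radialLength f z.1 z.2 =
      ∫⁻ x, {w : (ℝ × ℝ) × ℝ | w.2 ∈ Ioc 0 w.1.1}.indicator (fun w => depthDeriv f w.2 w.1.2)
        (z, x) := by
    intro z
    rw [radialLength, ← lintegral_indicator measurableSet_Ioc]
    rfl
  simp only [h]
  refine Measurable.lintegral_prod_right' ?_
  refine Measurable.indicator ?_ ?_
  · exact (measurable_depthDeriv f).comp (f := fun w : (ℝ × ℝ) × ℝ => (w.2, w.1.2)) (by fun_prop)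
  · exact (measurableSet_lt measurable_const measurable_snd).inter
      (measurableSet_le measurable_snd (by fun_prop))

theorem measurable_radialLength_mul (f : ℂ → ℂ) (c : ℝ) :
    Measurable fun z : ℝ × ℝ => radialLength f (c * z.1) z.2 :=
  (measurable_radialLength f).comp (f := fun z : ℝ × ℝ => (c * z.1, z.2)) (by fun_prop)

theorem measurable_radialLength_right (f : ℂ → ℂ) (h : ℝ) : Measurable (radialLength f h) :=
  (measurable_radialLength f).comp (f := fun θ => (h, θ)) (by fun_prop)

/-- The three parts of the increment of the boundary values from `θ` to `θ + u`: down from `θ` to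
depth `c u`, along the circle at that depth, and up to `θ + u`. -/
theorem setLIntegral_increment_le {p s : ℝ} (hp : 1 < p) {f : ℂ → ℂ} {G : ℝ → ℂ}
    (hf : DifferentiableOn ℂ f unitDisc)
    (hG : ∀ᵐ θ : ℝ, Tendsto (fun r : ℝ => f ((r : ℂ) * (Circle.exp θ : ℂ))) (𝓝[<] 1) (𝓝 (G θ)))
    {c l u : ℝ} (hu0 : 0 < u) (hul : u ≤ l) (hcu0 : 0 < c * u) (hcu1 : c * u < 1) (b : ℝ) :
    ∫⁻ θ in Ioc b (b + l), increment p G θ u * ENNReal.ofReal (u ^ (s - 2)) ≤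
      4 ^ (p - 1) * (2 * (∫⁻ θ in Ioc b (b + 2 * l),
          radialLength f (c * u) θ ^ p * ENNReal.ofReal (u ^ (s - 2))) +
        ENNReal.ofReal (u ^ (p - 2 + s)) *
          ∫⁻ v in Ioc b (b + 2 * l), depthDeriv f (c * u) v ^ p) := by
  have hAm := measurable_radialLength_right f (c * u)
  have hφm := measurable_depthDeriv_right f (c * u)
  have hG' : ∀ᵐ θ : ℝ, Tendsto (fun r : ℝ => f ((r : ℂ) * (Circle.exp (θ + u) : ℂ))) (𝓝[<] 1)
      (𝓝 (G (θ + u))) :=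
    (measurePreserving_add_right volume u).quasiMeasurePreserving.ae hG
  have hpt : ∀ᵐ θ : ℝ, increment p G θ u ≤
      4 ^ (p - 1) * (radialLength f (c * u) θ ^ p + radialLength f (c * u) (θ + u) ^ p +
        (∫⁻ v in Ioc θ (θ + u), depthDeriv f (c * u) v) ^ p) := by
    filter_upwards [hG, hG'] with θ h1 h2
    refine le_trans ?_ (ENNReal.add_add_rpow_le hp.le _ _ _)
    rw [increment]
    refine ENNReal.rpow_le_rpow ?_ (by linarith)
    have e1 := enorm_sub_le_lintegral_depthDeriv_radial hf h1 hcu0 hcu1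
    have e2 := enorm_sub_le_lintegral_depthDeriv_radial hf h2 hcu0 hcu1
    have e3 := enorm_sub_le_lintegral_depthDeriv_angular hf θ hu0.le hcu0 hcu1
    rw [enorm_sub_rev] at e1
    set X := f (((1 - c * u : ℝ) : ℂ) * (Circle.exp θ : ℂ))
    set Y := f (((1 - c * u : ℝ) : ℂ) * (Circle.exp (θ + u) : ℂ))
    calc ‖G (θ + u) - G θ‖ₑ = ‖(X - G θ) + (G (θ + u) - Y) + (Y - X)‖ₑ := by congr 1; ring
      _ ≤ ‖X - G θ‖ₑ + ‖G (θ + u) - Y‖ₑ + ‖Y - X‖ₑ :=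
        (enorm_add_le _ _).trans (add_le_add (enorm_add_le _ _) le_rfl)
      _ ≤ _ := add_le_add (add_le_add e1 e2) e3
  have i1 : ∫⁻ θ in Ioc b (b + l), radialLength f (c * u) θ ^ p ≤
      ∫⁻ θ in Ioc b (b + 2 * l), radialLength f (c * u) θ ^ p :=
    lintegral_mono_set (Ioc_subset_Ioc_right (by linarith))
  have i2 : ∫⁻ θ in Ioc b (b + l), radialLength f (c * u) (θ + u) ^ p ≤
      ∫⁻ θ in Ioc b (b + 2 * l), radialLength f (c * u) θ ^ p := by
    rw [setLIntegral_Ioc_comp_add_right (fun θ => radialLength f (c * u) θ ^ p)]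
    exact lintegral_mono_set (Ioc_subset_Ioc (by linarith) (by linarith))
  have i3 : ∫⁻ θ in Ioc b (b + l), (∫⁻ v in Ioc θ (θ + u), depthDeriv f (c * u) v) ^ p ≤
      ENNReal.ofReal (u ^ (p - 1)) * (ENNReal.ofReal u *
        ∫⁻ v in Ioc b (b + 2 * l), depthDeriv f (c * u) v ^ p) := by
    calc _ ≤ ∫⁻ θ in Ioc b (b + l), ENNReal.ofReal (u ^ (p - 1)) *
          ∫⁻ v in Ioc θ (θ + u), depthDeriv f (c * u) v ^ p := by
          refine lintegral_mono fun θ => ?_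
          have := setLIntegral_rpow_le hp (by linarith : θ ≤ θ + u) hφm
          rwa [add_sub_cancel_left] at this
      _ ≤ _ := by
          rw [lintegral_const_mul' _ _ ENNReal.ofReal_ne_top]
          gcongr ENNReal.ofReal (u ^ (p - 1)) * ?_
          refine (lintegral_lintegral_window_le (hφm.pow_const p) b l u).trans ?_
          gcongr ENNReal.ofReal u * ?_
          exact lintegral_mono_set (Ioc_subset_Ioc_right (by linarith))
  have e4 : ENNReal.ofReal (u ^ (p - 1)) * ENNReal.ofReal u * ENNReal.ofReal (u ^ (s - 2)) =
      ENNReal.ofReal (u ^ (p - 2 + s)) := by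
    rw [← ENNReal.ofReal_mul (by positivity), ← ENNReal.ofReal_mul (by positivity)]
    congr 1
    nth_rewrite 2 [← Real.rpow_one u]
    rw [← Real.rpow_add hu0, ← Real.rpow_add hu0]
    congr 1
    ring
  have hAu1 : Measurable fun θ => radialLength f (c * u) θ ^ p := hAm.pow_const p
  have hAu2 : Measurable fun θ => radialLength f (c * u) (θ + u) ^ p :=
    (hAm.comp (measurable_add_const u)).pow_const p
  rw [lintegral_mul_const' _ _ ENNReal.ofReal_ne_top,
    lintegral_mul_const' _ _ ENNReal.ofReal_ne_top]
  calc _ ≤ (∫⁻ θ in Ioc b (b + l), 4 ^ (p - 1) * (radialLength f (c * u) θ ^ p +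
          radialLength f (c * u) (θ + u) ^ p +
          (∫⁻ v in Ioc θ (θ + u), depthDeriv f (c * u) v) ^ p)) * ENNReal.ofReal (u ^ (s - 2)) := by
        gcongr ?_ * _
        exact lintegral_mono_ae (ae_restrict_of_ae hpt)
    _ = 4 ^ (p - 1) * ((∫⁻ θ in Ioc b (b + l), radialLength f (c * u) θ ^ p) +
          (∫⁻ θ in Ioc b (b + l), radialLength f (c * u) (θ + u) ^ p) +
          ∫⁻ θ in Ioc b (b + l), (∫⁻ v in Ioc θ (θ + u), depthDeriv f (c * u) v) ^ p) *
            ENNReal.ofReal (u ^ (s - 2)) := by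
        rw [lintegral_const_mul' _ _ (by finiteness), lintegral_add_left (by fun_prop),
          lintegral_add_left hAu1]
    _ ≤ 4 ^ (p - 1) * ((∫⁻ θ in Ioc b (b + 2 * l), radialLength f (c * u) θ ^ p) +
          (∫⁻ θ in Ioc b (b + 2 * l), radialLength f (c * u) θ ^ p) +
          ENNReal.ofReal (u ^ (p - 1)) * (ENNReal.ofReal u *
            ∫⁻ v in Ioc b (b + 2 * l), depthDeriv f (c * u) v ^ p)) * ENNReal.ofReal (u ^ (s - 2)) := by
        gcongr 4 ^ (p - 1) * ?_ * _
        exact add_le_add (add_le_add i1 i2) i3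
    _ = _ := by rw [← e4]; ring

/-- The integral of `|f'|^p (1 - |z|)^{p-2+s}` over the box of depth `d` below the arc of length
`l` that starts at the angle `b`. -/
noncomputable def boxIntegral (p s : ℝ) (f : ℂ → ℂ) (d b l : ℝ) : ENNReal :=
  ∫⁻ x in Ioc 0 d, ∫⁻ θ in Ioc b (b + l), depthDeriv f x θ ^ p * ENNReal.ofReal (x ^ (p - 2 + s))

theorem boxIntegral_mono_depth {p s : ℝ} {f : ℂ → ℂ} {d d' : ℝ} (h : d ≤ d') (b l : ℝ) :
    boxIntegral p s f d b l ≤ boxIntegral p s f d' b l :=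
  lintegral_mono_set (Ioc_subset_Ioc_right h)

theorem boxIntegral_add {p s : ℝ} {f : ℂ → ℂ} (d b : ℝ) {l l' : ℝ} (hl : 0 ≤ l) (hl' : 0 ≤ l') :
    boxIntegral p s f d b (l + l') = boxIntegral p s f d b l + boxIntegral p s f d (b + l) l' := by
  have hm := measurable_depthDeriv f
  unfold boxIntegral
  rw [← lintegral_add_left]
  · refine lintegral_congr fun x => ?_
    rw [← lintegral_union measurableSet_Ioc (Ioc_disjoint_Ioc_of_le le_rfl),
      Ioc_union_Ioc_eq_Ioc (by linarith) (by linarith), add_assoc]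
  · exact Measurable.lintegral_prod_right' (f := fun z : ℝ × ℝ =>
      depthDeriv f z.1 z.2 ^ p * ENNReal.ofReal (z.1 ^ (p - 2 + s))) (by fun_prop)

/-- The radial parts of the increments are controlled by Hardy's inequality on each radius. -/
theorem lintegral_radial_le {p s c : ℝ} (hp : 1 < p) (hs1 : s < 1) (hc : 0 < c) :
    ∃ C : NNReal, ∀ (f : ℂ → ℂ) (b l d : ℝ),
      ∫⁻ u in Ioc 0 d, ∫⁻ θ in Ioc b (b + l),
        radialLength f (c * u) θ ^ p * ENNReal.ofReal (u ^ (s - 2)) ≤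
      C * boxIntegral p s f (c * d) b l := by
  obtain ⟨C, hC⟩ := hardy_inequality (s := s) hp hs1 hc
  refine ⟨C, fun f b l d => ?_⟩
  have hm := measurable_depthDeriv f
  have hAm := measurable_radialLength_mul f c
  have hA : AEMeasurable (Function.uncurry fun u θ =>
      radialLength f (c * u) θ ^ p * ENNReal.ofReal (u ^ (s - 2)))
      ((volume.restrict (Ioc 0 d)).prod (volume.restrict (Ioc b (b + l)))) :=
    ((hAm.pow_const p).mul (by fun_prop : Measurable fun z : ℝ × ℝ =>
      ENNReal.ofReal (z.1 ^ (s - 2)))).aemeasurable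
  have hB : AEMeasurable (Function.uncurry fun x θ =>
      depthDeriv f x θ ^ p * ENNReal.ofReal (x ^ (p - 2 + s)))
      ((volume.restrict (Ioc 0 (c * d))).prod (volume.restrict (Ioc b (b + l)))) :=
    ((hm.pow_const p).mul (by fun_prop : Measurable fun z : ℝ × ℝ =>
      ENNReal.ofReal (z.1 ^ (p - 2 + s)))).aemeasurable
  rw [boxIntegral, lintegral_lintegral_swap hA, lintegral_lintegral_swap hB,
    ← lintegral_const_mul' _ _ ENNReal.coe_ne_top]
  exact lintegral_mono fun θ => hC d _ (measurable_depthDeriv_left f θ)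

/-- The parts of the increments along the circle at depth `c u` become an integral over a box by the
substitution `x = c u`. -/
theorem lintegral_angular_eq {p s c : ℝ} (hc : 0 < c) (f : ℂ → ℂ) (b l d : ℝ) :
    ∫⁻ u in Ioc 0 d, ENNReal.ofReal (u ^ (p - 2 + s)) *
      ∫⁻ v in Ioc b (b + l), depthDeriv f (c * u) v ^ p =
    ENNReal.ofReal (c ^ (-(p - 1 + s))) * boxIntegral p s f (c * d) b l := by
  have e : ∀ u ∈ Ioc 0 d, ENNReal.ofReal (u ^ (p - 2 + s)) *
      ∫⁻ v in Ioc b (b + l), depthDeriv f (c * u) v ^ p =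
      ENNReal.ofReal (c ^ (-(p - 1 + s))) * (ENNReal.ofReal c *
        ∫⁻ v in Ioc b (b + l),
          depthDeriv f (c * u) v ^ p * ENNReal.ofReal ((c * u) ^ (p - 2 + s))) := by
    intro u hu
    have hu0 : 0 < u := hu.1
    rw [lintegral_mul_const' _ _ ENNReal.ofReal_ne_top]
    have : u ^ (p - 2 + s) = c ^ (-(p - 1 + s)) * c * (c * u) ^ (p - 2 + s) := by
      have e1 : c ^ (-(p - 1 + s)) * c = c ^ (-(p - 2 + s)) := by
        conv_lhs => rw [← Real.rpow_add_one hc.ne']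
        congr 1
        ring
      rw [e1, Real.mul_rpow hc.le hu0.le, ← mul_assoc, ← Real.rpow_add hc, neg_add_cancel,
        Real.rpow_zero, one_mul]
    rw [this, ENNReal.ofReal_mul (by positivity), ENNReal.ofReal_mul (by positivity)]
    ring
  rw [setLIntegral_congr_fun measurableSet_Ioc e, lintegral_const_mul' _ _ ENNReal.ofReal_ne_top,
    lintegral_const_mul' _ _ ENNReal.ofReal_ne_top, boxIntegral,
    setLIntegral_Ioc_comp_mul hc (fun x => ∫⁻ v in Ioc b (b + l), depthDeriv f x v ^ p *
      ENNReal.ofReal (x ^ (p - 2 + s)))]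

/-- The increments of the boundary values of a function in `Q^p_s(𝔻)` with the base angle in an
arc of length `l`. The path from one boundary point to the other stays in boxes to which
`carlesonBox_le` applies. -/
theorem lintegral_increment_mul_le {p s : ℝ} (hp : 1 < p) (hs0 : 0 < s) (hs1 : s < 1) :
    ∃ C : NNReal, ∀ (f : ℂ → ℂ) (G : ℝ → ℂ) (M : ENNReal), DifferentiableOn ℂ f unitDisc →
      (∀ a ∈ unitDisc, ∫⁻ z in unitDisc, invariantDensity p s f a z ≤ M) →
      (∀ᵐ θ : ℝ, Tendsto (fun r : ℝ => f ((r : ℂ) * (Circle.exp θ : ℂ))) (𝓝[<] 1) (𝓝 (G θ))) →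
      ∀ b l : ℝ, l ∈ Ioc 0 (2 * Real.pi) →
        ∫⁻ u in Ioc 0 (min l Real.pi), ∫⁻ θ in Ioc b (b + l),
          increment p G θ u * ENNReal.ofReal (u ^ (s - 2)) ≤ C * M * ENNReal.ofReal (l ^ s) := by
  obtain ⟨C₁, hC₁⟩ := carlesonBox_le hp hs0
  have hπ := Real.pi_pos
  obtain ⟨c, hc⟩ : ∃ c : ℝ, c = 1 / (4 * Real.pi) := ⟨_, rfl⟩
  rw [← hc] at hC₁
  have hc0 : 0 < c := by rw [hc]; positivity
  obtain ⟨C₂, hC₂⟩ := lintegral_radial_le hp hs1 hc0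
  refine ⟨(4 : NNReal) ^ (p - 1) * (2 * C₂ + (c ^ (-(p - 1 + s))).toNNReal) * (2 * C₁),
    fun f G M hf hM hG b l hl => ?_⟩
  have hl0 : 0 < l := hl.1
  obtain ⟨d, hd⟩ : ∃ d, d = min l Real.pi := ⟨_, rfl⟩
  have hdl : d ≤ l := hd ▸ min_le_left _ _
  have hdπ : d ≤ Real.pi := hd ▸ min_le_right _ _
  rw [← hd]
  have hbox : boxIntegral p s f (c * d) b (2 * l) ≤ 2 * C₁ * M * ENNReal.ofReal (l ^ s) := by
    refine (boxIntegral_mono_depth (mul_le_mul_of_nonneg_left hdl hc0.le) _ _).trans ?_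
    rw [two_mul l, boxIntegral_add _ _ hl0.le hl0.le]
    calc _ ≤ _ := add_le_add (hC₁ f M hM b l hl) (hC₁ f M hM (b + l) l hl)
      _ = _ := by ring
  have hAm := measurable_radialLength_mul f c
  have hm1 : Measurable fun u => ∫⁻ θ in Ioc b (b + 2 * l),
      radialLength f (c * u) θ ^ p * ENNReal.ofReal (u ^ (s - 2)) :=
    Measurable.lintegral_prod_right' ((hAm.pow_const p).mul
      (by fun_prop : Measurable fun z : ℝ × ℝ => ENNReal.ofReal (z.1 ^ (s - 2))))
  calc _ ≤ ∫⁻ u in Ioc 0 d, 4 ^ (p - 1) * (2 * (∫⁻ θ in Ioc b (b + 2 * l),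
          radialLength f (c * u) θ ^ p * ENNReal.ofReal (u ^ (s - 2))) +
        ENNReal.ofReal (u ^ (p - 2 + s)) *
          ∫⁻ v in Ioc b (b + 2 * l), depthDeriv f (c * u) v ^ p) := by
        refine setLIntegral_mono' measurableSet_Ioc fun u hu => ?_
        have hu0 : 0 < u := hu.1
        refine setLIntegral_increment_le hp hf hG hu0 (hu.2.trans hdl) (by positivity) ?_ b
        have : u ≤ Real.pi := hu.2.trans hdπ
        rw [hc, one_div_mul_eq_div, div_lt_one (by positivity)]; linarith
    _ ≤ 4 ^ (p - 1) * (2 * (C₂ * boxIntegral p s f (c * d) b (2 * l)) +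
          ENNReal.ofReal (c ^ (-(p - 1 + s))) * boxIntegral p s f (c * d) b (2 * l)) := by
        rw [lintegral_const_mul' _ _ (ENNReal.rpow_ne_top_of_nonneg (by linarith) (by norm_num)),
          lintegral_add_left (hm1.const_mul 2), lintegral_const_mul' _ _ (by norm_num),
          lintegral_angular_eq hc0]
        gcongr
        exact hC₂ f b (2 * l) d
    _ = 4 ^ (p - 1) * (2 * C₂ + ENNReal.ofReal (c ^ (-(p - 1 + s)))) *
          boxIntegral p s f (c * d) b (2 * l) := by ring
    _ ≤ 4 ^ (p - 1) * (2 * C₂ + ENNReal.ofReal (c ^ (-(p - 1 + s)))) *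
        (2 * C₁ * M * ENNReal.ofReal (l ^ s)) := by gcongr
    _ = _ := by
        push_cast
        rw [ENNReal.coe_rpow_of_nonneg _ (by linarith), ENNReal.ofReal]
        push_cast
        ring

/-! ### From the disc to the circle -/

/-- The integrand of the arc energy. -/
noncomputable def arcDensity (p s : ℝ) (g : Circle → ℂ) (θ t : ℝ) : ENNReal :=
  ENNReal.ofReal (‖g (Circle.exp θ) - g (Circle.exp t)‖ ^ p /
      ‖(Circle.exp θ : ℂ) - (Circle.exp t : ℂ)‖ ^ (2 - s))

theorem measurable_arcDensity {p s : ℝ} {g : Circle → ℂ} (hg : Measurable fun θ : ℝ => g (Circle.exp θ)) :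
    Measurable fun z : ℝ × ℝ => arcDensity p s g z.1 z.2 := by
  have h1 : Measurable fun z : ℝ × ℝ => g (Circle.exp z.1) := hg.comp measurable_fst
  have h2 : Measurable fun z : ℝ × ℝ => g (Circle.exp z.2) := hg.comp measurable_snd
  have h3 : Measurable fun z : ℝ × ℝ => (Circle.exp z.1 : ℂ) - (Circle.exp z.2 : ℂ) := by fun_prop
  exact (((h1.sub h2).norm.pow_const p).div (h3.norm.pow_const (2 - s))).ennreal_ofReal

theorem norm_circleExp_add_sub (θ u : ℝ) :
    ‖(Circle.exp θ : ℂ) - (Circle.exp (θ + u) : ℂ)‖ = ‖(Circle.exp u : ℂ) - 1‖ := by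
  rw [Circle.exp_add, Circle.coe_mul, ← mul_one_sub, norm_mul, Circle.norm_coe, one_mul,
    norm_sub_rev]

theorem arcDensity_periodic (p s : ℝ) (g : Circle → ℂ) (θ : ℝ) :
    Function.Periodic (arcDensity p s g θ) (2 * Real.pi) := by
  intro t
  simp only [arcDensity, Circle.periodic_exp t]

theorem ofReal_norm_rpow {p : ℝ} (hp : 0 ≤ p) (z : ℂ) : ENNReal.ofReal (‖z‖ ^ p) = ‖z‖ₑ ^ p := by
  rw [← ofReal_norm, ENNReal.ofReal_rpow_of_nonneg (norm_nonneg _) hp]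

theorem arcDensity_le {p s : ℝ} (hp : 1 < p) (hs1 : s < 1) (g : Circle → ℂ) (θ : ℝ) {u : ℝ}
    (hu0 : u ≠ 0) (hu : |u| ≤ Real.pi) :
    arcDensity p s g θ (θ + u) ≤ ENNReal.ofReal ((Real.pi / 2) ^ (2 - s)) *
      (increment p (fun θ => g (Circle.exp θ)) θ u * ENNReal.ofReal (|u| ^ (s - 2))) := by
  have hπ := Real.pi_pos
  have hu' : 0 < |u| := abs_pos.2 hu0
  rw [arcDensity, increment, norm_circleExp_add_sub, ← ofReal_norm_rpow (by linarith),
    ← ENNReal.ofReal_mul (by positivity), ← ENNReal.ofReal_mul (by positivity)]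
  refine ENNReal.ofReal_le_ofReal ?_
  have h1 := le_norm_circleExp_sub_one hu
  have h2 : (2 / Real.pi * |u|) ^ (2 - s) ≤ ‖(Circle.exp u : ℂ) - 1‖ ^ (2 - s) :=
    Real.rpow_le_rpow (by positivity) h1 (by linarith)
  calc _ ≤ ‖g (Circle.exp θ) - g (Circle.exp (θ + u))‖ ^ p / (2 / Real.pi * |u|) ^ (2 - s) := by
        gcongr
    _ = _ := by
        rw [Real.mul_rpow (by positivity) (by positivity), norm_sub_rev, div_eq_mul_inv, mul_inv,
          ← Real.inv_rpow (by positivity), inv_div, ← Real.rpow_neg (by positivity), neg_sub]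
        ring

theorem lintegral_arcDensity_le (p s : ℝ) (g : Circle → ℂ) {a l θ : ℝ} (hl : l ≤ 2 * Real.pi)
    (hθ : θ ∈ Ioc a (a + l)) :
    ∫⁻ t in Ioc a (a + l), arcDensity p s g θ t ≤
      (∫⁻ u in Ioc 0 (min l Real.pi), arcDensity p s g θ (θ + -u)) +
        ∫⁻ u in Ioc 0 (min l Real.pi), arcDensity p s g θ (θ + u) := by
  have hπ := Real.pi_pos
  have hl0 : 0 ≤ l := by linarith [hθ.1, hθ.2]
  have h1 : ∀ d : ℝ, 0 ≤ d → ∫⁻ t in Ioc (θ - d) (θ + d), arcDensity p s g θ t =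
      (∫⁻ u in Ioc 0 d, arcDensity p s g θ (θ + -u)) +
        ∫⁻ u in Ioc 0 d, arcDensity p s g θ (θ + u) := by
    intro d hd
    rw [setLIntegral_Ioc_comp_neg (fun u => arcDensity p s g θ (θ + u)), neg_zero,
      ← lintegral_union measurableSet_Ioc (Ioc_disjoint_Ioc_of_le le_rfl),
      Ioc_union_Ioc_eq_Ioc (by linarith) hd]
    simp only [add_comm θ]
    rw [setLIntegral_Ioc_comp_add_right]
    congr 3
    ring
  rw [← h1 _ (le_min hl0 hπ.le)]
  rcases le_total l Real.pi with h | h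
  · rw [min_eq_left h]
    exact lintegral_mono_set (Ioc_subset_Ioc (by linarith [hθ.2]) (by linarith [hθ.1]))
  · rw [min_eq_right h]
    calc _ ≤ ∫⁻ t in Ioc a (a + 2 * Real.pi), arcDensity p s g θ t :=
          lintegral_mono_set (Ioc_subset_Ioc_right (by linarith))
      _ = ∫⁻ t in Ioc (θ - Real.pi) (θ - Real.pi + 2 * Real.pi), arcDensity p s g θ t :=
          (arcDensity_periodic p s g θ).setLIntegral_Ioc_eq Real.two_pi_pos _ _
      _ = _ := by congr 3; ring

/-- The bound of the increments, with increments of both signs and with chords in place of arcs. -/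
theorem arcEnergy_le {p s : ℝ} (hp : 1 < p) (hs0 : 0 < s) (hs1 : s < 1) :
    ∃ C : NNReal, ∀ (f : ℂ → ℂ) (g : Circle → ℂ) (M : ENNReal), DifferentiableOn ℂ f unitDisc →
      Measurable (fun θ : ℝ => g (Circle.exp θ)) →
      (∀ a ∈ unitDisc, ∫⁻ z in unitDisc, invariantDensity p s f a z ≤ M) →
      (∀ᵐ θ : ℝ, Tendsto (fun r : ℝ => f ((r : ℂ) * (Circle.exp θ : ℂ))) (𝓝[<] 1)
        (𝓝 (g (Circle.exp θ)))) →
      ∀ a l : ℝ, l ∈ Ioc 0 (2 * Real.pi) →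
        arcEnergy p s g a l ≤ C * M * ENNReal.ofReal (l ^ s) := by
  obtain ⟨C, hC⟩ := lintegral_increment_mul_le hp hs0 hs1
  refine ⟨((Real.pi / 2) ^ (2 - s)).toNNReal * (3 * C), fun f g M hf hg hM hlim a l hl => ?_⟩
  have hl0 : 0 < l := hl.1
  have hB := fun b => hC f (fun θ => g (Circle.exp θ)) M hf hM hlim b l hl
  have hNm : Measurable fun z : ℝ × ℝ => increment p (fun θ => g (Circle.exp θ)) z.1 z.2 :=
    measurable_increment hg
  generalize hN : increment p (fun θ => g (Circle.exp θ)) = N at hB hNm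
  obtain ⟨d, hd⟩ : ∃ d, d = min l Real.pi := ⟨_, rfl⟩
  have hdl : d ≤ l := hd ▸ min_le_left _ _
  have hdπ : d ≤ Real.pi := hd ▸ min_le_right _ _
  simp only [← hd] at hB
  have hneg : ∀ θ u, N θ (-u) = N (θ - u) u := by
    intro θ u
    rw [← hN]
    simp only [increment, sub_add_cancel, ← sub_eq_add_neg]
    rw [enorm_sub_rev]
  have hN1 : Measurable fun z : ℝ × ℝ => N z.1 z.2 * ENNReal.ofReal (z.2 ^ (s - 2)) := by fun_prop
  have hN2 : Measurable fun z : ℝ × ℝ => N (z.1 - z.2) z.2 * ENNReal.ofReal (z.2 ^ (s - 2)) :=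
    hN1.comp (f := fun z : ℝ × ℝ => (z.1 - z.2, z.2)) (by fun_prop)
  have hu : ∀ u ∈ Ioc 0 d, u ≠ 0 ∧ |u| = u ∧ |u| ≤ Real.pi := by
    intro u hu
    have : |u| = u := abs_of_pos hu.1
    exact ⟨hu.1.ne', this, this.symm ▸ hu.2.trans hdπ⟩
  set K := ENNReal.ofReal ((Real.pi / 2) ^ (2 - s)) with hK
  have hKtop : K ≠ ⊤ := ENNReal.ofReal_ne_top
  have i1 : ∫⁻ θ in Ioc a (a + l), ∫⁻ u in Ioc 0 d, N θ u * ENNReal.ofReal (u ^ (s - 2)) ≤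
      C * M * ENNReal.ofReal (l ^ s) := by
    rw [lintegral_lintegral_swap hN1.aemeasurable]
    exact hB a
  have i2 : ∫⁻ θ in Ioc a (a + l), ∫⁻ u in Ioc 0 d, N (θ - u) u * ENNReal.ofReal (u ^ (s - 2)) ≤
      2 * (C * M * ENNReal.ofReal (l ^ s)) := by
    rw [lintegral_lintegral_swap hN2.aemeasurable, two_mul]
    have hm : Measurable fun u => ∫⁻ θ in Ioc (a - l) (a - l + l),
        N θ u * ENNReal.ofReal (u ^ (s - 2)) :=
      Measurable.lintegral_prod_right' (f := fun z : ℝ × ℝ =>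
        N z.2 z.1 * ENNReal.ofReal (z.1 ^ (s - 2))) (hN1.comp measurable_swap)
    refine le_trans ?_ (add_le_add (hB (a - l)) (hB a))
    rw [← lintegral_add_left hm]
    refine setLIntegral_mono' measurableSet_Ioc fun u hu => ?_
    simp only [sub_eq_add_neg]
    rw [setLIntegral_Ioc_comp_add_right (fun θ => N θ u * ENNReal.ofReal (u ^ (s + -2))),
      ← lintegral_union measurableSet_Ioc (Ioc_disjoint_Ioc_of_le (by linarith)),
      neg_add_cancel_right, Ioc_union_Ioc_eq_Ioc (by linarith) (by linarith)]
    exact lintegral_mono_set (Ioc_subset_Ioc (by linarith [hu.2]) (by linarith [hu.1]))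
  have hpt1 : ∀ θ, ∫⁻ u in Ioc 0 d, arcDensity p s g θ (θ + u) ≤
      K * ∫⁻ u in Ioc 0 d, N θ u * ENNReal.ofReal (u ^ (s - 2)) := by
    intro θ
    rw [← lintegral_const_mul' _ _ hKtop]
    refine setLIntegral_mono' measurableSet_Ioc fun u hu' => ?_
    obtain ⟨h0, h1, h2⟩ := hu u hu'
    have := arcDensity_le hp hs1 g θ h0 h2
    rwa [h1, hN] at this
  have hpt2 : ∀ θ, ∫⁻ u in Ioc 0 d, arcDensity p s g θ (θ + -u) ≤
      K * ∫⁻ u in Ioc 0 d, N (θ - u) u * ENNReal.ofReal (u ^ (s - 2)) := by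
    intro θ
    rw [← lintegral_const_mul' _ _ hKtop]
    refine setLIntegral_mono' measurableSet_Ioc fun u hu' => ?_
    obtain ⟨h0, h1, h2⟩ := hu u hu'
    have := arcDensity_le hp hs1 g θ (neg_ne_zero.2 h0) (by rwa [abs_neg])
    rwa [abs_neg, h1, hN, hneg] at this
  have hm1 : Measurable fun θ => K * ∫⁻ u in Ioc 0 d, N (θ - u) u * ENNReal.ofReal (u ^ (s - 2)) :=
    (Measurable.lintegral_prod_right' hN2).const_mul K
  calc arcEnergy p s g a l
      ≤ ∫⁻ θ in Ioc a (a + l), (K * (∫⁻ u in Ioc 0 d, N (θ - u) u * ENNReal.ofReal (u ^ (s - 2))) +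
          K * ∫⁻ u in Ioc 0 d, N θ u * ENNReal.ofReal (u ^ (s - 2))) := by
        refine setLIntegral_mono' measurableSet_Ioc fun θ hθ => ?_
        refine (lintegral_arcDensity_le p s g hl.2 hθ).trans ?_
        rw [← hd]
        exact add_le_add (hpt2 θ) (hpt1 θ)
    _ ≤ K * (2 * (C * M * ENNReal.ofReal (l ^ s))) + K * (C * M * ENNReal.ofReal (l ^ s)) := by
        rw [lintegral_add_left hm1, lintegral_const_mul' _ _ hKtop, lintegral_const_mul' _ _ hKtop]
        gcongr
    _ = _ := by
        rw [hK, ENNReal.ofReal]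
        push_cast
        ring

/-- If the energy of the whole circle is finite, then `∫ |g(θ) - g(t)|^p dt` is finite for some `θ`,
and `g` is in `L^p`. -/
theorem memLp_of_arcEnergy_ne_top {p s : ℝ} (hp : 1 < p) (hs1 : s < 1) {g : Circle → ℂ}
    (hg : Measurable fun θ : ℝ => g (Circle.exp θ)) (h : arcEnergy p s g 0 (2 * Real.pi) ≠ ⊤) :
    MemLp (fun θ : ℝ => g (Circle.exp θ)) (ENNReal.ofReal p)
      (volume.restrict (Ioc 0 (2 * Real.pi))) := by
  have hp0 : 0 < p := by linarith
  have hm : Measurable fun θ => ∫⁻ t in Ioc 0 (2 * Real.pi), arcDensity p s g θ t :=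
    Measurable.lintegral_prod_right' (measurable_arcDensity hg)
  have hE : ∫⁻ θ in Ioc 0 (2 * Real.pi), ∫⁻ t in Ioc 0 (2 * Real.pi),
      arcDensity p s g θ t ≠ ⊤ := by
    rwa [arcEnergy, zero_add] at h
  have hae := ae_lt_top hm hE
  have : (ae (volume.restrict (Ioc 0 (2 * Real.pi)))).NeBot := by
    rw [ae_neBot, ne_eq, Measure.restrict_eq_zero]
    simp [Real.pi_pos]
  obtain ⟨θ, hθ⟩ := hae.exists
  have hd : MemLp (fun t : ℝ => g (Circle.exp t) - g (Circle.exp θ)) (ENNReal.ofReal p)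
      (volume.restrict (Ioc 0 (2 * Real.pi))) := by
    refine ⟨(hg.sub_const _).aestronglyMeasurable, ?_⟩
    rw [eLpNorm_lt_top_iff_lintegral_rpow_enorm_lt_top (by simpa using hp0) ENNReal.ofReal_ne_top,
      ENNReal.toReal_ofReal hp0.le]
    calc _ ≤ ∫⁻ t in Ioc 0 (2 * Real.pi),
          ENNReal.ofReal (2 ^ (2 - s)) * arcDensity p s g θ t := by
          refine lintegral_mono fun t => ?_
          rw [← ofReal_norm_rpow hp0.le, arcDensity, ← ENNReal.ofReal_mul (by positivity)]
          refine ENNReal.ofReal_le_ofReal ?_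
          rw [norm_sub_rev]
          by_cases hz : Circle.exp θ = Circle.exp t
          · simp [hz, Real.zero_rpow hp0.ne']
          · have h0 : 0 < ‖(Circle.exp θ : ℂ) - (Circle.exp t : ℂ)‖ :=
              norm_pos_iff.2 (sub_ne_zero.2 fun e => hz (Circle.ext e))
            have h2 : ‖(Circle.exp θ : ℂ) - (Circle.exp t : ℂ)‖ ≤ 2 := by
              refine (norm_sub_le _ _).trans ?_
              rw [Circle.norm_coe, Circle.norm_coe]; norm_num
            rw [mul_div_assoc', le_div_iff₀ (by positivity), mul_comm]
            gcongr
            linarith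
      _ < ⊤ := by
          rw [lintegral_const_mul' _ _ ENNReal.ofReal_ne_top]
          exact ENNReal.mul_lt_top ENNReal.ofReal_lt_top hθ
  have h3 := hd.add (memLp_const (g (Circle.exp θ)))
  refine h3.congr_norm hg.aestronglyMeasurable (Eventually.of_forall fun t => ?_)
  simp

/-- A function in `Q^p_s(𝔻)` has its boundary function in `Q^p_s(𝕋)`. -/
theorem memQCircle_of_memQDisc {p s : ℝ} (hp : 1 < p) (hs0 : 0 < s) (hs1 : s < 1) {f : ℂ → ℂ}
    {g : Circle → ℂ} (hg : Measurable fun θ : ℝ => g (Circle.exp θ))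
    (hlim : ∀ᵐ θ : ℝ, Tendsto (fun r : ℝ => f ((r : ℂ) * (Circle.exp θ : ℂ))) (𝓝[<] 1)
        (𝓝 (g (Circle.exp θ))))
    (h : MemQDisc p s f) : MemQCircle p s g := by
  obtain ⟨hf, hM⟩ := h
  obtain ⟨C, hC⟩ := arcEnergy_le hp hs0 hs1
  set M := ⨆ a ∈ unitDisc, besovEnergy p s (f ∘ mobiusDisc a)
  have hE := hC f g M hf hg (fun a ha => by
    rw [← besovEnergy_comp_mobiusDisc hf ha]
    exact le_iSup₂ (f := fun a _ => besovEnergy p s (f ∘ mobiusDisc a)) a ha) hlim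
  have hCM : C * M < ⊤ := ENNReal.mul_lt_top ENNReal.coe_lt_top hM
  refine ⟨memLp_of_arcEnergy_ne_top hp hs1 hg ?_, ?_⟩
  · exact ((hE 0 (2 * Real.pi) ⟨Real.two_pi_pos, le_rfl⟩).trans_lt
      (ENNReal.mul_lt_top hCM ENNReal.ofReal_lt_top)).ne
  · refine lt_of_le_of_lt (iSup_le fun a => iSup_le fun l => iSup_le fun hl => ?_) hCM
    exact ENNReal.div_le_of_le_mul (hE a l hl)

/-! ### Dyadic arcs and oscillations -/

/-- The constant at `x ^ p` may be taken arbitrarily close to one. With the usual constant `2 ^ (p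
- 1)` the recursion `crossOscillation_le_succ` would grow too fast for `s` close to one. -/
theorem ENNReal.exists_add_rpow_le {p lam : ℝ} (hp : 1 < p) (hlam : 1 < lam) :
    ∃ C : NNReal, ∀ x y : ENNReal, (x + y) ^ p ≤ ENNReal.ofReal lam * x ^ p + C * y ^ p := by
  have hp1 : 0 < p - 1 := by linarith
  -- convexity with weights `w` and `1 - w`, where `w ^ (1 - p) = lam`
  set w : ℝ := lam ^ (-(1 / (p - 1))) with hw
  have hw0 : 0 < w := by positivity
  have hw1 : w < 1 := Real.rpow_lt_one_of_one_lt_of_neg hlam (by simpa using hp1)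
  have hwp : w ^ (1 - p) = lam := by
    rw [hw, ← Real.rpow_mul (by linarith)]
    have : -(1 / (p - 1)) * (1 - p) = 1 := by field_simp; ring
    rw [this, Real.rpow_one]
  refine ⟨((1 - w) ^ (1 - p)).toNNReal, fun x y => ?_⟩
  have hsum : ENNReal.ofReal w + ENNReal.ofReal (1 - w) = 1 := by
    rw [← ENNReal.ofReal_add hw0.le (by linarith)]; simp
  have key : ∀ v : ℝ, 0 < v → ∀ z : ENNReal,
      ENNReal.ofReal v * (ENNReal.ofReal v⁻¹ * z) ^ p = ENNReal.ofReal (v ^ (1 - p)) * z ^ p := by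
    intro v hv z
    rw [ENNReal.mul_rpow_of_nonneg _ _ (by linarith),
      ENNReal.ofReal_rpow_of_nonneg (by positivity) (by linarith), ← mul_assoc,
      ← ENNReal.ofReal_mul hv.le, Real.rpow_sub hv, Real.rpow_one, Real.inv_rpow hv.le,
      div_eq_mul_inv]
  have canc : ∀ v : ℝ, 0 < v → ∀ z : ENNReal, ENNReal.ofReal v * (ENNReal.ofReal v⁻¹ * z) = z := by
    intro v hv z
    rw [← mul_assoc, ← ENNReal.ofReal_mul hv.le, mul_inv_cancel₀ hv.ne', ENNReal.ofReal_one, one_mul]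
  have h := ENNReal.rpow_arith_mean_le_arith_mean2_rpow (ENNReal.ofReal w) (ENNReal.ofReal (1 - w))
    (ENNReal.ofReal w⁻¹ * x) (ENNReal.ofReal (1 - w)⁻¹ * y) hsum hp.le
  rwa [key w hw0, key (1 - w) (by linarith), canc w hw0, canc (1 - w) (by linarith), hwp] at h

section Dyadic

/-- The arc (interval of angles) with centre `c` and half-length `π / 2 ^ n`. -/
def dyadicArc (c : ℝ) (n : ℕ) : Set ℝ := Ioc (c - Real.pi / 2 ^ n) (c + Real.pi / 2 ^ n)

theorem measurableSet_dyadicArc (c : ℝ) (n : ℕ) : MeasurableSet (dyadicArc c n) :=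
  measurableSet_Ioc

theorem dyadicArc_eq (c : ℝ) (n : ℕ) :
    dyadicArc c n = Ioc (c - Real.pi / 2 ^ n) (c - Real.pi / 2 ^ n + 2 * (Real.pi / 2 ^ n)) := by
  rw [dyadicArc]; congr 1; ring

theorem volume_dyadicArc (c : ℝ) (n : ℕ) :
    volume (dyadicArc c n) = ENNReal.ofReal (2 * (Real.pi / 2 ^ n)) := by
  rw [dyadicArc_eq, Real.volume_Ioc]; congr 1; ring

theorem pi_div_two_pow_pos (n : ℕ) : 0 < Real.pi / 2 ^ n := by positivity [Real.pi_pos]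

theorem pi_div_two_pow_le (n : ℕ) : Real.pi / 2 ^ n ≤ Real.pi :=
  div_le_self Real.pi_pos.le (one_le_pow₀ one_le_two)

theorem pi_div_two_pow_succ (n : ℕ) : Real.pi / 2 ^ (n + 1) = Real.pi / 2 ^ n / 2 := by
  rw [pow_succ, div_div]

theorem pi_div_two_pow_anti {m n : ℕ} (h : m ≤ n) : Real.pi / 2 ^ n ≤ Real.pi / 2 ^ m := by
  have := Real.pi_pos
  gcongr
  exact one_le_two

theorem dyadicArc_anti (c : ℝ) {m n : ℕ} (h : m ≤ n) : dyadicArc c n ⊆ dyadicArc c m :=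
  Ioc_subset_Ioc (by linarith [pi_div_two_pow_anti h]) (by linarith [pi_div_two_pow_anti h])

/-- The `p`-th power of the distance of the values of `G` at `θ` and `t`. -/
noncomputable def gap (p : ℝ) (G : ℝ → ℂ) (θ t : ℝ) : ENNReal := ‖G t - G θ‖ₑ ^ p

theorem increment_eq (p : ℝ) (G : ℝ → ℂ) (θ u : ℝ) :
    increment p G θ u = gap p G θ (θ + u) := rfl

theorem measurable_gap {p : ℝ} {G : ℝ → ℂ} (hG : Measurable G) :
    Measurable fun z : ℝ × ℝ => gap p G z.1 z.2 := by
  unfold gap; fun_prop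

variable {p s : ℝ} {g : Circle → ℂ}

theorem gap_le_arcDensity (hp : 1 < p) (hs1 : s < 1) {θ t l : ℝ} (hl : |t - θ| ≤ l) :
    gap p (fun θ => g (Circle.exp θ)) θ t ≤
      ENNReal.ofReal (l ^ (2 - s)) * arcDensity p s g θ t := by
  have hl0 : 0 ≤ l := (abs_nonneg _).trans hl
  rw [gap, ← ofReal_norm_rpow (by linarith), arcDensity,
    ← ENNReal.ofReal_mul (by positivity)]
  refine ENNReal.ofReal_le_ofReal ?_
  rw [norm_sub_rev]
  by_cases hz : Circle.exp θ = Circle.exp t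
  · simp [hz, Real.zero_rpow (by linarith : p ≠ 0)]
  · have h0 : 0 < ‖(Circle.exp θ : ℂ) - (Circle.exp t : ℂ)‖ :=
      norm_pos_iff.2 (sub_ne_zero.2 fun e => hz (Circle.ext e))
    have h1 : ‖(Circle.exp θ : ℂ) - (Circle.exp t : ℂ)‖ ≤ |t - θ| := by
      have := norm_circleExp_add_sub θ (t - θ)
      rw [add_sub_cancel] at this
      rw [this]
      exact norm_circleExp_sub_one_le _
    rw [mul_div_assoc', le_div_iff₀ (by positivity), mul_comm]
    gcongr
    · linarith
    · exact h1.trans hl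

theorem increment_mul_le_arcDensity (hp : 1 < p) (hs1 : s < 1) (θ u : ℝ) :
    increment p (fun θ => g (Circle.exp θ)) θ u * ENNReal.ofReal (|u| ^ (s - 2)) ≤
      arcDensity p s g θ (θ + u) := by
  rcases eq_or_ne u 0 with rfl | hu
  · simp [increment, ENNReal.zero_rpow_of_pos (by linarith : 0 < p)]
  · have hu' : 0 < |u| := abs_pos.2 hu
    have := gap_le_arcDensity (g := g) hp hs1 (θ := θ) (t := θ + u) (l := |u|) (by simp)
    rw [increment_eq]
    calc _ ≤ ENNReal.ofReal (|u| ^ (2 - s)) * arcDensity p s g θ (θ + u) *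
          ENNReal.ofReal (|u| ^ (s - 2)) := by gcongr
      _ = ENNReal.ofReal (|u| ^ (2 - s) * |u| ^ (s - 2)) * arcDensity p s g θ (θ + u) := by
          rw [ENNReal.ofReal_mul (by positivity)]; ring
      _ = _ := by
          rw [← Real.rpow_add hu']; simp

variable {M : ENNReal}

/-- The total oscillation of the function on the arc `I_n` against the arc `I_m`. -/
noncomputable def crossOscillation (p : ℝ) (G : ℝ → ℂ) (c : ℝ) (n m : ℕ) : ENNReal :=
  ∫⁻ θ in dyadicArc c n, ∫⁻ t in dyadicArc c m, gap p G θ t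

/-- On a single arc the kernel `|ζ - η|^{s-2}` is at least `|I|^{s-2}`. -/
theorem crossOscillation_self_le (hp : 1 < p) (hs1 : s < 1)
    (hM : ∀ a l : ℝ, l ∈ Ioc 0 (2 * Real.pi) → arcEnergy p s g a l ≤ M * ENNReal.ofReal (l ^ s))
    (c : ℝ) (n : ℕ) :
    crossOscillation p (fun θ => g (Circle.exp θ)) c n n ≤
      M * ENNReal.ofReal (4 * (Real.pi / 2 ^ n * (Real.pi / 2 ^ n))) := by
  obtain ⟨r, hr⟩ : ∃ r, r = Real.pi / 2 ^ n := ⟨_, rfl⟩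
  have hr0 : 0 < r := hr ▸ pi_div_two_pow_pos n
  have hr1 : r ≤ Real.pi := hr ▸ pi_div_two_pow_le n
  rw [crossOscillation, dyadicArc_eq, ← hr]
  calc _ ≤ ∫⁻ θ in Ioc (c - r) (c - r + 2 * r), ∫⁻ t in Ioc (c - r) (c - r + 2 * r),
        ENNReal.ofReal ((2 * r) ^ (2 - s)) * arcDensity p s g θ t :=
        setLIntegral_mono' measurableSet_Ioc fun θ hθ => setLIntegral_mono' measurableSet_Ioc
          fun t ht => gap_le_arcDensity hp hs1
            (by rw [abs_le]; constructor <;> linarith [hθ.1, hθ.2, ht.1, ht.2])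
    _ = ENNReal.ofReal ((2 * r) ^ (2 - s)) * arcEnergy p s g (c - r) (2 * r) := by
        simp only [lintegral_const_mul' _ _ ENNReal.ofReal_ne_top]
        rfl
    _ ≤ ENNReal.ofReal ((2 * r) ^ (2 - s)) * (M * ENNReal.ofReal ((2 * r) ^ s)) := by
        gcongr
        exact hM _ _ ⟨by linarith, by linarith⟩
    _ = M * ENNReal.ofReal ((2 * r) ^ (2 - s) * (2 * r) ^ s) := by
        rw [ENNReal.ofReal_mul (by positivity)]; ring
    _ = _ := by
        rw [← Real.rpow_add (by positivity), sub_add_cancel, Real.rpow_two]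
        congr 2
        ring

/-- Doubling the second arc: relative to the measures of the arcs, the oscillation grows at most
by the factor `lam`, up to a bounded term. -/
theorem crossOscillation_le_succ (hp : 1 < p) (hs1 : s < 1)
    (hg : Measurable fun θ : ℝ => g (Circle.exp θ))
    (hM : ∀ a l : ℝ, l ∈ Ioc 0 (2 * Real.pi) → arcEnergy p s g a l ≤ M * ENNReal.ofReal (l ^ s))
    {lam : ℝ} {C : NNReal}
    (hC : ∀ x y : ENNReal, (x + y) ^ p ≤ ENNReal.ofReal lam * x ^ p + C * y ^ p)
    (c : ℝ) (n m : ℕ) :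
    crossOscillation p (fun θ => g (Circle.exp θ)) c n m ≤
      2 * ENNReal.ofReal lam * crossOscillation p (fun θ => g (Circle.exp θ)) c n (m + 1) +
      8 * C * M * ENNReal.ofReal (Real.pi / 2 ^ n * (Real.pi / 2 ^ m)) := by
  have hself := crossOscillation_self_le hp hs1 hM c m
  set G : ℝ → ℂ := fun θ => g (Circle.exp θ)
  have hOm : Measurable fun z : ℝ × ℝ => gap p G z.1 z.2 := measurable_gap hg
  have hOθ : ∀ θ, Measurable fun t => gap p G θ t := fun θ =>
    hOm.comp (f := fun t => (θ, t)) (by fun_prop)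
  have hOθ' : ∀ t, Measurable fun θ => gap p G θ t := fun t =>
    hOm.comp (f := fun θ => (θ, t)) (by fun_prop)
  obtain ⟨r, hr⟩ : ∃ r, r = Real.pi / 2 ^ n := ⟨_, rfl⟩
  obtain ⟨q, hq⟩ : ∃ q, q = Real.pi / 2 ^ m := ⟨_, rfl⟩
  have hr0 : 0 < r := hr ▸ pi_div_two_pow_pos n
  have hq0 : 0 < q := hq ▸ pi_div_two_pow_pos m
  have vn : volume (dyadicArc c n) = ENNReal.ofReal (2 * r) := by rw [volume_dyadicArc, hr]
  have vm : volume (dyadicArc c m) = ENNReal.ofReal (2 * q) := by rw [volume_dyadicArc, hq]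
  have vm1 : volume (dyadicArc c (m + 1)) = ENNReal.ofReal q := by
    rw [volume_dyadicArc, pi_div_two_pow_succ, ← hq]; congr 1; ring
  have hcross : ∫⁻ t in dyadicArc c m, ∫⁻ w in dyadicArc c (m + 1), gap p G w t ≤
      M * ENNReal.ofReal (4 * (q * q)) := by
    rw [← hq] at hself
    refine le_trans ?_ hself
    have hsw : AEMeasurable (Function.uncurry fun t w => gap p G w t)
        ((volume.restrict (dyadicArc c m)).prod (volume.restrict (dyadicArc c (m + 1)))) :=
      (hOm.comp measurable_swap).aemeasurable
    rw [lintegral_lintegral_swap hsw, crossOscillation]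
    exact lintegral_mono_set (dyadicArc_anti c (Nat.le_succ m))
  -- compare through an intermediate angle `w` that runs over `I_{m+1}`
  have hpt : ∀ θ t w, gap p G θ t ≤
      ENNReal.ofReal lam * gap p G θ w + C * gap p G w t := by
    intro θ t w
    refine le_trans ?_ (hC _ _)
    rw [gap]
    refine ENNReal.rpow_le_rpow ?_ (by linarith)
    calc ‖G t - G θ‖ₑ = ‖(G w - G θ) + (G t - G w)‖ₑ := by congr 1; ring
      _ ≤ _ := enorm_add_le _ _
  have hmul : ENNReal.ofReal q * crossOscillation p G c n m ≤
      ENNReal.ofReal q * (2 * ENNReal.ofReal lam * crossOscillation p G c n (m + 1) +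
      8 * C * M * ENNReal.ofReal (r * q)) := by
    calc ENNReal.ofReal q * crossOscillation p G c n m
        = ∫⁻ θ in dyadicArc c n, ∫⁻ t in dyadicArc c m, ∫⁻ _w in dyadicArc c (m + 1),
            gap p G θ t := by
          simp only [lintegral_const, Measure.restrict_apply MeasurableSet.univ, univ_inter, vm1,
            lintegral_mul_const' _ _ ENNReal.ofReal_ne_top]
          rw [mul_comm]; rfl
      _ ≤ ∫⁻ θ in dyadicArc c n, ∫⁻ t in dyadicArc c m, ∫⁻ w in dyadicArc c (m + 1),
            (ENNReal.ofReal lam * gap p G θ w + C * gap p G w t) :=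
          lintegral_mono fun θ => lintegral_mono fun t => lintegral_mono fun w => hpt θ t w
      _ = ∫⁻ θ in dyadicArc c n, (ENNReal.ofReal (2 * q) * (ENNReal.ofReal lam *
            ∫⁻ w in dyadicArc c (m + 1), gap p G θ w) +
            C * ∫⁻ t in dyadicArc c m, ∫⁻ w in dyadicArc c (m + 1), gap p G w t) := by
          refine lintegral_congr fun θ => ?_
          have e : ∀ t, ∫⁻ w in dyadicArc c (m + 1),
              (ENNReal.ofReal lam * gap p G θ w + C * gap p G w t) =
              ENNReal.ofReal lam * (∫⁻ w in dyadicArc c (m + 1), gap p G θ w) +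
                C * ∫⁻ w in dyadicArc c (m + 1), gap p G w t := by
            intro t
            rw [lintegral_add_left ((hOθ θ).const_mul _), lintegral_const_mul' _ _
              ENNReal.ofReal_ne_top, lintegral_const_mul' _ _ ENNReal.coe_ne_top]
          simp only [e]
          rw [lintegral_add_left measurable_const, lintegral_const_mul' _ _ ENNReal.coe_ne_top,
            lintegral_const, Measure.restrict_apply MeasurableSet.univ, univ_inter, vm, mul_comm
              (ENNReal.ofReal (2 * q))]
      _ = ENNReal.ofReal (2 * q) * (ENNReal.ofReal lam * crossOscillation p G c n (m + 1)) +
            C * (∫⁻ t in dyadicArc c m, ∫⁻ w in dyadicArc c (m + 1), gap p G w t) *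
              ENNReal.ofReal (2 * r) := by
          rw [lintegral_add_right _ measurable_const, lintegral_const_mul' _ _
            ENNReal.ofReal_ne_top, lintegral_const_mul' _ _ ENNReal.ofReal_ne_top, lintegral_const,
            Measure.restrict_apply MeasurableSet.univ, univ_inter, vn]
          rfl
      _ ≤ ENNReal.ofReal (2 * q) * (ENNReal.ofReal lam * crossOscillation p G c n (m + 1)) +
            C * (M * ENNReal.ofReal (4 * (q * q))) * ENNReal.ofReal (2 * r) := by gcongr
      _ = _ := by
          rw [ENNReal.ofReal_mul two_pos.le, ENNReal.ofReal_mul (by norm_num : (0 : ℝ) ≤ 4),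
            ENNReal.ofReal_mul hq0.le, ENNReal.ofReal_mul two_pos.le, ENNReal.ofReal_mul hr0.le,
            ENNReal.ofReal_ofNat, ENNReal.ofReal_ofNat]
          ring
  rw [← hr, ← hq]
  exact (ENNReal.mul_le_mul_iff_right (by simpa using hq0) ENNReal.ofReal_ne_top).1 hmul

end Dyadic

/-! ### Concentrated double integrals over dyadic arcs -/

/-- Mean oscillations against concentric arcs grow at most geometrically, with a rate `lam` that
is as close to one as desired. -/
theorem crossOscillation_le {p s lam : ℝ} (hp : 1 < p) (hs1 : s < 1) (hlam : 1 < lam) :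
    ∃ A : NNReal, ∀ (g : Circle → ℂ) (M : ENNReal), Measurable (fun θ : ℝ => g (Circle.exp θ)) →
      (∀ a l : ℝ, l ∈ Ioc 0 (2 * Real.pi) → arcEnergy p s g a l ≤ M * ENNReal.ofReal (l ^ s)) →
      ∀ (c : ℝ) (n k : ℕ), k ≤ n →
        crossOscillation p (fun θ => g (Circle.exp θ)) c n (n - k) ≤
          A * M * ENNReal.ofReal (Real.pi / 2 ^ n * (Real.pi / 2 ^ (n - k)) * lam ^ k) := by
  obtain ⟨C, hC⟩ := ENNReal.exists_add_rpow_le hp hlam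
  -- `-B` is the fixed point of the recursion `x ↦ lam * x + 8 * C`
  set B : ℝ := 8 * C / (lam - 1) with hB
  have hlam1 : 0 < lam - 1 := by linarith
  have hB0 : 0 ≤ B := by positivity
  have hBl : B * (lam - 1) = 8 * C := by rw [hB]; field_simp
  refine ⟨(B + 4).toNNReal, fun g M hg hM c n k hk => ?_⟩
  have key : ∀ k ≤ n, crossOscillation p (fun θ => g (Circle.exp θ)) c n (n - k) ≤
      M * ENNReal.ofReal (Real.pi / 2 ^ n * (Real.pi / 2 ^ (n - k)) * ((B + 4) * lam ^ k - B)) := by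
    intro k
    induction k with
    | zero =>
      intro _
      refine (crossOscillation_self_le hp hs1 hM c n).trans (le_of_eq ?_)
      congr 2
      simp only [Nat.sub_zero]
      ring
    | succ k ih =>
      intro hk
      have ih := ih (by omega)
      have e : n - k = n - (k + 1) + 1 := by omega
      rw [e, pi_div_two_pow_succ] at ih
      refine (crossOscillation_le_succ hp hs1 hg hM hC c n (n - (k + 1))).trans ?_
      have hn := pi_div_two_pow_pos n
      have hm := pi_div_two_pow_pos (n - (k + 1))
      generalize Real.pi / 2 ^ n = r at *
      generalize Real.pi / 2 ^ (n - (k + 1)) = q at *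
      have hk1 : 1 ≤ lam ^ k := one_le_pow₀ hlam.le
      have h0 : 0 ≤ (B + 4) * lam ^ k - B := by nlinarith
      calc _ ≤ 2 * ENNReal.ofReal lam * (M * ENNReal.ofReal (r * (q / 2) *
            ((B + 4) * lam ^ k - B))) + 8 * C * M * ENNReal.ofReal (r * q) := by gcongr
        _ = M * ENNReal.ofReal (2 * lam * (r * (q / 2) * ((B + 4) * lam ^ k - B)) +
              8 * C * (r * q)) := by
            rw [ENNReal.ofReal_add (by positivity) (by positivity),
              ENNReal.ofReal_mul (p := 2 * lam) (by positivity), ENNReal.ofReal_mul two_pos.le,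
              ENNReal.ofReal_mul (p := 8 * C) (by positivity), ENNReal.ofReal_mul (p := 8)
              (by norm_num), ENNReal.ofReal_coe_nnreal, ENNReal.ofReal_ofNat, ENNReal.ofReal_ofNat]
            ring
        _ = _ := by
            rw [← hBl]
            congr 2
            ring
  refine (key k hk).trans ?_
  have hn := pi_div_two_pow_pos n
  have hm := pi_div_two_pow_pos (n - k)
  rw [mul_comm _ M, mul_assoc M, ENNReal.ofNNReal_toNNReal, ← ENNReal.ofReal_mul (by positivity)]
  gcongr M * ENNReal.ofReal ?_
  have h3 : (B + 4) * lam ^ k - B ≤ (B + 4) * lam ^ k := by linarith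
  refine (mul_le_mul_of_nonneg_left h3 (by positivity)).trans (le_of_eq ?_)
  ring

/-- If the first angle is in `I_n` and the increment is at most `π / 2 ^ m`, then the second angle
is in `I_{m-1}`. For `m = 0` the truncated difference `m - 1 = 0` is intended: increments up to
`π` run over the whole circle, by periodicity. -/
theorem lintegral_increment_le_crossOscillation {p : ℝ} {G : ℝ → ℂ}
    (hper : Function.Periodic G (2 * Real.pi)) (c : ℝ) {n m : ℕ} (hmn : m ≤ n) :
    ∫⁻ θ in dyadicArc c n, ∫⁻ u in dyadicArc 0 m, increment p G θ u ≤
      crossOscillation p G c n (m - 1) := by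
  refine setLIntegral_mono' (measurableSet_dyadicArc c n) fun θ hθ => ?_
  have hπ := Real.pi_pos
  have h1 : ∀ u, increment p G θ u = gap p G θ (u + θ) := fun u => by rw [increment_eq, add_comm]
  simp only [h1]
  rw [dyadicArc, setLIntegral_Ioc_comp_add_right (gap p G θ)]
  rcases m with _ | m
  · have hp : Function.Periodic (gap p G θ) (2 * Real.pi) := fun t => by simp [gap, hper t]
    rw [Nat.zero_sub, dyadicArc_eq]
    simp only [pow_zero, div_one]
    rw [hp.setLIntegral_Ioc_eq Real.two_pi_pos _ (0 - Real.pi + θ)]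
    apply le_of_eq
    congr 3
    ring
  · refine lintegral_mono_set ?_
    rw [Nat.add_sub_cancel]
    have h2 := pi_div_two_pow_anti hmn
    have h3 := pi_div_two_pow_succ m
    exact Ioc_subset_Ioc (by linarith [hθ.1]) (by linarith [hθ.2])

/-- The increments within the scale of the arc are part of the energy of the arc of twice the
length. -/
theorem lintegral_increment_mul_diag_le {p s : ℝ} (hp : 1 < p) (hs0 : 0 < s) (hs1 : s < 1)
    {g : Circle → ℂ} {M : ENNReal}
    (hM : ∀ a l : ℝ, l ∈ Ioc 0 (2 * Real.pi) → arcEnergy p s g a l ≤ M * ENNReal.ofReal (l ^ s))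
    (c : ℝ) (n : ℕ) :
    ∫⁻ θ in dyadicArc c n, ∫⁻ u in dyadicArc 0 n,
      increment p (fun θ => g (Circle.exp θ)) θ u * ENNReal.ofReal (|u| ^ (s - 2)) ≤
      M * ENNReal.ofReal ((4 * (Real.pi / 2 ^ n)) ^ s) := by
  have hπ := Real.pi_pos
  have h1 : ∀ θ, ∫⁻ u in dyadicArc 0 n,
      increment p (fun θ => g (Circle.exp θ)) θ u * ENNReal.ofReal (|u| ^ (s - 2)) ≤
      ∫⁻ t in Ioc (θ - Real.pi / 2 ^ n) (θ + Real.pi / 2 ^ n), arcDensity p s g θ t := by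
    intro θ
    calc _ ≤ ∫⁻ u in dyadicArc 0 n, arcDensity p s g θ (u + θ) :=
          lintegral_mono fun u => by
            rw [add_comm u]; exact increment_mul_le_arcDensity hp hs1 θ u
      _ = _ := by
          rw [dyadicArc, setLIntegral_Ioc_comp_add_right (arcDensity p s g θ)]
          congr 3 <;> ring
  refine (lintegral_mono fun θ => h1 θ).trans ?_
  rcases n with _ | n
  · simp only [pow_zero, div_one]
    refine le_trans (le_of_eq ?_) ((hM (c - Real.pi) (2 * Real.pi)
      ⟨Real.two_pi_pos, le_rfl⟩).trans ?_)
    · rw [arcEnergy, dyadicArc_eq]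
      simp only [pow_zero, div_one]
      refine lintegral_congr fun θ => ?_
      have := (arcDensity_periodic p s g θ).setLIntegral_Ioc_eq Real.two_pi_pos (θ - Real.pi)
        (c - Real.pi)
      rw [show θ - Real.pi + 2 * Real.pi = θ + Real.pi by ring] at this
      exact this
    · gcongr
      norm_num
  · obtain ⟨r, hr⟩ : ∃ r, r = Real.pi / 2 ^ n := ⟨_, rfl⟩
    have hr0 : 0 < r := hr ▸ pi_div_two_pow_pos n
    have hr1 : r ≤ Real.pi := hr ▸ pi_div_two_pow_le n
    rw [dyadicArc, pi_div_two_pow_succ, ← hr]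
    refine le_trans ?_ ((hM (c - r) (2 * r) ⟨by linarith, by linarith⟩).trans ?_)
    · rw [arcEnergy]
      refine (lintegral_mono_set (show Ioc (c - r / 2) (c + r / 2) ⊆ Ioc (c - r) (c - r + 2 * r) from
        Ioc_subset_Ioc (by linarith) (by linarith))).trans' ?_
      refine setLIntegral_mono' measurableSet_Ioc fun θ hθ => ?_
      exact lintegral_mono_set (Ioc_subset_Ioc (by linarith [hθ.1]) (by linarith [hθ.2]))
    · gcongr M * ENNReal.ofReal (?_ ^ s)
      linarith

/-- An arc interacts with the whole circle about as strongly as with itself. -/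
theorem lintegral_dyadicArc_increment_le {p s : ℝ} (hp : 1 < p) (hs0 : 0 < s) (hs1 : s < 1) :
    ∃ C : NNReal, ∀ (g : Circle → ℂ) (M : ENNReal), Measurable (fun θ : ℝ => g (Circle.exp θ)) →
      (∀ a l : ℝ, l ∈ Ioc 0 (2 * Real.pi) → arcEnergy p s g a l ≤ M * ENNReal.ofReal (l ^ s)) →
      ∀ (c : ℝ) (n : ℕ),
        ∫⁻ θ in dyadicArc c n, ∫⁻ u in dyadicArc 0 0,
          increment p (fun θ => g (Circle.exp θ)) θ u * ENNReal.ofReal (|u| ^ (s - 2)) ≤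
        C * M * ENNReal.ofReal ((Real.pi / 2 ^ n) ^ s) := by
  -- the growth rate `lam` of the oscillations is beaten by the decay `2 ^ (s - 1)` of the kernel
  obtain ⟨lam, hlam, hlam2⟩ : ∃ lam : ℝ, 1 < lam ∧ lam < 2 ^ (1 - s) :=
    exists_between (Real.one_lt_rpow (by norm_num) (by linarith))
  have hlam0 : 0 < lam := by linarith
  obtain ⟨A, hA⟩ := crossOscillation_le hp hs1 hlam
  set q : ℝ := lam * 2 ^ (s - 1) with hq
  have hq0 : 0 < q := by positivity
  have hq1 : q < 1 := by
    have : (2 : ℝ) ^ (1 - s) * 2 ^ (s - 1) = 1 := by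
      rw [← Real.rpow_add two_pos]; simp
    calc q < 2 ^ (1 - s) * 2 ^ (s - 1) := mul_lt_mul_of_pos_right hlam2 (by positivity)
      _ = 1 := this
  set B : ℝ := 4 * A * lam ^ 2 / (1 - q) with hB
  have hq1' : 0 < 1 - q := by linarith
  have hB0 : 0 ≤ B := by positivity
  have hBq : 4 * A * lam ^ 2 = B * (1 - q) := by rw [hB]; field_simp
  refine ⟨(4 ^ s + B).toNNReal, fun g M hg hM c n => ?_⟩
  have hper : Function.Periodic (fun θ : ℝ => g (Circle.exp θ)) (2 * Real.pi) := fun θ => by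
    simp only [Circle.periodic_exp θ]
  have hA := hA g M hg hM c n
  have hdiag := lintegral_increment_mul_diag_le hp hs0 hs1 hM c n
  have hNm : Measurable fun z : ℝ × ℝ => increment p (fun θ => g (Circle.exp θ)) z.1 z.2 :=
    measurable_increment hg
  have hcross := fun m hmn => lintegral_increment_le_crossOscillation (p := p) hper c
    (n := n) (m := m) hmn
  set G : ℝ → ℂ := fun θ => g (Circle.exp θ)
  -- each doubling of the range of the increments adds a term of a geometric series with ratio `q`
  have key : ∀ k ≤ n, ∫⁻ θ in dyadicArc c n, ∫⁻ u in dyadicArc 0 (n - k),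
      increment p G θ u * ENNReal.ofReal (|u| ^ (s - 2)) ≤
      M * ENNReal.ofReal ((Real.pi / 2 ^ n) ^ s * (4 ^ s + B * (1 - q ^ k))) := by
    intro k
    induction k with
    | zero =>
      intro _
      refine hdiag.trans (le_of_eq ?_)
      congr 2
      rw [Real.mul_rpow (by norm_num) (pi_div_two_pow_pos n).le, pow_zero, sub_self, mul_zero,
        add_zero, mul_comm]
    | succ k ih =>
      intro hk
      have ih := ih (by omega)
      obtain ⟨m, hm⟩ : ∃ m, m = n - (k + 1) := ⟨_, rfl⟩
      have hmn : m ≤ n := by omega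
      rw [show n - k = m + 1 by omega] at ih
      rw [← hm]
      obtain ⟨r, hr⟩ : ∃ r, r = Real.pi / 2 ^ n := ⟨_, rfl⟩
      obtain ⟨ρ, hρ⟩ : ∃ ρ, ρ = Real.pi / 2 ^ (m + 1) := ⟨_, rfl⟩
      have hr0 : 0 < r := hr ▸ pi_div_two_pow_pos n
      have hρ0 : 0 < ρ := hρ ▸ pi_div_two_pow_pos (m + 1)
      have hρr : ρ = 2 ^ k * r := by
        rw [hρ, hr, show n = m + 1 + k by omega, pow_add _ (m + 1)]
        field_simp
      have hX : crossOscillation p G c n (m - 1) ≤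
          A * M * ENNReal.ofReal (r * (4 * ρ) * lam ^ (k + 2)) := by
        rcases Nat.eq_zero_or_pos m with h0 | h0
        · have := hA (k + 1) hk
          rw [← hm, h0] at this
          rw [h0, Nat.zero_sub]
          refine this.trans ?_
          have hπ : Real.pi / 2 ^ 0 ≤ 4 * ρ := by
            rw [hρ, h0]; norm_num; linarith [Real.pi_pos]
          rw [← hr]
          gcongr
          · exact hlam.le
          · omega
        · have := hA (k + 2) (by omega)
          rw [show n - (k + 2) = m - 1 by omega] at this
          refine this.trans (le_of_eq ?_)
          rw [← hr]
          congr 4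
          rw [hρ, show m + 1 = (m - 1) + 1 + 1 by omega, pow_succ, pow_succ]
          field_simp
          norm_num
      have hsplit : ∀ θ, ∫⁻ u in dyadicArc 0 m,
          increment p G θ u * ENNReal.ofReal (|u| ^ (s - 2)) ≤
          (∫⁻ u in dyadicArc 0 (m + 1), increment p G θ u * ENNReal.ofReal (|u| ^ (s - 2))) +
          ENNReal.ofReal (ρ ^ (s - 2)) * ∫⁻ u in dyadicArc 0 m, increment p G θ u := by
        intro θ
        rw [← lintegral_inter_add_sdiff (B := dyadicArc 0 (m + 1)) _ (dyadicArc 0 m)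
          (measurableSet_dyadicArc 0 (m + 1)), ← lintegral_const_mul' _ _ ENNReal.ofReal_ne_top]
        refine add_le_add (lintegral_mono_set inter_subset_right) ?_
        refine le_trans ?_ (lintegral_mono_set
          (sdiff_subset : dyadicArc 0 m \ dyadicArc 0 (m + 1) ⊆ dyadicArc 0 m))
        refine setLIntegral_mono' ((measurableSet_dyadicArc 0 m).diff
          (measurableSet_dyadicArc 0 (m + 1))) fun u hu => ?_
        rw [mul_comm]
        gcongr ENNReal.ofReal ?_ * _
        have : ρ ≤ |u| := by
          by_contra! h
          refine hu.2 ⟨?_, ?_⟩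
          · rw [← hρ]; linarith [neg_abs_le u]
          · rw [← hρ]; linarith [le_abs_self u]
        exact Real.rpow_le_rpow_of_nonpos hρ0 this (by linarith)
      have hF : Measurable fun θ => ∫⁻ u in dyadicArc 0 (m + 1),
          increment p G θ u * ENNReal.ofReal (|u| ^ (s - 2)) :=
        Measurable.lintegral_prod_right' (f := fun z : ℝ × ℝ =>
          increment p G z.1 z.2 * ENNReal.ofReal (|z.2| ^ (s - 2))) (by fun_prop)
      have hqk : q ^ k ≤ 1 := pow_le_one₀ hq0.le hq1.le
      calc _ ≤ _ := lintegral_mono hsplit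
        _ ≤ M * ENNReal.ofReal (r ^ s * (4 ^ s + B * (1 - q ^ k))) +
              ENNReal.ofReal (ρ ^ (s - 2)) * (A * M *
                ENNReal.ofReal (r * (4 * ρ) * lam ^ (k + 2))) := by
            rw [lintegral_add_left hF, lintegral_const_mul' _ _ ENNReal.ofReal_ne_top]
            rw [← hr] at ih
            gcongr
            exact (hcross m hmn).trans hX
        _ = M * ENNReal.ofReal (r ^ s * (4 ^ s + B * (1 - q ^ k)) +
              A * (ρ ^ (s - 2) * (r * (4 * ρ) * lam ^ (k + 2)))) := by
            have : 0 ≤ 1 - q ^ k := by linarith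
            rw [ENNReal.ofReal_add (by positivity) (by positivity),
              ENNReal.ofReal_mul (p := (A : ℝ)) (by positivity),
              ENNReal.ofReal_mul (p := ρ ^ (s - 2)) (by positivity), ENNReal.ofReal_coe_nnreal]
            ring
        _ = _ := by
            rw [← hr]
            congr 2
            have e1 : ρ ^ (s - 2) * ρ = ρ ^ (s - 1) := by
              rw [← Real.rpow_add_one hρ0.ne']; congr 1; ring
            have e2 : r ^ (s - 1) * r = r ^ s := by
              rw [← Real.rpow_add_one hr0.ne']; congr 1; ring
            have e3 : ρ ^ (s - 1) = (2 ^ (s - 1)) ^ k * r ^ (s - 1) := by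
              rw [hρr, Real.mul_rpow (by positivity) hr0.le, ← Real.rpow_natCast,
                ← Real.rpow_natCast, ← Real.rpow_mul two_pos.le, ← Real.rpow_mul two_pos.le,
                mul_comm (k : ℝ)]
            have e4 : A * (ρ ^ (s - 2) * (r * (4 * ρ) * lam ^ (k + 2))) =
                r ^ s * (B * (1 - q)) * q ^ k := by
              calc _ = 4 * A * lam ^ 2 * (ρ ^ (s - 2) * ρ) * lam ^ k * r := by ring
                _ = 4 * A * lam ^ 2 * (lam * 2 ^ (s - 1)) ^ k * (r ^ (s - 1) * r) := by
                    rw [e1, e3]; ring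
                _ = _ := by rw [e2, ← hBq]; ring
            rw [e4]
            ring
  have := key n le_rfl
  rw [Nat.sub_self] at this
  refine this.trans ?_
  have hr := pi_div_two_pow_pos n
  rw [mul_comm _ M, mul_assoc M, ENNReal.ofNNReal_toNNReal, ← ENNReal.ofReal_mul (by positivity),
    mul_comm (4 ^ s + B)]
  gcongr
  have : 0 < q ^ n := by positivity
  nlinarith

/-! ### Bounds of `f'` by the boundary values -/

theorem le_norm_circleExp_sub_real {x u : ℝ} (hx : 0 ≤ x) (hx1 : x ≤ 1) (hu : |u| ≤ Real.pi) :
    x + |u| ≤ 5 * ‖(Circle.exp u : ℂ) - ((1 - x : ℝ) : ℂ)‖ := by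
  set c := ‖(Circle.exp u : ℂ) - ((1 - x : ℝ) : ℂ)‖ with hc
  have h1 : x ≤ c := by
    have := norm_sub_norm_le (Circle.exp u : ℂ) ((1 - x : ℝ) : ℂ)
    rw [Circle.norm_coe, Complex.norm_real, Real.norm_of_nonneg (by linarith)] at this
    linarith
  have h2 : ‖(Circle.exp u : ℂ) - 1‖ ≤ c + x := by
    have e : (Circle.exp u : ℂ) - 1 = ((Circle.exp u : ℂ) - ((1 - x : ℝ) : ℂ)) - (x : ℂ) := by
      push_cast; ring
    rw [e]
    refine (norm_sub_le _ _).trans ?_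
    rw [Complex.norm_real, Real.norm_of_nonneg hx]
  have h3 := le_norm_circleExp_sub_one hu
  have hπ := Real.pi_lt_four
  have h4 : |u| ≤ Real.pi * c := by
    have h5 : 2 / Real.pi * |u| ≤ 2 * c := by linarith
    rw [div_mul_eq_mul_div, div_le_iff₀ Real.pi_pos] at h5
    linarith
  nlinarith [norm_nonneg ((Circle.exp u : ℂ) - ((1 - x : ℝ) : ℂ))]

theorem exists_isOpen_differentiableOn_dilate {f : ℂ → ℂ} (hf : DifferentiableOn ℂ f unitDisc) {R : ℝ}
    (hR : R ∈ Ioo 0 1) : ∃ U : Set ℂ, IsOpen U ∧ Metric.closedBall 0 1 ⊆ U ∧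
      DifferentiableOn ℂ (fun ζ => f (R * ζ)) U := by
  refine ⟨(fun ζ : ℂ => (R : ℂ) * ζ) ⁻¹' unitDisc, isOpen_unitDisc.preimage (by fun_prop),
    fun ζ hζ => ?_, hf.comp (by fun_prop) fun ζ hζ => hζ⟩
  have : ‖ζ‖ ≤ 1 := by simpa using hζ
  rw [mem_preimage, mem_unitDisc, norm_mul, Complex.norm_real, Real.norm_of_nonneg hR.1.le]
  nlinarith [norm_nonneg ζ, hR.1, hR.2]

theorem tendsto_real_mul_nhdsLT (z : ℂ) : Tendsto (fun r : ℝ => (r : ℂ) * z) (𝓝[<] 1) (𝓝 z) := by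
  have : Tendsto (fun r : ℝ => (r : ℂ) * z) (𝓝 1) (𝓝 (((1 : ℝ) : ℂ) * z)) :=
    (by fun_prop : Continuous fun r : ℝ => (r : ℂ) * z).tendsto 1
  rw [Complex.ofReal_one, one_mul] at this
  exact this.mono_left nhdsWithin_le_nhds

/-- Estimates by a bounded kernel over the circles of radius `R < 1` pass to boundary values in
`L¹`. -/
theorem le_lintegral_of_tendsto_boundary {f : ℂ → ℂ} {G : ℝ → ℂ} (hG : Measurable G)
    (hlim : Tendsto (fun R : ℝ => ∫⁻ t in Ioc 0 (2 * Real.pi),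
      ‖f ((R : ℂ) * (Circle.exp t : ℂ)) - G t‖ₑ) (𝓝[<] 1) (𝓝 0)) (w : ℂ) {κ : ℝ → ℝ}
    (hκ : Measurable κ) {K : ℝ} (hK : ∀ t, κ t ≤ K) {A : ℝ → ENNReal} {A₁ : ENNReal}
    (hA : Tendsto A (𝓝[<] 1) (𝓝 A₁))
    (hle : ∀ R ∈ Ioo (0 : ℝ) 1, A R ≤ ∫⁻ t in Ioc 0 (2 * Real.pi),
      ‖f ((R : ℂ) * (Circle.exp t : ℂ)) - w‖ₑ * ENNReal.ofReal (κ t)) :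
    A₁ ≤ ∫⁻ t in Ioc 0 (2 * Real.pi), ‖G t - w‖ₑ * ENNReal.ofReal (κ t) := by
  have hr : Tendsto (fun R : ℝ => ENNReal.ofReal K * (∫⁻ t in Ioc 0 (2 * Real.pi),
      ‖f ((R : ℂ) * (Circle.exp t : ℂ)) - G t‖ₑ) + ∫⁻ t in Ioc 0 (2 * Real.pi), ‖G t - w‖ₑ *
        ENNReal.ofReal (κ t)) (𝓝[<] 1)
      (𝓝 (ENNReal.ofReal K * 0 + ∫⁻ t in Ioc 0 (2 * Real.pi), ‖G t - w‖ₑ *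
        ENNReal.ofReal (κ t))) :=
    (ENNReal.Tendsto.const_mul hlim (Or.inr ENNReal.ofReal_ne_top)).add tendsto_const_nhds
  rw [mul_zero, zero_add] at hr
  refine le_of_tendsto_of_tendsto hA hr ?_
  filter_upwards [Ioo_mem_nhdsLT (zero_lt_one' ℝ)] with R hR01
  refine (hle R hR01).trans ?_
  rw [← lintegral_const_mul' _ _ ENNReal.ofReal_ne_top, ← lintegral_add_right _ (by fun_prop)]
  refine lintegral_mono fun t => ?_
  have e : f ((R : ℂ) * (Circle.exp t : ℂ)) - w =
      (f ((R : ℂ) * (Circle.exp t : ℂ)) - G t) + (G t - w) := by ring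
  rw [e]
  calc _ ≤ (‖f ((R : ℂ) * (Circle.exp t : ℂ)) - G t‖ₑ + ‖G t - w‖ₑ) * ENNReal.ofReal (κ t) := by
        gcongr; exact enorm_add_le _ _
    _ ≤ _ := by
        rw [add_mul, mul_comm (ENNReal.ofReal K)]
        gcongr
        exact hK t

/-- Cauchy's formula for `f'`, on the circle of radius `R < 1`, applied to `f - w`. -/
theorem enorm_deriv_le_lintegral_circle {f : ℂ → ℂ} (hf : DifferentiableOn ℂ f unitDisc) {R : ℝ}
    (hR : R ∈ Ioo 0 1) {z : ℂ} (hz : z ∈ unitDisc) (w : ℂ) :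
    ENNReal.ofReal R * ‖deriv f (R * z)‖ₑ ≤ ∫⁻ t in Ioc 0 (2 * Real.pi),
      ‖f ((R : ℂ) * (Circle.exp t : ℂ)) - w‖ₑ *
        ENNReal.ofReal (1 / ‖(Circle.exp t : ℂ) - z‖ ^ 2) := by
  obtain ⟨U, hU, hsub, hd⟩ := exists_isOpen_differentiableOn_dilate hf hR
  have hz1 := mem_unitDisc.1 hz
  have hRz : (R : ℂ) * z ∈ unitDisc := by
    rw [mem_unitDisc, norm_mul, Complex.norm_real, Real.norm_of_nonneg hR.1.le]
    nlinarith [norm_nonneg z, hR.1, hR.2]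
  have key := Complex.two_pi_I_inv_smul_circleIntegral_sub_sq_inv_smul_of_differentiable hU hsub
    (hd.sub_const w) (w₀ := z) (by simpa using hz1)
  have hder : deriv (fun ζ => f (R * ζ) - w) z = R * deriv f (R * z) := by
    have h1 := (hf.differentiableAt (isOpen_unitDisc.mem_nhds hRz)).hasDerivAt
    have h2 : HasDerivAt (fun ζ : ℂ => (R : ℂ) * ζ) R z := by
      simpa using (hasDerivAt_id z).const_mul (R : ℂ)
    have := (HasDerivAt.comp z h1 h2).sub_const w
    rw [mul_comm]
    exact this.deriv
  have e1 : ENNReal.ofReal R * ‖deriv f (R * z)‖ₑ = ‖deriv (fun ζ => f (R * ζ) - w) z‖ₑ := by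
    rw [hder, enorm_mul, ← ofReal_norm (R : ℂ), Complex.norm_real, Real.norm_of_nonneg hR.1.le]
  rw [e1, ← key, enorm_smul]
  have e2 : ‖(2 * Real.pi * Complex.I : ℂ)⁻¹‖ₑ ≤ 1 := by
    rw [← ofReal_norm]
    refine ENNReal.ofReal_le_one.2 ?_
    rw [norm_inv]
    refine inv_le_one_of_one_le₀ ?_
    simp only [norm_mul, Complex.norm_ofNat, Complex.norm_real, Complex.norm_I, mul_one,
      Real.norm_of_nonneg Real.pi_pos.le]
    linarith [Real.pi_gt_three]
  refine (mul_le_of_le_one_left zero_le e2).trans ?_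
  rw [circleIntegral, intervalIntegral.integral_of_le Real.two_pi_pos.le]
  refine (enorm_integral_le_lintegral_enorm _).trans (lintegral_mono fun t => ?_)
  have e3 : circleMap 0 1 t = (Circle.exp t : ℂ) := by simp [circleMap, Circle.coe_exp]
  rw [e3, enorm_smul, enorm_smul, deriv_circleMap, e3]
  have e4 : ‖(Circle.exp t : ℂ) * Complex.I‖ₑ = 1 := by
    rw [← ofReal_norm, norm_mul, Circle.norm_coe, Complex.norm_I]; simp
  have e5 : ‖(((Circle.exp t : ℂ) - z) ^ 2)⁻¹‖ₑ =
      ENNReal.ofReal (1 / ‖(Circle.exp t : ℂ) - z‖ ^ 2) := by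
    rw [← ofReal_norm, norm_inv, norm_pow, one_div]
  rw [e4, one_mul, e5, mul_comm]

/-- Cauchy's formula for `f'` in terms of `L¹` boundary values `G`: the kernel has mean zero, so
that a constant may be subtracted from `G`. -/
theorem enorm_deriv_le_lintegral_boundary {f : ℂ → ℂ} {G : ℝ → ℂ}
    (hf : DifferentiableOn ℂ f unitDisc) (hG : Measurable G)
    (hlim : Tendsto (fun R : ℝ => ∫⁻ t in Ioc 0 (2 * Real.pi),
      ‖f ((R : ℂ) * (Circle.exp t : ℂ)) - G t‖ₑ) (𝓝[<] 1) (𝓝 0)) {z : ℂ} (hz : z ∈ unitDisc)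
    (w : ℂ) :
    ‖deriv f z‖ₑ ≤ ∫⁻ t in Ioc 0 (2 * Real.pi), ‖G t - w‖ₑ *
        ENNReal.ofReal (1 / ‖(Circle.exp t : ℂ) - z‖ ^ 2) := by
  have hz1 := mem_unitDisc.1 hz
  have hdc : ContinuousAt (deriv f) z :=
    ((hf.deriv isOpen_unitDisc).differentiableAt (isOpen_unitDisc.mem_nhds hz)).continuousAt
  have hR1 : Tendsto (fun R : ℝ => ENNReal.ofReal R) (𝓝[<] 1) (𝓝 1) := by
    have := (ENNReal.continuous_ofReal.tendsto (1 : ℝ)).mono_left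
      (nhdsWithin_le_nhds (s := Iio (1 : ℝ)))
    rwa [ENNReal.ofReal_one] at this
  have hl : Tendsto (fun R : ℝ => ENNReal.ofReal R * ‖deriv f (R * z)‖ₑ) (𝓝[<] 1)
      (𝓝 (1 * ‖deriv f z‖ₑ)) :=
    ENNReal.Tendsto.mul hR1 (Or.inl one_ne_zero) (hdc.tendsto.comp (tendsto_real_mul_nhdsLT z)).enorm
      (Or.inr (by simp))
  rw [one_mul] at hl
  have hm : Measurable fun t : ℝ => ‖(Circle.exp t : ℂ) - z‖ := by fun_prop
  refine le_lintegral_of_tendsto_boundary hG hlim w (by fun_prop) (K := 1 / (1 - ‖z‖) ^ 2)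
    (fun t => ?_) hl fun R hR => enorm_deriv_le_lintegral_circle hf hR hz w
  have := norm_sub_norm_le (Circle.exp t : ℂ) z
  rw [Circle.norm_coe] at this
  have h0 : 0 < 1 - ‖z‖ := by linarith
  gcongr

/-- Cauchy's formula, with the value of `G` at the angle of the point itself subtracted. -/
theorem depthDeriv_le_lintegral {f : ℂ → ℂ} {G : ℝ → ℂ}
    (hf : DifferentiableOn ℂ f unitDisc) (hG : Measurable G)
    (hper : Function.Periodic G (2 * Real.pi))
    (hlim : Tendsto (fun R : ℝ => ∫⁻ t in Ioc 0 (2 * Real.pi),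
      ‖f ((R : ℂ) * (Circle.exp t : ℂ)) - G t‖ₑ) (𝓝[<] 1) (𝓝 0)) {x : ℝ} (hx : x ∈ Ioo 0 1)
    (θ : ℝ) :
    depthDeriv f x θ ≤ ENNReal.ofReal 25 * ∫⁻ u in Ioc (-Real.pi) Real.pi, ‖G (θ + u) - G θ‖ₑ *
      ENNReal.ofReal (1 / (x + |u|) ^ 2) := by
  have hz : ((1 - x : ℝ) : ℂ) * (Circle.exp θ : ℂ) ∈ unitDisc := by
    rw [mem_unitDisc, norm_real_mul_circle, abs_of_nonneg] <;> linarith [hx.1, hx.2]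
  refine (enorm_deriv_le_lintegral_boundary hf hG hlim hz (G θ)).trans ?_
  have hp : Function.Periodic (fun t => ‖G t - G θ‖ₑ *
      ENNReal.ofReal (1 / ‖(Circle.exp t : ℂ) - ((1 - x : ℝ) : ℂ) * (Circle.exp θ : ℂ)‖ ^ 2))
      (2 * Real.pi) := fun t => by
    simp [hper t]
  have h1 := hp.setLIntegral_Ioc_eq Real.two_pi_pos 0 (-Real.pi + θ)
  rw [zero_add, show -Real.pi + θ + 2 * Real.pi = Real.pi + θ by ring,
    ← setLIntegral_Ioc_comp_add_right] at h1
  rw [h1, ← lintegral_const_mul' _ _ ENNReal.ofReal_ne_top]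
  refine setLIntegral_mono' measurableSet_Ioc fun u hu => ?_
  rw [add_comm u θ, mul_left_comm, ← ENNReal.ofReal_mul (by norm_num)]
  refine mul_le_mul' le_rfl (ENNReal.ofReal_le_ofReal ?_)
  have hu' : |u| ≤ Real.pi := abs_le.2 ⟨hu.1.le, hu.2⟩
  have h2 := le_norm_circleExp_sub_real hx.1.le hx.2.le hu'
  have h3 : ‖(Circle.exp (θ + u) : ℂ) - ((1 - x : ℝ) : ℂ) * (Circle.exp θ : ℂ)‖ =
      ‖(Circle.exp u : ℂ) - ((1 - x : ℝ) : ℂ)‖ := by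
    have : (Circle.exp (θ + u) : ℂ) - ((1 - x : ℝ) : ℂ) * (Circle.exp θ : ℂ) =
        (Circle.exp θ : ℂ) * ((Circle.exp u : ℂ) - ((1 - x : ℝ) : ℂ)) := by
      rw [Circle.exp_add, Circle.coe_mul]; ring
    rw [this, norm_mul, Circle.norm_coe, one_mul]
  rw [h3]
  have hx0 : 0 < x + |u| := by have := hx.1; positivity
  have h5 : 0 < ‖(Circle.exp u : ℂ) - ((1 - x : ℝ) : ℂ)‖ := by linarith
  rw [mul_one_div, div_le_div_iff₀ (by positivity) (by positivity)]
  nlinarith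

theorem lintegral_Ioc_neg_comp_abs (F : ℝ → ENNReal) {b : ℝ} (hb : 0 ≤ b) :
    ∫⁻ u in Ioc (-b) b, F |u| = 2 * ∫⁻ u in Ioc 0 b, F u := by
  have e : Ioc (-b) b = Ioc (-b) 0 ∪ Ioc 0 b :=
    (Ioc_union_Ioc_eq_Ioc (by linarith) hb).symm
  rw [e, lintegral_union measurableSet_Ioc (Ioc_disjoint_Ioc_of_le le_rfl), two_mul]
  congr 1
  · have := setLIntegral_Ioc_comp_neg (fun u => F |u|) 0 b
    rw [neg_zero] at this
    rw [← this]
    refine setLIntegral_congr_fun measurableSet_Ioc fun u hu => ?_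
    simp only [abs_neg, abs_of_pos hu.1]
  · refine setLIntegral_congr_fun measurableSet_Ioc fun u hu => ?_
    simp only [abs_of_pos hu.1]

theorem lintegral_one_div_add_abs_sq_le {x : ℝ} (hx : 0 < x) :
    ∫⁻ u in Ioc (-Real.pi) Real.pi, ENNReal.ofReal (1 / (x + |u|) ^ 2) ≤
      ENNReal.ofReal (2 * x⁻¹) := by
  rw [lintegral_Ioc_neg_comp_abs (fun u => ENNReal.ofReal (1 / (x + u) ^ 2)) Real.pi_pos.le]
  have h := lintegral_Ioi_rpow (r := -2) (by norm_num) hx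
  have h1 := setLIntegral_Ioc_comp_add_right (fun u => ENNReal.ofReal (u ^ (-2 : ℝ))) 0 Real.pi x
  rw [zero_add] at h1
  rw [ENNReal.ofReal_mul two_pos.le, ENNReal.ofReal_ofNat]
  gcongr 2 * ?_
  calc _ = ∫⁻ u in Ioc 0 Real.pi, ENNReal.ofReal ((u + x) ^ (-2 : ℝ)) := by
        refine setLIntegral_congr_fun measurableSet_Ioc fun u hu => ?_
        have := hu.1
        rw [Real.rpow_neg (by positivity), add_comm u x, one_div]
        norm_num
    _ ≤ ∫⁻ u in Ioi x, ENNReal.ofReal (u ^ (-2 : ℝ)) := by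
        rw [h1]
        exact lintegral_mono_set (show Ioc x (Real.pi + x) ⊆ Ioi x from fun u hu => hu.1)
    _ = _ := by
        rw [h]
        norm_num [Real.rpow_neg_one]

/-- The pointwise bound of `|f'|^p` by the increments of the boundary values, by Hölder's inequality
for the kernel `(x + |u|)^{-2}`, whose mass is at most `2 / x`. -/
theorem depthDeriv_rpow_le {p : ℝ} (hp : 1 < p) {f : ℂ → ℂ} {G : ℝ → ℂ}
    (hf : DifferentiableOn ℂ f unitDisc) (hG : Measurable G)
    (hper : Function.Periodic G (2 * Real.pi))
    (hlim : Tendsto (fun R : ℝ => ∫⁻ t in Ioc 0 (2 * Real.pi),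
      ‖f ((R : ℂ) * (Circle.exp t : ℂ)) - G t‖ₑ) (𝓝[<] 1) (𝓝 0)) {x : ℝ} (hx : x ∈ Ioo 0 1)
    (θ : ℝ) :
    depthDeriv f x θ ^ p ≤ ENNReal.ofReal (25 ^ p * 2 ^ (p - 1) * x ^ (1 - p)) *
      ∫⁻ u in Ioc (-Real.pi) Real.pi, increment p G θ u * ENNReal.ofReal (1 / (x + |u|) ^ 2) := by
  have hx0 := hx.1
  calc depthDeriv f x θ ^ p ≤ _ :=
        ENNReal.rpow_le_rpow (depthDeriv_le_lintegral hf hG hper hlim hx θ) (by linarith)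
    _ ≤ ENNReal.ofReal (25 ^ p) * (ENNReal.ofReal (2 * x⁻¹) ^ (p - 1) *
          ∫⁻ u in Ioc (-Real.pi) Real.pi,
            increment p G θ u * ENNReal.ofReal (1 / (x + |u|) ^ 2)) := by
        rw [ENNReal.mul_rpow_of_nonneg _ _ (by linarith),
          ENNReal.ofReal_rpow_of_nonneg (by norm_num) (by linarith)]
        gcongr ENNReal.ofReal (25 ^ p) * ?_
        refine (lintegral_mul_rpow_le _ hp (by fun_prop) (by fun_prop)).trans ?_
        gcongr ?_ * _
        exact ENNReal.rpow_le_rpow (lintegral_one_div_add_abs_sq_le hx0) (by linarith)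
    _ = _ := by
        rw [ENNReal.ofReal_rpow_of_nonneg (by positivity) (by linarith), ← mul_assoc,
          ← ENNReal.ofReal_mul (by positivity), Real.mul_rpow two_pos.le (by positivity),
          Real.inv_rpow hx0.le, ← Real.rpow_neg hx0.le, neg_sub, mul_assoc]

/-! ### From the circle to the disc -/

/-- For `|a| = 1 - δ`, the quantity `(1 - |σ_a|^2)^s` at depth `x` below the circle and at the angle
`u` from `a` is at most a constant times `x ^ s` times this weight. -/
noncomputable def mobiusWeight (s δ u : ℝ) : ENNReal := ENNReal.ofReal ((δ / (δ + |u|) ^ 2) ^ s)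

theorem measurable_mobiusWeight (s δ : ℝ) : Measurable (mobiusWeight s δ) := by
  unfold mobiusWeight; fun_prop

theorem exists_eq_mul_circleExp {a : ℂ} (ha : a ∈ unitDisc) :
    ∃ δ c : ℝ, 0 < δ ∧ δ ≤ 1 ∧ a = ((1 - δ : ℝ) : ℂ) * (Circle.exp c : ℂ) := by
  refine ⟨1 - ‖a‖, Complex.arg a, ?_, ?_, ?_⟩
  · linarith [mem_unitDisc.1 ha]
  · linarith [norm_nonneg a]
  · rw [sub_sub_cancel, Circle.coe_exp, Complex.norm_mul_exp_arg_mul_I]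

theorem invariantDensity_polar_le {p s : ℝ} (hp : 1 < p) (hs0 : 0 < s) (f : ℂ → ℂ) {δ c x θ : ℝ}
    (hδ0 : 0 < δ) (hδ1 : δ ≤ 1) (hx : x ∈ Ioo 0 1) (hθ : |θ - c| ≤ Real.pi) :
    ENNReal.ofReal (1 - x) * invariantDensity p s f (((1 - δ : ℝ) : ℂ) * (Circle.exp c : ℂ))
      (((1 - x : ℝ) : ℂ) * (Circle.exp θ : ℂ)) ≤
    ENNReal.ofReal (2 ^ |p - 2| * 100 ^ s) * (mobiusWeight s δ (θ - c) *
      (depthDeriv f x θ ^ p * ENNReal.ofReal (x ^ (p - 2 + s)))) := by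
  have hx0 := hx.1
  have hx1 := hx.2
  set z : ℂ := ((1 - x : ℝ) : ℂ) * (Circle.exp θ : ℂ) with hz
  set a : ℂ := ((1 - δ : ℝ) : ℂ) * (Circle.exp c : ℂ) with ha
  have hnz : ‖z‖ = 1 - x := by rw [hz, norm_real_mul_circle, abs_of_nonneg]; linarith
  have hna : ‖a‖ = 1 - δ := by rw [ha, norm_real_mul_circle, abs_of_nonneg]; linarith
  have hzD : z ∈ unitDisc := by rw [mem_unitDisc, hnz]; linarith
  have haD : a ∈ unitDisc := by rw [mem_unitDisc, hna]; linarith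
  have hden : δ + |θ - c| ≤ 5 * ‖1 - starRingEnd ℂ a * z‖ := by
    have h := le_norm_circleExp_sub_real (x := 1 - (1 - δ) * (1 - x)) (u := c - θ)
      (by nlinarith) (by nlinarith) (by rwa [abs_sub_comm])
    have e : 1 - starRingEnd ℂ a * z = (Circle.exp (θ - c) : ℂ) *
        ((Circle.exp (c - θ) : ℂ) - ((1 - (1 - (1 - δ) * (1 - x)) : ℝ) : ℂ)) := by
      have h1 : (Circle.exp (θ - c) : ℂ) * (Circle.exp (c - θ) : ℂ) = 1 := by
        rw [← Circle.coe_mul, ← Circle.exp_add]; simp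
      rw [ha, hz, conj_mul_polar, sub_sub_cancel 1 ((1 - δ) * (1 - x))]
      linear_combination -h1
    rw [e, norm_mul, Circle.norm_coe, one_mul]
    rw [abs_sub_comm c θ] at h
    nlinarith
  have hd0 : 0 < δ + |θ - c| := by positivity
  have hden0 : 0 < ‖1 - starRingEnd ℂ a * z‖ := by linarith
  have hσ0 : 0 < 1 - ‖mobiusDisc a z‖ ^ 2 := one_sub_norm_sq_pos (mobiusDisc_mem haD hzD)
  have hσ : 1 - ‖mobiusDisc a z‖ ^ 2 ≤ 100 * (δ / (δ + |θ - c|) ^ 2) * x := by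
    rw [one_sub_norm_sq_mobiusDisc haD hzD, hna, hnz]
    have h1 : (1 - (1 - δ) ^ 2) * (1 - (1 - x) ^ 2) ≤ (2 * δ) * (2 * x) := by
      refine mul_le_mul ?_ ?_ ?_ ?_ <;> nlinarith
    have h2 : 100 * (δ / (δ + |θ - c|) ^ 2) * x = 100 * δ * x / (δ + |θ - c|) ^ 2 := by ring
    rw [h2, div_le_div_iff₀ (by positivity) (by positivity)]
    have h3 : (δ + |θ - c|) ^ 2 ≤ 25 * ‖1 - starRingEnd ℂ a * z‖ ^ 2 := by nlinarith
    calc _ ≤ ((2 * δ) * (2 * x)) * (25 * ‖1 - starRingEnd ℂ a * z‖ ^ 2) := by gcongr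
      _ = _ := by ring
  have hσs : (1 - ‖mobiusDisc a z‖ ^ 2) ^ s ≤ 100 ^ s * (δ / (δ + |θ - c|) ^ 2) ^ s * x ^ s := by
    rw [← Real.mul_rpow (by norm_num) (by positivity), ← Real.mul_rpow (by positivity) hx0.le]
    exact Real.rpow_le_rpow hσ0.le hσ hs0.le
  have hW : 0 ≤ (δ / (δ + |θ - c|) ^ 2) ^ s := by positivity
  have hz0 := one_sub_norm_sq_pos hzD
  have hzx : (1 - ‖z‖ ^ 2) ^ (p - 2) ≤ 2 ^ |p - 2| * x ^ (p - 2) := by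
    refine Real.rpow_le_two_rpow_abs_mul hz0 ?_ ?_ <;> rw [hnz] <;> nlinarith
  rw [depthDeriv, ← hz, ← ofReal_norm, ENNReal.ofReal_rpow_of_nonneg (norm_nonneg _)
      (by linarith), invariantDensity, mobiusWeight, ← ENNReal.ofReal_mul (by positivity),
      ← ENNReal.ofReal_mul (by positivity), ← ENNReal.ofReal_mul (by linarith),
      ← ENNReal.ofReal_mul (by positivity)]
  refine ENNReal.ofReal_le_ofReal ?_
  rw [Real.rpow_add hx0]
  calc (1 - x) * (‖deriv f z‖ ^ p * (1 - ‖z‖ ^ 2) ^ (p - 2) * (1 - ‖mobiusDisc a z‖ ^ 2) ^ s)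
      ≤ 1 * (‖deriv f z‖ ^ p * (2 ^ |p - 2| * x ^ (p - 2)) *
        (100 ^ s * (δ / (δ + |θ - c|) ^ 2) ^ s * x ^ s)) := by gcongr; linarith
    _ = _ := by ring

theorem lintegral_depth_kernel_le {s : ℝ} (hs0 : 0 < s) (hs1 : s < 1) {v : ℝ} (hv : 0 < v) :
    ∫⁻ x in Ioo 0 1, ENNReal.ofReal (x ^ (s - 1)) * ENNReal.ofReal (1 / (x + v) ^ 2) ≤
      ENNReal.ofReal (1 / s + 1 / (2 - s)) * ENNReal.ofReal (v ^ (s - 2)) := by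
  have hsub : Ioo (0 : ℝ) 1 ⊆ Ioc 0 v ∪ Ioi v := by
    intro x hx
    rcases le_or_gt x v with h | h
    · exact Or.inl ⟨hx.1, h⟩
    · exact Or.inr h
  refine (lintegral_mono_set hsub).trans ((lintegral_union_le _ _ _).trans ?_)
  have h1 : ∫⁻ x in Ioc 0 v, ENNReal.ofReal (x ^ (s - 1)) * ENNReal.ofReal (1 / (x + v) ^ 2) ≤
      ENNReal.ofReal (1 / s * v ^ (s - 2)) := by
    calc _ ≤ ∫⁻ x in Ioc 0 v, ENNReal.ofReal (1 / v ^ 2) * ENNReal.ofReal (x ^ (s - 1)) := by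
          refine setLIntegral_mono' measurableSet_Ioc fun x hx => ?_
          rw [mul_comm]
          have := hx.1
          gcongr
          linarith
      _ = _ := by
          rw [lintegral_const_mul' _ _ ENNReal.ofReal_ne_top, lintegral_Ioc_rpow (by linarith) hv.le,
            ← ENNReal.ofReal_mul (by positivity)]
          congr 1
          rw [sub_add_cancel, Real.rpow_sub hv, Real.rpow_two]
          field_simp
  have h2 : ∫⁻ x in Ioi v, ENNReal.ofReal (x ^ (s - 1)) * ENNReal.ofReal (1 / (x + v) ^ 2) ≤
      ENNReal.ofReal (1 / (2 - s) * v ^ (s - 2)) := by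
    calc _ ≤ ∫⁻ x in Ioi v, ENNReal.ofReal (x ^ (s - 3)) := by
          refine setLIntegral_mono' measurableSet_Ioi fun x hx => ?_
          have hx0 : 0 < x := hv.trans hx
          rw [← ENNReal.ofReal_mul (by positivity)]
          refine ENNReal.ofReal_le_ofReal ?_
          have e : x ^ (s - 3) = x ^ (s - 1) * (1 / x ^ 2) := by
            rw [show s - 3 = (s - 1) - 2 by ring, Real.rpow_sub hx0 (s - 1) 2, Real.rpow_two]
            ring
          rw [e]
          gcongr
          linarith
      _ = _ := by
          rw [lintegral_Ioi_rpow (by linarith) hv]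
          congr 1
          rw [show s - 3 + 1 = s - 2 by ring, neg_sub]
          ring
  refine (add_le_add h1 h2).trans (le_of_eq ?_)
  have : 0 < 2 - s := by linarith
  rw [← ENNReal.ofReal_add (by positivity) (by positivity), ← ENNReal.ofReal_mul (by positivity)]
  congr 1
  ring

/-- The increments of the boundary values at `θ`, in the norm which is compared with the
radial integral of `|f'|^p (1 - |z|)^{p-2+s}`. -/
noncomputable def incrementEnergy (p s : ℝ) (G : ℝ → ℂ) (θ : ℝ) : ENNReal :=
  ∫⁻ u in Ioc (-Real.pi) Real.pi, increment p G θ u * ENNReal.ofReal (|u| ^ (s - 2))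

/-- Integration of `depthDeriv_rpow_le` over a radius. -/
theorem lintegral_depthDeriv_rpow_le {p s : ℝ} (hp : 1 < p) (hs0 : 0 < s) (hs1 : s < 1) :
    ∃ C : NNReal, ∀ (f : ℂ → ℂ) (G : ℝ → ℂ), DifferentiableOn ℂ f unitDisc → Measurable G →
      Function.Periodic G (2 * Real.pi) →
      Tendsto (fun R : ℝ => ∫⁻ t in Ioc 0 (2 * Real.pi),
        ‖f ((R : ℂ) * (Circle.exp t : ℂ)) - G t‖ₑ) (𝓝[<] 1) (𝓝 0) → ∀ θ : ℝ,
      ∫⁻ x in Ioo 0 1, depthDeriv f x θ ^ p * ENNReal.ofReal (x ^ (p - 2 + s)) ≤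
        C * incrementEnergy p s G θ := by
  have h2s : 0 < 2 - s := by linarith
  refine ⟨(25 ^ p * 2 ^ (p - 1) * (1 / s + 1 / (2 - s))).toNNReal, fun f G hf hG hper hlim θ => ?_⟩
  have hm : Measurable (increment p G θ) :=
    (measurable_increment hG).comp (f := fun u => (θ, u)) (by fun_prop)
  calc _ ≤ ∫⁻ x in Ioo 0 1, ENNReal.ofReal (25 ^ p * 2 ^ (p - 1)) *
        ∫⁻ u in Ioc (-Real.pi) Real.pi, increment p G θ u *
          (ENNReal.ofReal (x ^ (s - 1)) * ENNReal.ofReal (1 / (x + |u|) ^ 2)) := by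
        refine setLIntegral_mono' measurableSet_Ioo fun x hx => ?_
        have hx0 := hx.1
        refine (mul_le_mul' (depthDeriv_rpow_le hp hf hG hper hlim hx θ) le_rfl).trans
          (le_of_eq ?_)
        have e : 25 ^ p * 2 ^ (p - 1) * x ^ (1 - p) * x ^ (p - 2 + s) =
            25 ^ p * 2 ^ (p - 1) * x ^ (s - 1) := by
          rw [mul_assoc, ← Real.rpow_add hx0]; congr 2; ring
        rw [mul_right_comm, ← ENNReal.ofReal_mul (by positivity), e,
          ENNReal.ofReal_mul (by positivity), mul_assoc,
          ← lintegral_const_mul' _ _ ENNReal.ofReal_ne_top]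
        congr 1
        refine lintegral_congr fun u => ?_
        ring
    _ = ENNReal.ofReal (25 ^ p * 2 ^ (p - 1)) * ∫⁻ u in Ioc (-Real.pi) Real.pi,
          ∫⁻ x in Ioo 0 1, increment p G θ u *
            (ENNReal.ofReal (x ^ (s - 1)) * ENNReal.ofReal (1 / (x + |u|) ^ 2)) := by
        rw [lintegral_const_mul' _ _ ENNReal.ofReal_ne_top, lintegral_lintegral_swap]
        have h1 : Measurable fun z : ℝ × ℝ => increment p G θ z.2 := hm.comp measurable_snd
        exact Measurable.aemeasurable (by unfold Function.uncurry; fun_prop)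
    _ ≤ ENNReal.ofReal (25 ^ p * 2 ^ (p - 1)) * ∫⁻ u in Ioc (-Real.pi) Real.pi,
          ENNReal.ofReal (1 / s + 1 / (2 - s)) *
            (increment p G θ u * ENNReal.ofReal (|u| ^ (s - 2))) := by
        gcongr with u
        rcases eq_or_ne u 0 with rfl | hu
        · simp [increment, ENNReal.zero_rpow_of_pos (by linarith : 0 < p)]
        · rw [lintegral_const_mul _ (by fun_prop), mul_left_comm]
          gcongr _ * ?_
          exact lintegral_depth_kernel_le hs0 hs1 (abs_pos.2 hu)
    _ = _ := by
        rw [lintegral_const_mul' _ _ ENNReal.ofReal_ne_top, ← mul_assoc,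
          ← ENNReal.ofReal_mul (by positivity)]
        rfl

/-- Integration against the Möbius weight, by splitting the circle into the dyadic arc around the
direction of `a` whose length is comparable to `1 - |a|`, and the differences of the larger arcs. -/
theorem lintegral_mobiusWeight_mul_le {s : ℝ} (hs0 : 0 < s) {J : ℝ → ENNReal} (M : ENNReal)
    {c δ : ℝ} (hδ0 : 0 < δ) (hδ1 : δ ≤ 1)
    (hJ : ∀ n, ∫⁻ θ in dyadicArc c n, J θ ≤ M * ENNReal.ofReal ((Real.pi / 2 ^ n) ^ s)) :
    ∫⁻ θ in dyadicArc c 0, mobiusWeight s δ (θ - c) * J θ ≤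
      M * ENNReal.ofReal (2 ^ s + 4 ^ s / (1 - 2 ^ (-s))) := by
  have hπ := Real.pi_gt_three
  -- `π / 2 ^ (n + 1) < δ ≤ π / 2 ^ n`
  obtain ⟨n, hn1, hn2⟩ := exists_nat_pow_near_of_lt_one (x := δ / Real.pi) (y := 1 / 2)
    (by positivity) (by rw [div_le_one Real.pi_pos]; linarith) (by norm_num) (by norm_num)
  rw [lt_div_iff₀ Real.pi_pos, one_div, inv_pow, inv_mul_eq_div] at hn1
  rw [div_le_iff₀ Real.pi_pos, one_div, inv_pow, inv_mul_eq_div] at hn2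
  obtain ⟨q, hq⟩ : ∃ q : ℝ, q = 2 ^ (-s) := ⟨_, rfl⟩
  have hq0 : 0 < q := by rw [hq]; positivity
  have hq1 : q < 1 := by rw [hq]; exact Real.rpow_lt_one_of_one_lt_of_neg one_lt_two (by linarith)
  obtain ⟨B, hB⟩ : ∃ B : ℝ, B = 4 ^ s / (1 - q) := ⟨_, rfl⟩
  have hq1' : 0 < 1 - q := by linarith
  have hB0 : 0 < B := by rw [hB]; positivity
  have hBq : B * (1 - q) = 4 ^ s := by rw [hB]; field_simp
  have key : ∀ k ≤ n, ∫⁻ θ in dyadicArc c (n - k), mobiusWeight s δ (θ - c) * J θ ≤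
      M * ENNReal.ofReal (2 ^ s + B * (1 - q ^ k)) := by
    intro k
    induction k with
    | zero =>
      intro _
      rw [Nat.sub_zero, pow_zero, sub_self, mul_zero, add_zero]
      calc _ ≤ ∫⁻ θ in dyadicArc c n, ENNReal.ofReal ((1 / δ) ^ s) * J θ := by
            refine lintegral_mono fun θ => ?_
            rw [mobiusWeight]
            gcongr ENNReal.ofReal (?_ ^ s) * _
            rw [div_le_div_iff₀ (by positivity) hδ0]
            nlinarith [abs_nonneg (θ - c)]
        _ ≤ ENNReal.ofReal ((1 / δ) ^ s) * (M * ENNReal.ofReal ((Real.pi / 2 ^ n) ^ s)) := by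
            rw [lintegral_const_mul' _ _ ENNReal.ofReal_ne_top]
            gcongr
            exact hJ n
        _ = M * ENNReal.ofReal ((1 / δ * (Real.pi / 2 ^ n)) ^ s) := by
            rw [Real.mul_rpow (by positivity) (by positivity), ENNReal.ofReal_mul (by positivity)]
            ring
        _ ≤ _ := by
            gcongr M * ENNReal.ofReal (?_ ^ s)
            rw [pi_div_two_pow_succ] at hn1
            rw [one_div_mul_eq_div, div_le_iff₀ hδ0]
            linarith
    | succ k ih =>
      intro hk
      have ih := ih (by omega)
      obtain ⟨m, hm⟩ : ∃ m, m = n - (k + 1) := ⟨_, rfl⟩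
      have e : n - k = m + 1 := by omega
      rw [e] at ih
      rw [← hm]
      have hr := pi_div_two_pow_pos (m + 1)
      have hmn : Real.pi / 2 ^ n = Real.pi / 2 ^ (m + 1) * (1 / 2) ^ k := by
        rw [show n = m + 1 + k by omega, pow_add, one_div, inv_pow]; field_simp
      rw [← lintegral_inter_add_sdiff (B := dyadicArc c (m + 1)) _ (dyadicArc c m)
        (measurableSet_dyadicArc c (m + 1))]
      have h1 : ∫⁻ θ in dyadicArc c m \ dyadicArc c (m + 1), mobiusWeight s δ (θ - c) * J θ ≤
          M * ENNReal.ofReal (4 ^ s * q ^ k) := by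
        calc _ ≤ ∫⁻ θ in dyadicArc c m \ dyadicArc c (m + 1),
              ENNReal.ofReal ((δ / (Real.pi / 2 ^ (m + 1)) ^ 2) ^ s) * J θ := by
              refine setLIntegral_mono' ((measurableSet_dyadicArc c m).diff
                (measurableSet_dyadicArc c (m + 1))) fun θ hθ => ?_
              rw [mobiusWeight]
              have : Real.pi / 2 ^ (m + 1) ≤ |θ - c| := by
                by_contra! h
                refine hθ.2 ⟨?_, ?_⟩
                · linarith [neg_abs_le (θ - c)]
                · linarith [le_abs_self (θ - c)]
              gcongr
              linarith
          _ ≤ ∫⁻ θ in dyadicArc c m,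
              ENNReal.ofReal ((δ / (Real.pi / 2 ^ (m + 1)) ^ 2) ^ s) * J θ :=
              lintegral_mono_set (sdiff_subset : dyadicArc c m \ dyadicArc c (m + 1) ⊆ _)
          _ ≤ ENNReal.ofReal ((δ / (Real.pi / 2 ^ (m + 1)) ^ 2) ^ s) *
              (M * ENNReal.ofReal ((Real.pi / 2 ^ m) ^ s)) := by
              rw [lintegral_const_mul' _ _ ENNReal.ofReal_ne_top]
              gcongr
              exact hJ m
          _ = M * ENNReal.ofReal ((δ / (Real.pi / 2 ^ (m + 1)) ^ 2 * (Real.pi / 2 ^ m)) ^ s) := by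
              rw [Real.mul_rpow (by positivity) (by positivity),
                ENNReal.ofReal_mul (by positivity)]
              ring
          _ ≤ M * ENNReal.ofReal ((4 * (1 / 2) ^ k) ^ s) := by
              gcongr M * ENNReal.ofReal (?_ ^ s)
              have h3 : Real.pi / 2 ^ m = 2 * (Real.pi / 2 ^ (m + 1)) := by
                rw [pi_div_two_pow_succ]; ring
              rw [h3]
              rw [hmn] at hn2
              generalize Real.pi / 2 ^ (m + 1) = r at *
              rw [div_mul_eq_mul_div, div_le_iff₀ (by positivity)]
              have : (0 : ℝ) < (1 / 2) ^ k := by positivity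
              nlinarith [mul_pos hr hr]
          _ = _ := by
              rw [Real.mul_rpow (by norm_num) (by positivity), hq, ← Real.rpow_natCast,
                ← Real.rpow_natCast, ← Real.rpow_mul (by norm_num), ← Real.rpow_mul (by norm_num),
                one_div, Real.inv_rpow (by norm_num), ← Real.rpow_neg (by norm_num)]
              congr 4
              ring
      have h2 : ∫⁻ θ in dyadicArc c m ∩ dyadicArc c (m + 1), mobiusWeight s δ (θ - c) * J θ ≤
          M * ENNReal.ofReal (2 ^ s + B * (1 - q ^ k)) :=
        (lintegral_mono_set inter_subset_right).trans ih
      refine (add_le_add h2 h1).trans (le_of_eq ?_)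
      have : 0 ≤ 1 - q ^ k := by linarith [pow_le_one₀ (n := k) hq0.le hq1.le]
      rw [← mul_add, ← ENNReal.ofReal_add (by positivity) (by positivity), ← hBq]
      congr 2
      ring
  have := key n le_rfl
  rw [Nat.sub_self] at this
  refine this.trans ?_
  rw [← hq, ← hB]
  gcongr
  have : 0 < q ^ n := by positivity
  nlinarith

/-- Boundary values in `Q^p_s(𝕋)`, attained in the `L¹` sense, belong to functions in
`Q^p_s(𝔻)`. -/
theorem memQDisc_of_memQCircle {p s : ℝ} (hp : 1 < p) (hs0 : 0 < s) (hs1 : s < 1) {f : ℂ → ℂ}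
    {g : Circle → ℂ} (hf : DifferentiableOn ℂ f unitDisc)
    (hg : Measurable fun θ : ℝ => g (Circle.exp θ))
    (hlim : Tendsto (fun R : ℝ => ∫⁻ t in Ioc 0 (2 * Real.pi),
      ‖f ((R : ℂ) * (Circle.exp t : ℂ)) - g (Circle.exp t)‖ₑ) (𝓝[<] 1) (𝓝 0))
    (h : MemQCircle p s g) : MemQDisc p s f := by
  obtain ⟨-, hM⟩ := h
  obtain ⟨M, hMe⟩ : ∃ M, M = ⨆ (a : ℝ) (l : ℝ) (_ : l ∈ Ioc 0 (2 * Real.pi)),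
      arcEnergy p s g a l / ENNReal.ofReal (l ^ s) := ⟨_, rfl⟩
  rw [← hMe] at hM
  have harc : ∀ a l : ℝ, l ∈ Ioc 0 (2 * Real.pi) →
      arcEnergy p s g a l ≤ M * ENNReal.ofReal (l ^ s) := by
    intro a l hl
    have hl0 : 0 < l ^ s := Real.rpow_pos_of_pos hl.1 s
    rw [← ENNReal.div_le_iff (by simpa using hl0) ENNReal.ofReal_ne_top, hMe]
    exact le_iSup_of_le a (le_iSup_of_le l (le_iSup_of_le hl le_rfl))
  obtain ⟨C₁, hC₁⟩ := lintegral_dyadicArc_increment_le hp hs0 hs1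
  obtain ⟨C₂, hC₂⟩ := lintegral_depthDeriv_rpow_le hp hs0 hs1
  have hper : Function.Periodic (fun θ => g (Circle.exp θ)) (2 * Real.pi) := fun θ => by simp
  have hJ : ∀ c n, ∫⁻ θ in dyadicArc c n, incrementEnergy p s (fun θ => g (Circle.exp θ)) θ ≤
      C₁ * M * ENNReal.ofReal ((Real.pi / 2 ^ n) ^ s) := by
    intro c n
    have := hC₁ g M hg harc c n
    rwa [show dyadicArc 0 0 = Ioc (-Real.pi) Real.pi by simp [dyadicArc]] at this
  refine ⟨hf, ?_⟩
  refine lt_of_le_of_lt (b := ENNReal.ofReal (2 ^ |p - 2| * 100 ^ s) * (C₂ *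
    (C₁ * M * ENNReal.ofReal (2 ^ s + 4 ^ s / (1 - 2 ^ (-s)))))) (iSup₂_le fun a ha => ?_) ?_
  · rw [besovEnergy_comp_mobiusDisc hf ha]
    obtain ⟨δ, c, hδ0, hδ1, rfl⟩ := exists_eq_mul_circleExp ha
    rw [setLIntegral_unitDisc_eq (measurable_invariantDensity p s f _) (c - Real.pi)]
    have e : Ioc (c - Real.pi) (c - Real.pi + 2 * Real.pi) = dyadicArc c 0 := by
      rw [dyadicArc]; congr 1; simp; ring
    rw [e]
    have hd := measurable_depthDeriv f
    have hw := measurable_mobiusWeight s δ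
    calc _ ≤ ∫⁻ x in Ioo 0 1, ∫⁻ θ in dyadicArc c 0, ENNReal.ofReal (2 ^ |p - 2| * 100 ^ s) *
          (mobiusWeight s δ (θ - c) *
            (depthDeriv f x θ ^ p * ENNReal.ofReal (x ^ (p - 2 + s)))) := by
          refine setLIntegral_mono' measurableSet_Ioo fun x hx =>
            setLIntegral_mono' (measurableSet_dyadicArc c 0) fun θ hθ => ?_
          refine invariantDensity_polar_le hp hs0 f hδ0 hδ1 hx ?_
          simp only [dyadicArc, pow_zero, div_one] at hθ
          exact abs_le.2 ⟨by linarith [hθ.1], by linarith [hθ.2]⟩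
      _ = ENNReal.ofReal (2 ^ |p - 2| * 100 ^ s) * ∫⁻ θ in dyadicArc c 0, ∫⁻ x in Ioo 0 1,
          mobiusWeight s δ (θ - c) *
            (depthDeriv f x θ ^ p * ENNReal.ofReal (x ^ (p - 2 + s))) := by
          rw [lintegral_lintegral_swap]
          · simp only [lintegral_const_mul' _ _ ENNReal.ofReal_ne_top]
          · have h1 : Measurable fun z : ℝ × ℝ => mobiusWeight s δ (z.2 - c) :=
              hw.comp (by fun_prop)
            exact Measurable.aemeasurable (by unfold Function.uncurry; fun_prop)
      _ ≤ ENNReal.ofReal (2 ^ |p - 2| * 100 ^ s) * ∫⁻ θ in dyadicArc c 0,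
          C₂ * (mobiusWeight s δ (θ - c) *
            incrementEnergy p s (fun θ => g (Circle.exp θ)) θ) := by
          gcongr with θ
          rw [lintegral_const_mul' _ _ (by simp [mobiusWeight]), mul_left_comm]
          gcongr _ * ?_
          exact hC₂ f _ hf hg hper hlim θ
      _ ≤ _ := by
          rw [lintegral_const_mul' _ _ ENNReal.coe_ne_top]
          gcongr _ * (_ * ?_)
          exact lintegral_mobiusWeight_mul_le hs0 _ hδ0 hδ1 (hJ c)
  · exact ENNReal.mul_lt_top ENNReal.ofReal_lt_top (ENNReal.mul_lt_top ENNReal.coe_lt_top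
      (ENNReal.mul_lt_top (ENNReal.mul_lt_top ENNReal.coe_lt_top hM) ENNReal.ofReal_lt_top))

/-! ### Factorization of holomorphic functions into square factors -/

/-- `f = k l` in the disc, where `|k|^2` and `|l|^2` have a common continuous majorant which
equals `|f|` on the circle. -/
def HasSquareFactors (f : ℂ → ℂ) : Prop :=
  ∃ (k l : ℂ → ℂ) (H : ℂ → ℝ), DifferentiableOn ℂ k unitDisc ∧ DifferentiableOn ℂ l unitDisc ∧
    ContinuousOn H (Metric.closedBall 0 1) ∧ (∀ z ∈ unitDisc, f z = k z * l z) ∧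
    (∀ z ∈ unitDisc, ‖k z‖ ^ 2 ≤ H z ∧ ‖l z‖ ^ 2 ≤ H z) ∧ ∀ z, ‖z‖ = 1 → H z = ‖f z‖

theorem unitDisc_subset_closedBall : unitDisc ⊆ Metric.closedBall 0 1 := Metric.ball_subset_closedBall

theorem exists_sq_eq_on_unitDisc {h : ℂ → ℂ} (hd : DifferentiableOn ℂ h unitDisc)
    (h0 : ∀ z ∈ unitDisc, h z ≠ 0) :
    ∃ k : ℂ → ℂ, DifferentiableOn ℂ k unitDisc ∧ ∀ z ∈ unitDisc, k z ^ 2 = h z := by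
  have hq : DifferentiableOn ℂ (fun z => deriv h z / h z) unitDisc :=
    (hd.deriv isOpen_unitDisc).fun_div hd h0
  obtain ⟨P, hP⟩ := DifferentiableOn.isExactOn_ball hq
  have hPd : DifferentiableOn ℂ P unitDisc := fun z hz =>
    (hP z hz).differentiableAt.differentiableWithinAt
  -- `h exp(-P)` is constant
  obtain ⟨C, hC⟩ : ∃ C, ∀ z ∈ unitDisc, h z * Complex.exp (-P z) = C := by
    refine isOpen_unitDisc.exists_is_const_of_deriv_eq_zero
      (convex_ball (0 : ℂ) 1).isPreconnected (hd.fun_mul hPd.fun_neg.cexp) fun z hz => ?_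
    have h1 := (hd.differentiableAt (isOpen_unitDisc.mem_nhds hz)).hasDerivAt
    have h2 := h1.fun_mul (hP z hz).fun_neg.cexp
    rw [h2.deriv]
    have := h0 z hz
    simp only [Pi.zero_apply]
    field_simp
    ring
  refine ⟨fun z => C ^ (1 / 2 : ℂ) * Complex.exp (P z / 2), (hPd.div_const 2).cexp.const_mul _,
    fun z hz => ?_⟩
  have h2 : (C ^ (1 / 2 : ℂ)) ^ 2 = C := by
    rw [one_div]; exact Complex.cpow_nat_inv_pow C two_ne_zero
  rw [mul_pow, h2, ← Complex.exp_nat_mul, ← hC z hz, mul_assoc, ← Complex.exp_add]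
  push_cast
  rw [mul_div_cancel₀ _ two_ne_zero, neg_add_cancel, Complex.exp_zero, mul_one]

theorem HasSquareFactors.of_ne_zero {h : ℂ → ℂ} (hc : ContinuousOn h (Metric.closedBall 0 1))
    (hd : DifferentiableOn ℂ h unitDisc) (h0 : ∀ z ∈ unitDisc, h z ≠ 0) :
    HasSquareFactors h := by
  obtain ⟨k, hk, hkh⟩ := exists_sq_eq_on_unitDisc hd h0
  refine ⟨k, k, fun z => ‖h z‖, hk, hk, hc.norm, fun z hz => ?_, fun z hz => ?_, fun z _ => rfl⟩
  · rw [← hkh z hz, sq]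
  · simp only [← hkh z hz, norm_pow]; exact ⟨le_rfl, le_rfl⟩

theorem norm_one_sub_conj_mul_sq_sub (u z : ℂ) :
    ‖1 - starRingEnd ℂ u * z‖ ^ 2 - ‖z - u‖ ^ 2 = (1 - ‖u‖ ^ 2) * (1 - ‖z‖ ^ 2) := by
  simp only [← Complex.normSq_eq_norm_sq, Complex.normSq_apply, Complex.sub_re, Complex.sub_im,
    Complex.mul_re, Complex.mul_im, Complex.conj_re, Complex.conj_im, Complex.one_re,
    Complex.one_im]
  ring

theorem norm_sub_le_norm_one_sub_conj_mul {u z : ℂ} (hu : ‖u‖ ≤ 1) (hz : ‖z‖ ≤ 1) :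
    ‖z - u‖ ≤ ‖1 - starRingEnd ℂ u * z‖ := by
  have h := norm_one_sub_conj_mul_sq_sub u z
  have h1 : 0 ≤ (1 - ‖u‖ ^ 2) * (1 - ‖z‖ ^ 2) :=
    mul_nonneg (by nlinarith [norm_nonneg u]) (by nlinarith [norm_nonneg z])
  exact (sq_le_sq₀ (norm_nonneg _) (norm_nonneg _)).1 (by linarith)

theorem norm_sub_eq_norm_one_sub_conj_mul {u z : ℂ} (hz : ‖z‖ = 1) :
    ‖z - u‖ = ‖1 - starRingEnd ℂ u * z‖ := by
  have h := norm_one_sub_conj_mul_sq_sub u z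
  rw [hz, one_pow, sub_self, mul_zero, sub_eq_zero] at h
  exact ((sq_eq_sq₀ (norm_nonneg _) (norm_nonneg _)).1 h).symm

/-- The functions whose product with any continuous function, holomorphic and zero-free in the disc,
has square factors. -/
def SquareFactorable (φ : ℂ → ℂ) : Prop :=
  ∀ h : ℂ → ℂ, ContinuousOn h (Metric.closedBall 0 1) → DifferentiableOn ℂ h unitDisc →
    (∀ z ∈ unitDisc, h z ≠ 0) → HasSquareFactors fun z => φ z * h z

/-- A zero in the disc is exchanged for a Blaschke factor, which has modulus one on the circle; a
zero outside the open disc does no harm. -/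
theorem SquareFactorable.sub_mul {φ : ℂ → ℂ} (hφ : SquareFactorable φ) (u : ℂ) :
    SquareFactorable fun z => (z - u) * φ z := by
  intro h hc hd h0
  by_cases hu : u ∈ unitDisc
  · have hu1 := mem_unitDisc.1 hu
    obtain ⟨k, l, H, hk, hl, hH, hf, hle, heq⟩ := hφ (fun z => (1 - starRingEnd ℂ u * z) * h z)
      (ContinuousOn.mul (by fun_prop) hc) (DifferentiableOn.mul (by fun_prop) hd)
      fun z hz => mul_ne_zero (one_sub_conj_mul_ne_zero hu hz) (h0 z hz)
    refine ⟨k, fun z => l z * ((z - u) / (1 - starRingEnd ℂ u * z)), H, hk,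
      hl.fun_mul (DifferentiableOn.fun_div (by fun_prop) (by fun_prop) fun z hz =>
        one_sub_conj_mul_ne_zero hu hz), hH, fun z hz => ?_, fun z hz => ⟨(hle z hz).1, ?_⟩,
      fun z hz => ?_⟩
    · have := one_sub_conj_mul_ne_zero hu hz
      rw [← mul_assoc, ← hf z hz, ← mul_div_assoc, eq_div_iff this]
      ring
    · have h1 := norm_pos_iff.2 (one_sub_conj_mul_ne_zero hu hz)
      have h2 : ‖(z - u) / (1 - starRingEnd ℂ u * z)‖ ≤ 1 := by
        rw [norm_div, div_le_one h1]
        exact norm_sub_le_norm_one_sub_conj_mul hu1.le (mem_unitDisc.1 hz).le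
      refine le_trans ?_ (hle z hz).2
      rw [norm_mul]
      gcongr
      exact mul_le_of_le_one_right (norm_nonneg _) h2
    · rw [heq z hz, norm_mul, norm_mul, norm_mul, norm_mul, norm_sub_eq_norm_one_sub_conj_mul hz]
      ring
  · have := hφ (fun z => (z - u) * h z) (ContinuousOn.mul (by fun_prop) hc)
      (DifferentiableOn.mul (by fun_prop) hd) fun z hz => mul_ne_zero
        (sub_ne_zero.2 fun e => hu (e ▸ hz)) (h0 z hz)
    convert this using 2 with z
    ring

theorem squareFactorable_prod (T : Finset ℂ) (m : ℂ → ℕ) :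
    SquareFactorable fun z => ∏ u ∈ T, (z - u) ^ m u := by
  classical
  induction T using Finset.induction_on with
  | empty =>
    intro h hc hd h0
    simpa using HasSquareFactors.of_ne_zero hc hd h0
  | insert u T hu ih =>
    simp only [Finset.prod_insert hu]
    induction m u with
    | zero => simpa using ih
    | succ n hn => simpa only [pow_succ', mul_assoc] using hn.sub_mul u

/-- A function holomorphic on the closed disc has finitely many zeros there, which split off. -/
theorem exists_eq_prod_mul_of_analyticOnNhd {f : ℂ → ℂ}
    (hf : AnalyticOnNhd ℂ f (Metric.closedBall 0 1)) {z₀ : ℂ} (hz₀ : z₀ ∈ unitDisc)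
    (hfz₀ : f z₀ ≠ 0) :
    ∃ (T : Finset ℂ) (m : ℂ → ℕ) (g : ℂ → ℂ), AnalyticOnNhd ℂ g (Metric.closedBall 0 1) ∧
      (∀ z ∈ Metric.closedBall (0 : ℂ) 1, g z ≠ 0) ∧
      ∀ z ∈ Metric.closedBall (0 : ℂ) 1, f z = (∏ u ∈ T, (z - u) ^ m u) * g z := by
  have hm : MeromorphicOn f (Metric.closedBall 0 1) := hf.meromorphicOn
  have hord : ∀ u : Metric.closedBall (0 : ℂ) 1, meromorphicOrderAt f u ≠ ⊤ := by
    have hconn : IsConnected (Metric.closedBall (0 : ℂ) 1) :=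
      ⟨⟨0, by simp⟩, (convex_closedBall (0 : ℂ) 1).isPreconnected⟩
    refine (hm.exists_meromorphicOrderAt_ne_top_iff_forall hconn).1
      ⟨⟨z₀, unitDisc_subset_closedBall hz₀⟩, ?_⟩
    have ha := hf z₀ (unitDisc_subset_closedBall hz₀)
    have : analyticOrderAt f z₀ = 0 := ha.analyticOrderAt_eq_zero.2 hfz₀
    rw [ha.meromorphicOrderAt_eq, this]
    simp
  have hfin := (MeromorphicOn.divisor f (Metric.closedBall 0 1)).finiteSupport
    (isCompact_closedBall (0 : ℂ) 1)
  obtain ⟨g, hga, hg0, hfg⟩ := hm.extract_zeros_poles hord hfin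
  obtain ⟨D, hD⟩ : ∃ D, D = MeromorphicOn.divisor f (Metric.closedBall 0 1) := ⟨_, rfl⟩
  rw [← hD] at hfin hfg
  have hD0 : 0 ≤ D := hD ▸ MeromorphicOn.AnalyticOnNhd.divisor_nonneg hf
  refine ⟨hfin.toFinset, fun u => (D u).toNat, g, hga, fun z hz => hg0 ⟨z, hz⟩, ?_⟩
  have hprod : ∀ z, ((∏ᶠ u, (· - u) ^ D u) • g) z =
      (∏ u ∈ hfin.toFinset, (z - u) ^ (D u).toNat) * g z := by
    intro z
    rw [Function.FactorizedRational.finprod_eq_fun hfin, Pi.smul_apply', smul_eq_mul]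
    congr 1
    rw [finprod_eq_prod_of_mulSupport_subset (s := hfin.toFinset)]
    · refine Finset.prod_congr rfl fun u _ => ?_
      rw [← zpow_natCast, Int.toNat_of_nonneg (hD0 u)]
    · intro u hu
      simp only [Finite.coe_toFinset, Function.mem_support]
      rintro h
      simp [h] at hu
  have hcont : ContinuousOn (fun z => (∏ u ∈ hfin.toFinset, (z - u) ^ (D u).toNat) * g z)
      (Metric.closedBall 0 1) := ContinuousOn.mul (by fun_prop) hga.continuousOn
  have hball : EqOn f (fun z => (∏ u ∈ hfin.toFinset, (z - u) ^ (D u).toNat) * g z)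
      (Metric.ball 0 1) := by
    intro x hx
    have hnhds : Metric.closedBall (0 : ℂ) 1 ∈ 𝓝 x :=
      mem_of_superset (Metric.isOpen_ball.mem_nhds hx) Metric.ball_subset_closedBall
    have h1 := mem_codiscreteWithin_iff_forall_mem_nhdsNE.1 hfg x (Metric.ball_subset_closedBall hx)
    have h2 : ∀ᶠ z in 𝓝[≠] x, f z = (∏ u ∈ hfin.toFinset, (z - u) ^ (D u).toNat) * g z := by
      filter_upwards [h1, nhdsWithin_le_nhds hnhds] with z hz hzb
      rcases hz with hz | hz
      · rw [← hprod z]; exact hz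
      · exact absurd hzb hz
    exact tendsto_nhds_unique_of_eventuallyEq
      ((hf.continuousOn.continuousAt hnhds).tendsto.mono_left nhdsWithin_le_nhds)
      ((hcont.continuousAt hnhds).tendsto.mono_left nhdsWithin_le_nhds) h2
  exact hball.of_subset_closure hf.continuousOn hcont Metric.ball_subset_closedBall
    (closure_ball (0 : ℂ) one_ne_zero).ge

theorem hasSquareFactors_of_analyticOnNhd {f : ℂ → ℂ}
    (hf : AnalyticOnNhd ℂ f (Metric.closedBall 0 1)) : HasSquareFactors f := by
  by_cases h0 : ∃ z₀ ∈ unitDisc, f z₀ ≠ 0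
  · obtain ⟨z₀, hz₀, hfz₀⟩ := h0
    obtain ⟨T, m, g, hga, hg0, hfg⟩ := exists_eq_prod_mul_of_analyticOnNhd hf hz₀ hfz₀
    obtain ⟨k, l, H, hk, hl, hH, hf', hle, heq⟩ := squareFactorable_prod T m g hga.continuousOn
      (hga.differentiableOn.mono unitDisc_subset_closedBall)
      fun z hz => hg0 z (unitDisc_subset_closedBall hz)
    refine ⟨k, l, H, hk, hl, hH, fun z hz => ?_, hle, fun z hz => ?_⟩
    · rw [hfg z (unitDisc_subset_closedBall hz), ← hf' z hz]
    · rw [hfg z (by simp [hz]), heq z hz]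
  · push Not at h0
    refine ⟨0, 0, fun z => ‖f z‖, by fun_prop, by fun_prop, hf.continuousOn.norm,
      fun z hz => by simp [h0 z hz], fun z hz => by simp, fun z _ => rfl⟩

/-! ### Power series with square summable coefficients -/

theorem integral_circleExp_pow_mul_conj_pow (i j : ℕ) :
    ∫ θ in (0 : ℝ)..2 * Real.pi,
      (Circle.exp θ : ℂ) ^ i * starRingEnd ℂ ((Circle.exp θ : ℂ) ^ j) =
      if i = j then 2 * Real.pi else 0 := by
  have h : ∀ θ : ℝ, (Circle.exp θ : ℂ) ^ i * starRingEnd ℂ ((Circle.exp θ : ℂ) ^ j) =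
      Complex.exp (((i - j : ℤ) : ℂ) * Complex.I * θ) := by
    intro θ
    rw [map_pow, ← Circle.coe_inv_eq_conj, ← Circle.exp_neg, Circle.coe_exp, Circle.coe_exp,
      ← Complex.exp_nat_mul, ← Complex.exp_nat_mul, ← Complex.exp_add]
    congr 1
    push_cast
    ring
  simp only [h]
  split_ifs with hij
  · simp [hij]
  · have hc : ((i - j : ℤ) : ℂ) ≠ 0 := by
      rw [Int.cast_ne_zero, sub_ne_zero]; exact_mod_cast hij
    rw [integral_exp_mul_complex (mul_ne_zero hc Complex.I_ne_zero)]
    have : ((i - j : ℤ) : ℂ) * Complex.I * ((2 * Real.pi : ℝ) : ℂ) =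
        (i - j : ℤ) * (2 * Real.pi * Complex.I) := by push_cast; ring
    rw [this, Complex.exp_int_mul_two_pi_mul_I]
    simp

theorem integral_norm_sq_sum_range (b : ℕ → ℂ) (N : ℕ) :
    ∫ θ in (0 : ℝ)..2 * Real.pi, ‖∑ j ∈ Finset.range N, b j * (Circle.exp θ : ℂ) ^ j‖ ^ 2 =
      2 * Real.pi * ∑ j ∈ Finset.range N, ‖b j‖ ^ 2 := by
  have hcont : ∀ j : ℕ, Continuous fun θ : ℝ => (Circle.exp θ : ℂ) ^ j := fun j => by fun_prop
  have hcj : ∀ j : ℕ, Continuous fun θ : ℝ => starRingEnd ℂ ((Circle.exp θ : ℂ) ^ j) := fun j =>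
    Complex.continuous_conj.comp (hcont j)
  apply Complex.ofReal_injective
  rw [← intervalIntegral.integral_ofReal]
  have h : ∀ θ : ℝ, ((‖∑ j ∈ Finset.range N, b j * (Circle.exp θ : ℂ) ^ j‖ ^ 2 : ℝ) : ℂ) =
      ∑ i ∈ Finset.range N, ∑ j ∈ Finset.range N, b i * starRingEnd ℂ (b j) *
        ((Circle.exp θ : ℂ) ^ i * starRingEnd ℂ ((Circle.exp θ : ℂ) ^ j)) := by
    intro θ
    rw [← Complex.normSq_eq_norm_sq, Complex.normSq_eq_conj_mul_self, map_sum, mul_comm,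
      Finset.sum_mul_sum]
    refine Finset.sum_congr rfl fun i _ => Finset.sum_congr rfl fun j _ => ?_
    rw [map_mul]
    ring
  simp only [h]
  rw [intervalIntegral.integral_finsetSum fun i _ => Continuous.intervalIntegrable (by
    have := hcont i
    fun_prop) _ _]
  have hin : ∀ i, ∫ θ in (0 : ℝ)..2 * Real.pi, ∑ j ∈ Finset.range N, b i * starRingEnd ℂ (b j) *
      ((Circle.exp θ : ℂ) ^ i * starRingEnd ℂ ((Circle.exp θ : ℂ) ^ j)) =
      ∑ j ∈ Finset.range N, b i * starRingEnd ℂ (b j) *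
        (if i = j then 2 * Real.pi else 0 : ℝ) := by
    intro i
    rw [intervalIntegral.integral_finsetSum]
    swap
    · exact fun j _ => (continuous_const.mul ((hcont i).mul (hcj j))).intervalIntegrable _ _
    refine Finset.sum_congr rfl fun j _ => ?_
    rw [intervalIntegral.integral_const_mul, integral_circleExp_pow_mul_conj_pow]
  rw [Finset.sum_congr rfl fun i _ => hin i]
  simp only [apply_ite ((↑) : ℝ → ℂ), Complex.ofReal_zero]
  simp only [mul_ite, mul_zero, Finset.sum_ite_eq, Finset.mem_range]
  push_cast
  rw [Finset.mul_sum]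
  refine Finset.sum_congr rfl fun i hi => ?_
  rw [if_pos (Finset.mem_range.1 hi), ← Complex.ofReal_pow, ← Complex.normSq_eq_norm_sq,
    Complex.normSq_eq_conj_mul_self]
  ring

/-- Parseval's identity for absolutely convergent series. -/
theorem hasSum_norm_sq_of_summable {b : ℕ → ℂ} (hb : Summable fun j => ‖b j‖) :
    HasSum (fun j => 2 * Real.pi * ‖b j‖ ^ 2)
      (∫ θ in (0 : ℝ)..2 * Real.pi, ‖∑' j, b j * (Circle.exp θ : ℂ) ^ j‖ ^ 2) := by
  rw [hasSum_iff_tendsto_nat_of_nonneg fun j => by positivity]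
  simp only [← Finset.mul_sum, ← integral_norm_sq_sum_range]
  have hn : ∀ (θ : ℝ) j, ‖b j * (Circle.exp θ : ℂ) ^ j‖ = ‖b j‖ := by
    intro θ j
    rw [norm_mul, norm_pow, Circle.norm_coe, one_pow, mul_one]
  have hs : ∀ θ : ℝ, Summable fun j => b j * (Circle.exp θ : ℂ) ^ j := fun θ =>
    Summable.of_norm (by simpa only [hn] using hb)
  refine intervalIntegral.tendsto_integral_filter_of_dominated_convergence
    (fun _ => (∑' j, ‖b j‖) ^ 2) (Eventually.of_forall fun N => ?_)
    (Eventually.of_forall fun N => ae_of_all _ fun θ _ => ?_) intervalIntegrable_const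
    (ae_of_all _ fun θ _ => ?_)
  · exact Continuous.aestronglyMeasurable (by fun_prop)
  · rw [norm_pow, norm_norm]
    refine pow_le_pow_left₀ (norm_nonneg _) ((norm_sum_le _ _).trans ?_) 2
    simp only [hn]
    exact hb.sum_le_tsum _ fun j _ => norm_nonneg _
  · exact ((hs θ).hasSum.tendsto_sum_nat.norm).pow 2

theorem hasSum_taylor_unitDisc {k : ℂ → ℂ} (hk : DifferentiableOn ℂ k unitDisc) :
    ∃ a : ℕ → ℂ, ∀ z ∈ unitDisc, HasSum (fun j => a j * z ^ j) (k z) := by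
  refine ⟨fun j => (j.factorial : ℂ)⁻¹ * iteratedDeriv j k 0, fun z hz => ?_⟩
  have := Complex.hasSum_taylorSeries_on_ball hk hz
  simpa [mul_assoc, mul_comm, mul_left_comm] using this

theorem summable_norm_mul_pow {a : ℕ → ℂ} {k : ℂ → ℂ}
    (ha : ∀ z ∈ unitDisc, HasSum (fun j => a j * z ^ j) (k z)) {r : ℝ} (hr : r ∈ Ioo 0 1) :
    Summable fun j => ‖a j * (r : ℂ) ^ j‖ := by
  have : (r : ℂ) ∈ unitDisc := by
    rw [mem_unitDisc, Complex.norm_real, Real.norm_of_nonneg hr.1.le]; exact hr.2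
  exact (ha r this).summable.norm

theorem real_mul_circle_mem_unitDisc {r : ℝ} (hr : r ∈ Ioo 0 1) (ζ : Circle) :
    (r : ℂ) * (ζ : ℂ) ∈ unitDisc := by
  rw [mem_unitDisc, norm_real_mul_circle, abs_of_pos hr.1]; exact hr.2

/-- The coefficients of a function with `|k|^2 ≤ H` are square summable with the bound given by the
integral of `H` over the circle. -/
theorem sum_norm_sq_le_integral {k : ℂ → ℂ} {H : ℂ → ℝ} {a : ℕ → ℂ}
    (hk : DifferentiableOn ℂ k unitDisc)
    (ha : ∀ z ∈ unitDisc, HasSum (fun j => a j * z ^ j) (k z))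
    (hH : ContinuousOn H (Metric.closedBall 0 1)) (hkH : ∀ z ∈ unitDisc, ‖k z‖ ^ 2 ≤ H z) (N : ℕ) :
    2 * Real.pi * ∑ j ∈ Finset.range N, ‖a j‖ ^ 2 ≤
      ∫ θ in (0 : ℝ)..2 * Real.pi, H (Circle.exp θ) := by
  have hmem : ∀ r ∈ Ioo (0 : ℝ) 1, ∀ θ : ℝ,
      (r : ℂ) * (Circle.exp θ : ℂ) ∈ Metric.closedBall (0 : ℂ) 1 := fun r hr θ =>
    unitDisc_subset_closedBall (real_mul_circle_mem_unitDisc hr _)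
  have hHc : ∀ r ∈ Ioo (0 : ℝ) 1, Continuous fun θ : ℝ => H ((r : ℂ) * (Circle.exp θ : ℂ)) :=
    fun r hr => hH.comp_continuous (by fun_prop) (hmem r hr)
  have key : ∀ r ∈ Ioo (0 : ℝ) 1, 2 * Real.pi * ∑ j ∈ Finset.range N, ‖a j * (r : ℂ) ^ j‖ ^ 2 ≤
      ∫ θ in (0 : ℝ)..2 * Real.pi, H ((r : ℂ) * (Circle.exp θ : ℂ)) := by
    intro r hr
    have h1 := hasSum_norm_sq_of_summable (summable_norm_mul_pow ha hr)
    rw [Finset.mul_sum]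
    refine (sum_le_hasSum _ (fun j _ => by positivity) h1).trans ?_
    refine intervalIntegral.integral_mono_on Real.two_pi_pos.le ?_
      ((hHc r hr).intervalIntegrable _ _) fun θ _ => ?_
    · refine Continuous.intervalIntegrable (Continuous.pow (Continuous.norm ?_) 2) _ _
      have : Continuous fun θ : ℝ => k ((r : ℂ) * (Circle.exp θ : ℂ)) :=
        hk.continuousOn.comp_continuous (by fun_prop) fun θ => real_mul_circle_mem_unitDisc hr _
      convert this using 2 with θ
      rw [← (ha _ (real_mul_circle_mem_unitDisc hr (Circle.exp θ))).tsum_eq]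
      simp only [mul_pow, mul_assoc]
    · have h2 := (ha _ (real_mul_circle_mem_unitDisc hr (Circle.exp θ))).tsum_eq
      simp only [mul_pow, ← mul_assoc] at h2
      rw [h2]
      exact hkH _ (real_mul_circle_mem_unitDisc hr _)
  obtain ⟨B, hB⟩ := (isCompact_closedBall (0 : ℂ) 1).exists_bound_of_continuousOn hH
  have hr1 : ∀ᶠ r : ℝ in 𝓝[<] 1, r ∈ Ioo (0 : ℝ) 1 := Ioo_mem_nhdsLT one_pos
  refine le_of_tendsto_of_tendsto (b := 𝓝[<] (1 : ℝ))
    (f := fun r : ℝ => 2 * Real.pi * ∑ j ∈ Finset.range N, ‖a j * (r : ℂ) ^ j‖ ^ 2)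
    (g := fun r : ℝ => ∫ θ in (0 : ℝ)..2 * Real.pi, H ((r : ℂ) * (Circle.exp θ : ℂ))) ?_ ?_
    (hr1.mono key)
  · have : Tendsto (fun r : ℝ => 2 * Real.pi * ∑ j ∈ Finset.range N, ‖a j * (r : ℂ) ^ j‖ ^ 2)
        (𝓝 1) (𝓝 (2 * Real.pi * ∑ j ∈ Finset.range N, ‖a j * ((1 : ℝ) : ℂ) ^ j‖ ^ 2)) :=
      (by fun_prop : Continuous fun r : ℝ =>
        2 * Real.pi * ∑ j ∈ Finset.range N, ‖a j * (r : ℂ) ^ j‖ ^ 2).tendsto 1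
    simp only [Complex.ofReal_one, one_pow, mul_one] at this
    exact this.mono_left nhdsWithin_le_nhds
  · refine intervalIntegral.tendsto_integral_filter_of_dominated_convergence (fun _ => B)
      (hr1.mono fun r hr => (hHc r hr).aestronglyMeasurable)
      (hr1.mono fun r hr => ae_of_all _ fun θ _ => hB _ (hmem r hr θ)) intervalIntegrable_const
      (ae_of_all _ fun θ _ => ?_)
    have h1 : (Circle.exp θ : ℂ) ∈ Metric.closedBall (0 : ℂ) 1 := by simp
    exact (hH _ h1).tendsto.comp (tendsto_nhdsWithin_iff.2
      ⟨tendsto_real_mul_nhdsLT _, hr1.mono fun r hr => hmem r hr θ⟩)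

theorem HasSquareFactors.exists_coeff {f : ℂ → ℂ} (hf : HasSquareFactors f) :
    ∃ a b : ℕ → ℂ,
      (∀ N, 2 * Real.pi * ∑ j ∈ Finset.range N, ‖a j‖ ^ 2 ≤
        ∫ θ in (0 : ℝ)..2 * Real.pi, ‖f (Circle.exp θ)‖) ∧
      (∀ N, 2 * Real.pi * ∑ j ∈ Finset.range N, ‖b j‖ ^ 2 ≤
        ∫ θ in (0 : ℝ)..2 * Real.pi, ‖f (Circle.exp θ)‖) ∧
      ∀ z ∈ unitDisc, f z = (∑' j, a j * z ^ j) * ∑' j, b j * z ^ j := by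
  obtain ⟨k, l, H, hk, hl, hH, hf, hle, heq⟩ := hf
  obtain ⟨a, ha⟩ := hasSum_taylor_unitDisc hk
  obtain ⟨b, hb⟩ := hasSum_taylor_unitDisc hl
  have e : ∀ θ : ℝ, ‖f (Circle.exp θ)‖ = H (Circle.exp θ) := fun θ =>
    (heq _ (Circle.norm_coe _)).symm
  simp only [e]
  refine ⟨a, b, sum_norm_sq_le_integral hk ha hH fun z hz => (hle z hz).1,
    sum_norm_sq_le_integral hl hb hH fun z hz => (hle z hz).2, fun z hz => ?_⟩
  rw [(ha z hz).tsum_eq, (hb z hz).tsum_eq, hf z hz]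

theorem norm_le_sqrt_of_sum_le {a : ℕ → ℂ} {A : ℝ}
    (ha : ∀ N, ∑ j ∈ Finset.range N, ‖a j‖ ^ 2 ≤ A) (j : ℕ) : ‖a j‖ ≤ √A := by
  refine Real.le_sqrt_of_sq_le (le_trans ?_ (ha (j + 1)))
  exact Finset.single_le_sum (f := fun j => ‖a j‖ ^ 2) (fun i _ => by positivity) (by simp)

/-- Every function in `H^1` is the product of two power series with square summable coefficients. -/
theorem MemHardy.exists_coeff {f : ℂ → ℂ} (hf : MemHardy 1 f) :
    ∃ a b : ℕ → ℂ, Summable (fun j => ‖a j‖ ^ 2) ∧ Summable (fun j => ‖b j‖ ^ 2) ∧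
      ∀ z ∈ unitDisc, f z = (∑' j, a j * z ^ j) * ∑' j, b j * z ^ j := by
  obtain ⟨hd, A, hA⟩ := hf
  obtain ⟨ρ, -, hρ, hρ1⟩ := exists_seq_strictMono_tendsto' (zero_lt_one' ℝ)
  have hdil : ∀ n, ∃ a b : ℕ → ℂ, (∀ N, ∑ j ∈ Finset.range N, ‖a j‖ ^ 2 ≤ A) ∧
      (∀ N, ∑ j ∈ Finset.range N, ‖b j‖ ^ 2 ≤ A) ∧
      ∀ z ∈ unitDisc, f (ρ n * z) = (∑' j, a j * z ^ j) * ∑' j, b j * z ^ j := by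
    intro n
    have hn := hρ n
    obtain ⟨U, hU, hsub, hdn⟩ := exists_isOpen_differentiableOn_dilate hd hn
    obtain ⟨a, b, ha, hb, hfab⟩ := (hasSquareFactors_of_analyticOnNhd
      ((hdn.analyticOnNhd hU).mono hsub)).exists_coeff
    have hint : ∫ θ in (0 : ℝ)..2 * Real.pi, ‖f (ρ n * (Circle.exp θ : ℂ))‖ ≤
        2 * Real.pi * A := by
      have := hA (ρ n) hn
      simp only [integralMean, Real.rpow_one, div_one] at this
      rwa [inv_mul_le_iff₀ Real.two_pi_pos] at this
    exact ⟨a, b, fun N => le_of_mul_le_mul_left ((ha N).trans hint) Real.two_pi_pos,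
      fun N => le_of_mul_le_mul_left ((hb N).trans hint) Real.two_pi_pos, hfab⟩
  choose a b ha hb hfab using hdil
  -- a subsequence along which all coefficients converge
  have hK : IsCompact (univ.pi fun _ : ℕ => Metric.closedBall (0 : ℂ) √A) :=
    isCompact_univ_pi fun _ => isCompact_closedBall _ _
  obtain ⟨⟨a', b'⟩, -, φ, hφ, hlim⟩ := (hK.prod hK).tendsto_subseq (x := fun n => (a n, b n))
    fun n => ⟨fun j _ => by simpa using norm_le_sqrt_of_sum_le (ha n) j,
      fun j _ => by simpa using norm_le_sqrt_of_sum_le (hb n) j⟩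
  rw [nhds_prod_eq, tendsto_prod_iff'] at hlim
  obtain ⟨hla, hlb⟩ := hlim
  have hla' : ∀ j, Tendsto (fun n => a (φ n) j) atTop (𝓝 (a' j)) := fun j =>
    (tendsto_pi_nhds.1 hla) j
  have hlb' : ∀ j, Tendsto (fun n => b (φ n) j) atTop (𝓝 (b' j)) := fun j =>
    (tendsto_pi_nhds.1 hlb) j
  have hsum : ∀ (c : ℕ → ℕ → ℂ) (c' : ℕ → ℂ), (∀ n N, ∑ j ∈ Finset.range N, ‖c n j‖ ^ 2 ≤ A) →
      (∀ j, Tendsto (fun n => c (φ n) j) atTop (𝓝 (c' j))) → Summable fun j => ‖c' j‖ ^ 2 := by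
    intro c c' hc hl
    refine summable_of_sum_range_le (c := A) (fun j => by positivity) fun N => ?_
    exact le_of_tendsto (tendsto_finsetSum (Finset.range N) fun j _ => (hl j).norm.pow 2)
      (Eventually.of_forall fun n => hc (φ n) N)
  have hseries : ∀ (c : ℕ → ℕ → ℂ) (c' : ℕ → ℂ),
      (∀ n N, ∑ j ∈ Finset.range N, ‖c n j‖ ^ 2 ≤ A) →
      (∀ j, Tendsto (fun n => c (φ n) j) atTop (𝓝 (c' j))) → ∀ z ∈ unitDisc,
      Tendsto (fun n => ∑' j, c (φ n) j * z ^ j) atTop (𝓝 (∑' j, c' j * z ^ j)) := by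
    intro c c' hc hl z hz
    refine tendsto_tsum_of_dominated_convergence (bound := fun j => √A * ‖z‖ ^ j)
      ((summable_geometric_of_lt_one (norm_nonneg z) (mem_unitDisc.1 hz)).mul_left _)
      (fun j => (hl j).mul_const _) (Eventually.of_forall fun n j => ?_)
    rw [norm_mul, norm_pow]
    gcongr
    exact norm_le_sqrt_of_sum_le (hc (φ n)) j
  refine ⟨a', b', hsum a a' ha hla', hsum b b' hb hlb', fun z hz => ?_⟩
  have h1 := (hseries a a' ha hla' z hz).mul (hseries b b' hb hlb' z hz)
  have h2 : Tendsto (fun n => f (ρ (φ n) * z)) atTop (𝓝 (f z)) := by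
    refine (hd.continuousOn.continuousAt (isOpen_unitDisc.mem_nhds hz)).tendsto.comp ?_
    have h3 : Tendsto (fun n => ((ρ (φ n) : ℝ) : ℂ)) atTop (𝓝 ((1 : ℝ) : ℂ)) :=
      (Complex.continuous_ofReal.tendsto 1).comp (hρ1.comp hφ.tendsto_atTop)
    simpa using h3.mul_const z
  refine tendsto_nhds_unique h2 (h1.congr fun n => (hfab (φ n) z hz).symm)

/-! ### Boundary values of `H^1` functions in `L^1` -/

theorem continuous_tsum_mul_circleExp_pow {c : ℕ → ℂ} (hc : Summable fun j => ‖c j‖) :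
    Continuous fun θ : ℝ => ∑' j, c j * (Circle.exp θ : ℂ) ^ j := by
  refine continuous_tsum (fun j => by fun_prop) hc fun j θ => ?_
  rw [norm_mul, norm_pow, Circle.norm_coe, one_pow, mul_one]

theorem lintegral_enorm_sq_tsum {c : ℕ → ℂ} (hc : Summable fun j => ‖c j‖) :
    ∫⁻ θ in Ioc 0 (2 * Real.pi), ‖∑' j, c j * (Circle.exp θ : ℂ) ^ j‖ₑ ^ (2 : ℝ) =
      ENNReal.ofReal (∑' j, 2 * Real.pi * ‖c j‖ ^ 2) := by
  have hcont := continuous_tsum_mul_circleExp_pow hc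
  rw [(hasSum_norm_sq_of_summable hc).tsum_eq,
    intervalIntegral.integral_of_le Real.two_pi_pos.le, ofReal_integral_eq_lintegral_ofReal]
  · refine lintegral_congr fun θ => ?_
    rw [← ofReal_norm, ENNReal.ofReal_rpow_of_nonneg (norm_nonneg _) two_pos.le, Real.rpow_two]
  · exact ((hcont.norm.pow 2).integrableOn_Icc).mono_set Ioc_subset_Icc_self
  · exact ae_of_all _ fun θ => by positivity

theorem summable_norm_mul_pow_of_sq {a : ℕ → ℂ} (ha : Summable fun j => ‖a j‖ ^ 2) {r : ℝ}
    (hr : r ∈ Ioo 0 1) : Summable fun j => ‖a j * (r : ℂ) ^ j‖ := by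
  have hb := norm_le_sqrt_of_sum_le (a := a) (A := ∑' j, ‖a j‖ ^ 2) fun N =>
    ha.sum_le_tsum _ fun j _ => by positivity
  refine Summable.of_nonneg_of_le (fun j => norm_nonneg _) (fun j => ?_)
    ((summable_geometric_of_lt_one hr.1.le hr.2).mul_left √(∑' j, ‖a j‖ ^ 2))
  rw [norm_mul, norm_pow, Complex.norm_real, Real.norm_of_nonneg hr.1.le]
  gcongr
  · exact pow_nonneg hr.1.le j
  · exact hb j

theorem tsum_mul_real_mul_pow (a : ℕ → ℂ) (r : ℝ) (z : ℂ) :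
    ∑' j, a j * ((r : ℂ) * z) ^ j = ∑' j, a j * (r : ℂ) ^ j * z ^ j := by
  simp only [mul_pow, mul_assoc]

theorem lintegral_enorm_sq_tsum_radius_le {a : ℕ → ℂ} (ha : Summable fun j => ‖a j‖ ^ 2) {r : ℝ}
    (hr : r ∈ Ioo 0 1) :
    ∫⁻ θ in Ioc 0 (2 * Real.pi), ‖∑' j, a j * ((r : ℂ) * (Circle.exp θ : ℂ)) ^ j‖ₑ ^ (2 : ℝ) ≤
      ENNReal.ofReal (∑' j, 2 * Real.pi * ‖a j‖ ^ 2) := by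
  simp only [tsum_mul_real_mul_pow]
  rw [lintegral_enorm_sq_tsum (summable_norm_mul_pow_of_sq ha hr)]
  have hle : ∀ j, 2 * Real.pi * ‖a j * (r : ℂ) ^ j‖ ^ 2 ≤ 2 * Real.pi * ‖a j‖ ^ 2 := by
    intro j
    gcongr
    rw [norm_mul, norm_pow, Complex.norm_real, Real.norm_of_nonneg hr.1.le]
    exact mul_le_of_le_one_right (norm_nonneg _) (pow_le_one₀ hr.1.le hr.2.le)
  exact ENNReal.ofReal_le_ofReal (Summable.tsum_le_tsum hle
    (Summable.of_nonneg_of_le (fun j => by positivity) hle (ha.mul_left _)) (ha.mul_left _))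

/-- The restrictions of an `H^2` function to circles form a Cauchy family in `L^2`. -/
theorem tendsto_lintegral_enorm_sq_sub {a : ℕ → ℂ} (ha : Summable fun j => ‖a j‖ ^ 2) :
    Tendsto (fun q : ℝ × ℝ => ∫⁻ θ in Ioc 0 (2 * Real.pi),
      ‖(∑' j, a j * ((q.1 : ℂ) * (Circle.exp θ : ℂ)) ^ j) -
        ∑' j, a j * ((q.2 : ℂ) * (Circle.exp θ : ℂ)) ^ j‖ₑ ^ (2 : ℝ))
      (𝓝[<] 1 ×ˢ 𝓝[<] 1) (𝓝 0) := by
  have hr1 : ∀ᶠ r : ℝ in 𝓝[<] 1, r ∈ Ioo (0 : ℝ) 1 := Ioo_mem_nhdsLT one_pos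
  have hq : ∀ᶠ q : ℝ × ℝ in 𝓝[<] 1 ×ˢ 𝓝[<] 1, q.1 ∈ Ioo (0 : ℝ) 1 ∧ q.2 ∈ Ioo (0 : ℝ) 1 :=
    hr1.prod_mk hr1
  have hlim : Tendsto (fun q : ℝ × ℝ =>
      ∑' j, 2 * Real.pi * ‖a j * (q.1 : ℂ) ^ j - a j * (q.2 : ℂ) ^ j‖ ^ 2)
      (𝓝[<] 1 ×ˢ 𝓝[<] 1) (𝓝 (∑' j : ℕ, 0)) := by
    refine tendsto_tsum_of_dominated_convergence (bound := fun j => 2 * Real.pi * ‖a j‖ ^ 2)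
      (ha.mul_left _) (fun j => ?_) (hq.mono fun q hq j => ?_)
    · have h1 : Tendsto (fun q : ℝ × ℝ =>
          2 * Real.pi * ‖a j * (q.1 : ℂ) ^ j - a j * (q.2 : ℂ) ^ j‖ ^ 2) (𝓝 (1, 1))
          (𝓝 (2 * Real.pi * ‖a j * ((1 : ℝ) : ℂ) ^ j - a j * ((1 : ℝ) : ℂ) ^ j‖ ^ 2)) :=
        (by fun_prop : Continuous fun q : ℝ × ℝ =>
          2 * Real.pi * ‖a j * (q.1 : ℂ) ^ j - a j * (q.2 : ℂ) ^ j‖ ^ 2).tendsto (1, 1)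
      rw [sub_self, norm_zero, zero_pow two_ne_zero, mul_zero, nhds_prod_eq] at h1
      exact h1.mono_left (Filter.prod_mono nhdsWithin_le_nhds nhdsWithin_le_nhds)
    · rw [Real.norm_of_nonneg (by positivity)]
      gcongr
      rw [← mul_sub, norm_mul, ← Complex.ofReal_pow, ← Complex.ofReal_pow, ← Complex.ofReal_sub,
        Complex.norm_real]
      refine mul_le_of_le_one_right (norm_nonneg _) ?_
      have h1 := pow_le_one₀ (n := j) hq.1.1.le hq.1.2.le
      have h2 := pow_le_one₀ (n := j) hq.2.1.le hq.2.2.le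
      have h3 := pow_nonneg hq.1.1.le j
      have h4 := pow_nonneg hq.2.1.le j
      rw [Real.norm_eq_abs, abs_le]
      constructor <;> linarith
  rw [tsum_zero] at hlim
  have := (ENNReal.continuous_ofReal.tendsto 0).comp hlim
  rw [ENNReal.ofReal_zero] at this
  refine this.congr' (hq.mono fun q hq => ?_)
  have hs1 := summable_norm_mul_pow_of_sq ha hq.1
  have hs2 := summable_norm_mul_pow_of_sq ha hq.2
  have hs : Summable fun j => ‖a j * (q.1 : ℂ) ^ j - a j * (q.2 : ℂ) ^ j‖ :=
    Summable.of_nonneg_of_le (fun j => norm_nonneg _) (fun j => norm_sub_le _ _) (hs1.add hs2)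
  rw [Function.comp_apply, ← lintegral_enorm_sq_tsum hs]
  refine lintegral_congr fun θ => ?_
  have hn : ∀ {c : ℕ → ℂ}, Summable (fun j => ‖c j‖) →
      Summable fun j => c j * (Circle.exp θ : ℂ) ^ j := fun {c} hc => Summable.of_norm (by
    simpa only [norm_mul, norm_pow, Circle.norm_coe, one_pow, mul_one] using hc)
  rw [tsum_mul_real_mul_pow, tsum_mul_real_mul_pow, ← (hn hs1).tsum_sub (hn hs2)]
  simp only [sub_mul]

theorem lintegral_enorm_mul_sub_mul_le {α : Type*} [MeasurableSpace α] (μ : Measure α)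
    {φ₁ φ₂ ψ₁ ψ₂ : α → ℂ} (hφ₁ : Measurable φ₁) (hφ₂ : Measurable φ₂) (hψ₁ : Measurable ψ₁)
    (hψ₂ : Measurable ψ₂) :
    ∫⁻ x, ‖φ₁ x * ψ₁ x - φ₂ x * ψ₂ x‖ₑ ∂μ ≤
      (∫⁻ x, ‖φ₁ x - φ₂ x‖ₑ ^ (2 : ℝ) ∂μ) ^ (1 / 2 : ℝ) * (∫⁻ x, ‖ψ₁ x‖ₑ ^ (2 : ℝ) ∂μ) ^ (1 / 2 : ℝ) +
      (∫⁻ x, ‖φ₂ x‖ₑ ^ (2 : ℝ) ∂μ) ^ (1 / 2 : ℝ) *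
        (∫⁻ x, ‖ψ₁ x - ψ₂ x‖ₑ ^ (2 : ℝ) ∂μ) ^ (1 / 2 : ℝ) := by
  have hCS : ∀ φ ψ : α → ℂ, Measurable φ → Measurable ψ → ∫⁻ x, ‖φ x‖ₑ * ‖ψ x‖ₑ ∂μ ≤
      (∫⁻ x, ‖φ x‖ₑ ^ (2 : ℝ) ∂μ) ^ (1 / 2 : ℝ) * (∫⁻ x, ‖ψ x‖ₑ ^ (2 : ℝ) ∂μ) ^ (1 / 2 : ℝ) :=
    fun φ ψ hφ hψ => ENNReal.lintegral_mul_le_Lp_mul_Lq μ Real.HolderConjugate.two_two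
      hφ.enorm.aemeasurable hψ.enorm.aemeasurable
  refine le_trans ?_ (add_le_add (hCS _ _ (hφ₁.sub hφ₂) hψ₁) (hCS _ _ hφ₂ (hψ₁.sub hψ₂)))
  rw [← lintegral_add_left (by fun_prop)]
  refine lintegral_mono fun x => ?_
  have e : φ₁ x * ψ₁ x - φ₂ x * ψ₂ x = (φ₁ x - φ₂ x) * ψ₁ x + φ₂ x * (ψ₁ x - ψ₂ x) := by ring
  rw [e]
  refine (enorm_add_le _ _).trans (le_of_eq ?_)
  simp only [enorm_mul]

/-- The restrictions of an `H^1` function to circles form a Cauchy family in `L^1`. -/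
theorem MemHardy.tendsto_lintegral_enorm_sub {f : ℂ → ℂ} (hf : MemHardy 1 f) :
    Tendsto (fun q : ℝ × ℝ => ∫⁻ θ in Ioc 0 (2 * Real.pi),
      ‖f ((q.1 : ℂ) * (Circle.exp θ : ℂ)) - f ((q.2 : ℂ) * (Circle.exp θ : ℂ))‖ₑ)
      (𝓝[<] 1 ×ˢ 𝓝[<] 1) (𝓝 0) := by
  obtain ⟨a, b, ha, hb, hfab⟩ := hf.exists_coeff
  have hr1 : ∀ᶠ r : ℝ in 𝓝[<] 1, r ∈ Ioo (0 : ℝ) 1 := Ioo_mem_nhdsLT one_pos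
  have hq : ∀ᶠ q : ℝ × ℝ in 𝓝[<] 1 ×ˢ 𝓝[<] 1, q.1 ∈ Ioo (0 : ℝ) 1 ∧ q.2 ∈ Ioo (0 : ℝ) 1 :=
    hr1.prod_mk hr1
  have h2 : (0 : ℝ) < 1 / 2 := by norm_num
  have hS : ∀ c : ℕ → ℂ, Summable (fun j => ‖c j‖ ^ 2) → Tendsto (fun q : ℝ × ℝ =>
      (∫⁻ θ in Ioc 0 (2 * Real.pi), ‖(∑' j, c j * ((q.1 : ℂ) * (Circle.exp θ : ℂ)) ^ j) -
        ∑' j, c j * ((q.2 : ℂ) * (Circle.exp θ : ℂ)) ^ j‖ₑ ^ (2 : ℝ)) ^ (1 / 2 : ℝ))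
      (𝓝[<] 1 ×ˢ 𝓝[<] 1) (𝓝 0) := by
    intro c hc
    have := ((ENNReal.continuous_rpow_const (y := 1 / 2)).tendsto (0 : ENNReal)).comp
      (tendsto_lintegral_enorm_sq_sub hc)
    rwa [ENNReal.zero_rpow_of_pos h2] at this
  obtain ⟨A, hA⟩ : ∃ A, A = ENNReal.ofReal (∑' j, 2 * Real.pi * ‖a j‖ ^ 2) ^ (1 / 2 : ℝ) := ⟨_, rfl⟩
  obtain ⟨B, hB⟩ : ∃ B, B = ENNReal.ofReal (∑' j, 2 * Real.pi * ‖b j‖ ^ 2) ^ (1 / 2 : ℝ) := ⟨_, rfl⟩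
  have hAt : A ≠ ⊤ := by rw [hA]; exact ENNReal.rpow_ne_top_of_nonneg h2.le ENNReal.ofReal_ne_top
  have hBt : B ≠ ⊤ := by rw [hB]; exact ENNReal.rpow_ne_top_of_nonneg h2.le ENNReal.ofReal_ne_top
  have hlim := (ENNReal.Tendsto.mul_const (b := B) (hS a ha) (Or.inr hBt)).add
    (ENNReal.Tendsto.const_mul (a := A) (hS b hb) (Or.inr hAt))
  rw [zero_mul, mul_zero, add_zero] at hlim
  refine tendsto_of_tendsto_of_tendsto_of_le_of_le' tendsto_const_nhds hlim
    (Eventually.of_forall fun q => zero_le) (hq.mono fun q hq => ?_)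
  have hcont : ∀ c : ℕ → ℂ, Summable (fun j => ‖c j‖ ^ 2) → ∀ r ∈ Ioo (0 : ℝ) 1,
      Continuous fun θ : ℝ => ∑' j, c j * ((r : ℂ) * (Circle.exp θ : ℂ)) ^ j := by
    intro c hc r hr
    simp only [tsum_mul_real_mul_pow]
    exact continuous_tsum_mul_circleExp_pow (summable_norm_mul_pow_of_sq hc hr)
  simp only [hfab _ (real_mul_circle_mem_unitDisc hq.1 _),
    hfab _ (real_mul_circle_mem_unitDisc hq.2 _)]
  refine (lintegral_enorm_mul_sub_mul_le _ (hcont a ha q.1 hq.1).measurable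
    (hcont a ha q.2 hq.2).measurable (hcont b hb q.1 hq.1).measurable
    (hcont b hb q.2 hq.2).measurable).trans (add_le_add ?_ ?_)
  · rw [hB]
    exact mul_le_mul' le_rfl
      (ENNReal.rpow_le_rpow (lintegral_enorm_sq_tsum_radius_le hb hq.1) h2.le)
  · rw [hA]
    exact mul_le_mul'
      (ENNReal.rpow_le_rpow (lintegral_enorm_sq_tsum_radius_le ha hq.2) h2.le) le_rfl

/-- An `H^1` function has boundary values in the sense of `L^1`. -/
theorem MemHardy.exists_boundary_lintegral {f : ℂ → ℂ} (hf : MemHardy 1 f) :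
    ∃ g : Circle → ℂ, Measurable (fun θ : ℝ => g (Circle.exp θ)) ∧
      ∫⁻ θ in Ioc 0 (2 * Real.pi), ‖g (Circle.exp θ)‖ₑ < ⊤ ∧
      Tendsto (fun R : ℝ => ∫⁻ t in Ioc 0 (2 * Real.pi),
        ‖f ((R : ℂ) * (Circle.exp t : ℂ)) - g (Circle.exp t)‖ₑ) (𝓝[<] 1) (𝓝 0) := by
  have hcauchy := hf.tendsto_lintegral_enorm_sub
  have hcont : ∀ r ∈ Ioo (0 : ℝ) 1, Continuous fun θ : ℝ => f ((r : ℂ) * (Circle.exp θ : ℂ)) :=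
    fun r hr => hf.1.continuousOn.comp_continuous (by fun_prop) fun θ =>
      real_mul_circle_mem_unitDisc hr _
  have hint : ∀ r ∈ Ioo (0 : ℝ) 1, Integrable (fun θ : ℝ => f ((r : ℂ) * (Circle.exp θ : ℂ)))
      (volume.restrict (Ioc 0 (2 * Real.pi))) := fun r hr =>
    ((hcont r hr).integrableOn_Icc).mono_set Ioc_subset_Icc_self
  have hr1 : ∀ᶠ r : ℝ in 𝓝[<] 1, r ∈ Ioo (0 : ℝ) 1 := Ioo_mem_nhdsLT one_pos
  classical
  obtain ⟨T, hT⟩ : ∃ T : ℝ → (ℝ →₁[volume.restrict (Ioc 0 (2 * Real.pi))] ℂ),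
      ∀ r (hr : r ∈ Ioo (0 : ℝ) 1), T r = (hint r hr).toL1 :=
    ⟨fun r => if hr : r ∈ Ioo (0 : ℝ) 1 then (hint r hr).toL1 else 0, fun r hr => dif_pos hr⟩
  have hTc : Cauchy (map T (𝓝[<] 1)) := by
    refine cauchy_map_iff.2 ⟨inferInstance, ?_⟩
    rw [tendsto_uniformity_iff_dist_tendsto_zero]
    have := (ENNReal.tendsto_toReal ENNReal.zero_ne_top).comp hcauchy
    rw [ENNReal.toReal_zero] at this
    refine this.congr' ((hr1.prod_mk hr1).mono fun q hq => ?_)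
    simp only [Function.comp_apply]
    rw [hT _ hq.1, hT _ hq.2, dist_edist, Integrable.edist_toL1_toL1]
    simp only [edist_eq_enorm_sub]
  obtain ⟨L, hL⟩ := CompleteSpace.complete hTc
  have hL' : Tendsto T (𝓝[<] 1) (𝓝 L) := hL
  obtain ⟨r, -, hr, hr1'⟩ := exists_seq_strictMono_tendsto' (zero_lt_one' ℝ)
  have hrlim : Tendsto r atTop (𝓝[<] 1) :=
    tendsto_nhdsWithin_iff.2 ⟨hr1', Eventually.of_forall fun n => (hr n).2⟩
  obtain ⟨ns, -, hae⟩ := (tendstoInMeasure_of_tendsto_Lp (hL'.comp hrlim)).exists_seq_tendsto_ae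
  obtain ⟨g, hg⟩ : ∃ g : Circle → ℂ,
      g = fun ζ : Circle => limUnder atTop fun i => f ((r (ns i) : ℂ) * (ζ : ℂ)) := ⟨_, rfl⟩
  have hgL : ∀ᵐ θ ∂volume.restrict (Ioc 0 (2 * Real.pi)), L θ = g (Circle.exp θ) := by
    have hcoe : ∀ᵐ θ ∂volume.restrict (Ioc 0 (2 * Real.pi)), ∀ i,
        T (r (ns i)) θ = f ((r (ns i) : ℂ) * (Circle.exp θ : ℂ)) := by
      rw [ae_all_iff]
      intro i
      rw [hT _ (hr _)]
      exact (hint _ (hr (ns i))).coeFn_toL1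
    filter_upwards [hae, hcoe] with θ h1 h2
    simp only [Function.comp_apply, h2] at h1
    rw [hg]
    exact h1.limUnder_eq.symm
  refine ⟨g, ?_, ?_, ?_⟩
  · rw [hg]
    exact (StronglyMeasurable.limUnder fun i => (hcont _ (hr (ns i))).stronglyMeasurable).measurable
  · refine lt_of_eq_of_lt (lintegral_congr_ae (hgL.mono fun θ h => ?_)) (L1.integrable_coeFn L).2
    simp only [h]
  · have h1 : Tendsto (fun r => edist (T r) L) (𝓝[<] 1) (𝓝 0) := tendsto_iff_edist_tendsto_0.1 hL'
    refine h1.congr' (hr1.mono fun r hr => ?_)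
    have h2 := Integrable.edist_toL1_toL1 _ _ (hint r hr) (L1.integrable_coeFn L)
    rw [Integrable.toL1_coeFn, ← hT r hr] at h2
    rw [h2]
    refine lintegral_congr_ae (hgL.mono fun θ h => ?_)
    simp only [edist_eq_enorm_sub, h]

/-! ### Non-tangential limits -/

/-- Layer cake representation of the kernel `d / (d + |u|)^2`. -/
theorem lintegral_Ioi_cube_eq {d y : ℝ} (hd : 0 < d) (hy : 0 ≤ y) :
    ∫⁻ v in Ioi (d + y), ENNReal.ofReal (2 * d * v ^ (-3 : ℝ)) =
      ENNReal.ofReal (d / (d + y) ^ 2) := by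
  have h0 : 0 < d + y := by linarith
  have h2 : (0 : ℝ) ≤ 2 * d := by positivity
  simp only [ENNReal.ofReal_mul h2]
  rw [lintegral_const_mul' _ _ ENNReal.ofReal_ne_top, lintegral_Ioi_rpow (by norm_num) h0,
    ← ENNReal.ofReal_mul h2]
  congr 1
  rw [show (-3 : ℝ) + 1 = -2 by norm_num, Real.rpow_neg h0.le, Real.rpow_two]
  field_simp

/-- The kernels `d / (d + |u|)^2` are an approximate identity at every Lebesgue point: the part with
`|u| ≤ η` is an average of means over intervals centred at zero. -/
theorem setLIntegral_kernel_near_le {φ : ℝ → ENNReal} (hφ : Measurable φ) {ε η d : ℝ} (hε : 0 ≤ ε)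
    (hd : 0 < d) (h : ∀ y ∈ Ioc 0 η, ∫⁻ u in Metric.closedBall 0 y, φ u ≤ ENNReal.ofReal (ε * y)) :
    ∫⁻ u in Metric.closedBall 0 η, φ u * ENNReal.ofReal (d / (d + |u|) ^ 2) ≤
      ENNReal.ofReal (2 * ε) := by
  rcases le_or_gt η 0 with hη | hη
  · have : volume (Metric.closedBall (0 : ℝ) η) = 0 := by
      rw [Real.volume_closedBall, ENNReal.ofReal_eq_zero]; linarith
    rw [Measure.restrict_eq_zero.2 this, lintegral_zero_measure]
    exact zero_le
  have e : ∀ u, φ u * ENNReal.ofReal (d / (d + |u|) ^ 2) = ∫⁻ v in Ioi d,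
      {z : ℝ × ℝ | |z.1| < z.2 - d}.indicator (fun z => φ z.1) (u, v) *
        ENNReal.ofReal (2 * d * v ^ (-3 : ℝ)) := by
    intro u
    rw [← lintegral_Ioi_cube_eq hd (abs_nonneg u), ← lintegral_const_mul _ (by fun_prop),
      ← lintegral_indicator measurableSet_Ioi, ← lintegral_indicator measurableSet_Ioi]
    refine lintegral_congr fun v => ?_
    by_cases hv : d + |u| < v
    · have h1 : d < v := by linarith [abs_nonneg u]
      have h2 : |u| < v - d := by linarith
      simp [hv, h1, h2]
    · have h2 : ¬ |u| < v - d := by intro h; exact hv (by linarith)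
      by_cases h1 : d < v <;> simp [hv, h1, h2]
  have hS : MeasurableSet {z : ℝ × ℝ | |z.1| < z.2 - d} :=
    measurableSet_lt (by fun_prop) (by fun_prop)
  have hm : Measurable ({z : ℝ × ℝ | |z.1| < z.2 - d}.indicator fun z => φ z.1) :=
    (hφ.comp measurable_fst).indicator hS
  simp only [e]
  rw [lintegral_lintegral_swap (Measurable.aemeasurable (by
    unfold Function.uncurry; exact hm.mul (by fun_prop)))]
  calc _ ≤ ∫⁻ v in Ioi d, ENNReal.ofReal (2 * d * ε) * ENNReal.ofReal (v ^ (-2 : ℝ)) := by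
        refine setLIntegral_mono' measurableSet_Ioi fun v hv => ?_
        have hv0 : 0 < v := hd.trans hv
        have hvd : 0 < v - d := sub_pos.2 hv
        rw [lintegral_mul_const' _ _ ENNReal.ofReal_ne_top]
        have h1 : ∫⁻ u in Metric.closedBall 0 η,
            {z : ℝ × ℝ | |z.1| < z.2 - d}.indicator (fun z => φ z.1) (u, v) ≤
            ENNReal.ofReal (ε * v) := by
          calc _ ≤ ∫⁻ u in Metric.closedBall 0 (min η (v - d)), φ u := by
                rw [← lintegral_indicator Metric.isClosed_closedBall.measurableSet,
                  ← lintegral_indicator Metric.isClosed_closedBall.measurableSet]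
                refine lintegral_mono fun u => ?_
                by_cases hu : |u| ≤ η
                · by_cases hu2 : |u| < v - d
                  · simp [hu, hu2, hu2.le]
                  · simp [hu, hu2]
                · simp [hu]
            _ ≤ ENNReal.ofReal (ε * min η (v - d)) :=
                h _ ⟨lt_min hη hvd, min_le_left _ _⟩
            _ ≤ _ := by
                gcongr
                exact (min_le_right _ _).trans (by linarith)
        refine (mul_le_mul' h1 le_rfl).trans (le_of_eq ?_)
        rw [← ENNReal.ofReal_mul (by positivity), ← ENNReal.ofReal_mul (by positivity)]
        congr 1
        have : v ^ (-2 : ℝ) = v * v ^ (-3 : ℝ) := by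
          rw [← Real.rpow_one_add' hv0.le (by norm_num)]; norm_num
        rw [this]
        ring
    _ = _ := by
        rw [lintegral_const_mul' _ _ ENNReal.ofReal_ne_top, lintegral_Ioi_rpow (by norm_num) hd,
          ← ENNReal.ofReal_mul (by positivity)]
        congr 1
        rw [show (-2 : ℝ) + 1 = -1 by norm_num, Real.rpow_neg_one]
        field_simp

/-- The part with `|u| > η` vanishes in the limit for any integrable `φ`. -/
theorem tendsto_setLIntegral_kernel {φ : ℝ → ENNReal} (hφ : Measurable φ)
    (hfin : ∫⁻ u in Ioc (-Real.pi) Real.pi, φ u < ⊤)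
    (hleb : ∀ ε > 0, ∃ η > 0, ∀ y ∈ Ioc (0 : ℝ) η,
      ∫⁻ u in Metric.closedBall 0 y, φ u ≤ ENNReal.ofReal (ε * y)) :
    Tendsto (fun d => ∫⁻ u in Ioc (-Real.pi) Real.pi, φ u * ENNReal.ofReal (d / (d + |u|) ^ 2))
      (𝓝[>] 0) (𝓝 0) := by
  rw [ENNReal.tendsto_nhds_zero]
  intro ε' hε'
  obtain ⟨ε, hε0, hε⟩ : ∃ ε : ℝ, 0 < ε ∧ ENNReal.ofReal (3 * ε) ≤ ε' := by
    rcases eq_or_ne ε' ⊤ with rfl | h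
    · exact ⟨1, one_pos, le_top⟩
    · refine ⟨ε'.toReal / 3, by have := ENNReal.toReal_pos hε'.ne' h; positivity, ?_⟩
      rw [mul_div_cancel₀ _ (by norm_num), ENNReal.ofReal_toReal h]
  obtain ⟨η, hη0, hη⟩ := hleb ε hε0
  obtain ⟨Φ, hΦ⟩ : ∃ Φ, Φ = ∫⁻ u in Ioc (-Real.pi) Real.pi, φ u := ⟨_, rfl⟩
  have hfar : Tendsto (fun d : ℝ => ENNReal.ofReal (d / η ^ 2) * Φ) (𝓝[>] 0) (𝓝 0) := by
    have h1 : Tendsto (fun d : ℝ => ENNReal.ofReal (d / η ^ 2)) (𝓝 0) (𝓝 0) := by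
      have := (ENNReal.continuous_ofReal.comp
        (by fun_prop : Continuous fun d : ℝ => d / η ^ 2)).tendsto 0
      rwa [Function.comp_apply, zero_div, ENNReal.ofReal_zero] at this
    have := ENNReal.Tendsto.mul_const (b := Φ) (h1.mono_left (nhdsWithin_le_nhds (s := Ioi 0)))
      (Or.inr (by rw [hΦ]; exact hfin.ne))
    rwa [zero_mul] at this
  filter_upwards [(ENNReal.tendsto_nhds_zero.1 hfar) (ENNReal.ofReal ε) (by simpa using hε0),
    self_mem_nhdsWithin] with d hd hd0
  have hd0 : 0 < d := hd0
  calc _ ≤ ∫⁻ u in Metric.closedBall 0 η ∪ (Ioc (-Real.pi) Real.pi \ Metric.closedBall 0 η),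
        φ u * ENNReal.ofReal (d / (d + |u|) ^ 2) := by
        refine lintegral_mono_set (show Ioc (-Real.pi) Real.pi ⊆ _ from fun u hu => ?_)
        by_cases h : u ∈ Metric.closedBall 0 η
        · exact Or.inl h
        · exact Or.inr ⟨hu, h⟩
    _ ≤ ENNReal.ofReal (2 * ε) + ENNReal.ofReal ε := by
        refine (lintegral_union_le _ _ _).trans (add_le_add
          (setLIntegral_kernel_near_le hφ hε0.le hd0 hη) (le_trans ?_ hd))
        calc _ ≤ ∫⁻ u in Ioc (-Real.pi) Real.pi \ Metric.closedBall 0 η,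
              ENNReal.ofReal (d / η ^ 2) * φ u := by
              refine setLIntegral_mono' (measurableSet_Ioc.diff
                Metric.isClosed_closedBall.measurableSet) fun u hu => ?_
              have h1 : η ≤ |u| := by
                have := hu.2
                simp only [Metric.mem_closedBall, dist_zero_right, Real.norm_eq_abs, not_le] at this
                exact this.le
              rw [mul_comm]
              gcongr
              linarith
          _ ≤ ∫⁻ u in Ioc (-Real.pi) Real.pi, ENNReal.ofReal (d / η ^ 2) * φ u :=
              lintegral_mono_set sdiff_subset
          _ = _ := by rw [lintegral_const_mul' _ _ ENNReal.ofReal_ne_top, ← hΦ]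
    _ ≤ ε' := by
        rw [← ENNReal.ofReal_add (by positivity) hε0.le]
        refine le_trans (le_of_eq ?_) hε
        congr 1
        ring

/-- Poisson's formula for `f - w` on the circle of radius `R < 1`. -/
theorem enorm_sub_le_lintegral_circle {f : ℂ → ℂ} (hf : DifferentiableOn ℂ f unitDisc) {R : ℝ}
    (hR : R ∈ Ioo 0 1) {z : ℂ} (hz : z ∈ unitDisc) (w : ℂ) :
    ‖f (R * z) - w‖ₑ ≤ ∫⁻ t in Ioc 0 (2 * Real.pi), ‖f ((R : ℂ) * (Circle.exp t : ℂ)) - w‖ₑ *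
      ENNReal.ofReal ((1 - ‖z‖ ^ 2) / ‖(Circle.exp t : ℂ) - z‖ ^ 2) := by
  obtain ⟨U, hU, hsub, hd⟩ := exists_isOpen_differentiableOn_dilate hf hR
  have hz0 := one_sub_norm_sq_pos hz
  have key := ((hd.sub_const w).diffContOnCl_ball hsub).circleAverage_poissonKernel_smul' hz
  rw [← key, Real.circleAverage_def, enorm_smul]
  have e2 : ‖(2 * Real.pi)⁻¹‖ₑ ≤ 1 := by
    rw [← ofReal_norm, norm_inv, Real.norm_of_nonneg Real.two_pi_pos.le]
    refine ENNReal.ofReal_le_one.2 (inv_le_one_of_one_le₀ ?_)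
    linarith [Real.pi_gt_three]
  refine (mul_le_of_le_one_left zero_le e2).trans ?_
  rw [intervalIntegral.integral_of_le Real.two_pi_pos.le]
  refine (enorm_integral_le_lintegral_enorm _).trans (lintegral_mono fun t => ?_)
  have e3 : circleMap 0 1 t = (Circle.exp t : ℂ) := by simp [circleMap, Circle.coe_exp]
  rw [e3, enorm_smul, sub_zero, sub_zero, Circle.norm_coe, one_pow, mul_comm]
  gcongr
  rw [← ofReal_norm, Real.norm_of_nonneg (by positivity)]

/-- Poisson's formula in terms of `L¹` boundary values `G`. -/
theorem enorm_sub_le_lintegral_boundary {f : ℂ → ℂ} {G : ℝ → ℂ}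
    (hf : DifferentiableOn ℂ f unitDisc) (hG : Measurable G)
    (hlim : Tendsto (fun R : ℝ => ∫⁻ t in Ioc 0 (2 * Real.pi),
      ‖f ((R : ℂ) * (Circle.exp t : ℂ)) - G t‖ₑ) (𝓝[<] 1) (𝓝 0)) {z : ℂ} (hz : z ∈ unitDisc)
    (w : ℂ) :
    ‖f z - w‖ₑ ≤ ∫⁻ t in Ioc 0 (2 * Real.pi), ‖G t - w‖ₑ *
        ENNReal.ofReal ((1 - ‖z‖ ^ 2) / ‖(Circle.exp t : ℂ) - z‖ ^ 2) := by
  have hz1 := mem_unitDisc.1 hz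
  have hz0 := one_sub_norm_sq_pos hz
  have hm : Measurable fun t : ℝ => ‖(Circle.exp t : ℂ) - z‖ := by fun_prop
  have hl : Tendsto (fun R : ℝ => ‖f (R * z) - w‖ₑ) (𝓝[<] 1) (𝓝 ‖f z - w‖ₑ) :=
    (((hf.continuousOn.continuousAt (isOpen_unitDisc.mem_nhds hz)).tendsto.comp
      (tendsto_real_mul_nhdsLT z)).sub_const w).enorm
  refine le_lintegral_of_tendsto_boundary hG hlim w (by fun_prop)
    (K := (1 - ‖z‖ ^ 2) / (1 - ‖z‖) ^ 2) (fun t => ?_) hl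
    fun R hR => enorm_sub_le_lintegral_circle hf hR hz w
  have := norm_sub_norm_le (Circle.exp t : ℂ) z
  rw [Circle.norm_coe] at this
  have h0 : 0 < 1 - ‖z‖ := by linarith
  gcongr

/-- In a Stolz angle with vertex `e^{iθ}` the Poisson kernel is bounded by a multiple of
`d / (d + |u|)^2`, where `d = 1 - |z|`. -/
theorem enorm_sub_le_of_mem_stolzAngle {f : ℂ → ℂ} {G : ℝ → ℂ}
    (hf : DifferentiableOn ℂ f unitDisc) (hG : Measurable G)
    (hper : Function.Periodic G (2 * Real.pi))
    (hlim : Tendsto (fun R : ℝ => ∫⁻ t in Ioc 0 (2 * Real.pi),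
      ‖f ((R : ℂ) * (Circle.exp t : ℂ)) - G t‖ₑ) (𝓝[<] 1) (𝓝 0)) {α θ : ℝ} (hα : 1 < α) {z : ℂ}
    (hz : z ∈ stolzAngle α (Circle.exp θ)) :
    ‖f z - G θ‖ₑ ≤ ENNReal.ofReal (50 * α ^ 2) * ∫⁻ u in Ioc (-Real.pi) Real.pi,
      ‖G (θ + u) - G θ‖ₑ * ENNReal.ofReal ((1 - ‖z‖) / (1 - ‖z‖ + |u|) ^ 2) := by
  obtain ⟨hzD, hzα⟩ := hz
  have hz1 := mem_unitDisc.1 hzD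
  refine (enorm_sub_le_lintegral_boundary hf hG hlim hzD (G θ)).trans ?_
  have hp : Function.Periodic (fun t => ‖G t - G θ‖ₑ *
      ENNReal.ofReal ((1 - ‖z‖ ^ 2) / ‖(Circle.exp t : ℂ) - z‖ ^ 2)) (2 * Real.pi) := fun t => by
    simp [hper t]
  have h1 := hp.setLIntegral_Ioc_eq Real.two_pi_pos 0 (-Real.pi + θ)
  rw [zero_add, show -Real.pi + θ + 2 * Real.pi = Real.pi + θ by ring,
    ← setLIntegral_Ioc_comp_add_right] at h1
  rw [h1, ← lintegral_const_mul' _ _ ENNReal.ofReal_ne_top]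
  refine setLIntegral_mono' measurableSet_Ioc fun u hu => ?_
  rw [add_comm u θ, mul_left_comm, ← ENNReal.ofReal_mul (by positivity)]
  refine mul_le_mul' le_rfl (ENNReal.ofReal_le_ofReal ?_)
  have hu' : |u| ≤ Real.pi := abs_le.2 ⟨hu.1.le, hu.2⟩
  obtain ⟨c, hc⟩ : ∃ c, c = ‖(Circle.exp (θ + u) : ℂ) - z‖ := ⟨_, rfl⟩
  obtain ⟨d, hd⟩ : ∃ d, d = 1 - ‖z‖ := ⟨_, rfl⟩
  have hd0 : 0 < d := by linarith
  have hdc : d ≤ c := by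
    have := norm_sub_norm_le (Circle.exp (θ + u) : ℂ) z
    rw [Circle.norm_coe] at this
    linarith
  have hζ : ‖(Circle.exp θ : ℂ) - z‖ < α * d := by
    have e : 1 - starRingEnd ℂ (Circle.exp θ : ℂ) * z =
        starRingEnd ℂ (Circle.exp θ : ℂ) * ((Circle.exp θ : ℂ) - z) := by
      rw [mul_sub, ← Complex.normSq_eq_conj_mul_self, Circle.normSq_coe, Complex.ofReal_one]
    rw [e, norm_mul, RCLike.norm_conj, Circle.norm_coe, one_mul] at hzα
    rwa [hd]
  have hchord : 2 / Real.pi * |u| ≤ c + α * d := by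
    refine (le_norm_circleExp_sub_one hu').trans ?_
    have e : (Circle.exp θ : ℂ) - (Circle.exp (θ + u) : ℂ) =
      ((Circle.exp θ : ℂ) - z) - ((Circle.exp (θ + u) : ℂ) - z) := by ring
    rw [← norm_circleExp_add_sub θ u, e]
    refine (norm_sub_le _ _).trans ?_
    rw [← hc]
    linarith
  have hπ := Real.pi_lt_four
  have h4 : |u| ≤ 2 * (1 + α) * c := by
    rw [div_mul_eq_mul_div, div_le_iff₀ Real.pi_pos] at hchord
    have h41 : c + α * d ≤ (1 + α) * c := by nlinarith
    have h42 : 0 ≤ c + α * d := by nlinarith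
    nlinarith
  have h5 : d + |u| ≤ 5 * α * c := by nlinarith
  have h6 : 1 - ‖z‖ ^ 2 ≤ 2 * d := by rw [hd]; nlinarith [norm_nonneg z]
  have hc0 : 0 < c := by linarith
  rw [← hc, ← hd, mul_div_assoc', div_le_div_iff₀ (by positivity) (by positivity)]
  have h7 : (d + |u|) ^ 2 ≤ (5 * α * c) ^ 2 := by gcongr
  calc _ ≤ 2 * d * (5 * α * c) ^ 2 := by gcongr
    _ = _ := by ring

theorem ae_lebesgue_point {G : ℝ → ℂ} (hG : LocallyIntegrable G volume) :
    ∀ᵐ θ : ℝ, ∀ ε > 0, ∃ η > 0, ∀ y ∈ Ioc (0 : ℝ) η,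
      ∫⁻ u in Metric.closedBall 0 y, ‖G (θ + u) - G θ‖ₑ ≤ ENNReal.ofReal (ε * y) := by
  filter_upwards [(Besicovitch.vitaliFamily (volume : Measure ℝ)).ae_tendsto_lintegral_enorm_sub_div
    hG] with θ hθ
  intro ε hε
  have h1 := hθ.comp (Besicovitch.tendsto_filterAt volume θ)
  have h2 := (ENNReal.tendsto_nhds_zero.1 h1) (ENNReal.ofReal (ε / 2)) (by simpa using hε)
  obtain ⟨η, hη0, hη⟩ := mem_nhdsGT_iff_exists_Ioc_subset.1 h2
  refine ⟨η, hη0, fun y hy => ?_⟩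
  have h3 := hη hy
  have hy0 : 0 < y := hy.1
  simp only [mem_ofPred_eq, Function.comp_apply] at h3
  rw [Real.volume_closedBall, ENNReal.div_le_iff (by simpa using hy0) ENNReal.ofReal_ne_top,
    ← ENNReal.ofReal_mul (by positivity), show ε / 2 * (2 * y) = ε * y by ring] at h3
  refine le_trans (le_of_eq ?_) h3
  have := (measurePreserving_add_left (volume : Measure ℝ) θ).setLIntegral_comp_preimage_emb
    (MeasurableEquiv.addLeft θ).measurableEmbedding (fun t => ‖G t - G θ‖ₑ) (Metric.closedBall θ y)
  rw [← this]
  simp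

theorem locallyIntegrable_of_periodic {G : ℝ → ℂ} (hG : Measurable G)
    (hper : Function.Periodic G (2 * Real.pi))
    (hfin : ∫⁻ θ in Ioc 0 (2 * Real.pi), ‖G θ‖ₑ < ⊤) : LocallyIntegrable G volume := by
  intro x
  refine ⟨Ioc (x - Real.pi) (x - Real.pi + 2 * Real.pi), Ioc_mem_nhds ?_ ?_, hG.aestronglyMeasurable, ?_⟩
  · linarith [Real.pi_pos]
  · linarith [Real.pi_pos]
  · have hp : Function.Periodic (fun t => ‖G t‖ₑ) (2 * Real.pi) := fun t => by simp [hper t]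
    rw [HasFiniteIntegral, hp.setLIntegral_Ioc_eq Real.two_pi_pos _ 0, zero_add]
    exact hfin

/-- Fatou's theorem: `f` has non-tangential limits at all Lebesgue points of its boundary values in
the sense of `L¹`. -/
theorem isBoundaryFunction_of_tendsto_lintegral {f : ℂ → ℂ} {g : Circle → ℂ}
    (hf : DifferentiableOn ℂ f unitDisc) (hg : Measurable fun θ : ℝ => g (Circle.exp θ))
    (hfin : ∫⁻ θ in Ioc 0 (2 * Real.pi), ‖g (Circle.exp θ)‖ₑ < ⊤)
    (hlim : Tendsto (fun R : ℝ => ∫⁻ t in Ioc 0 (2 * Real.pi),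
      ‖f ((R : ℂ) * (Circle.exp t : ℂ)) - g (Circle.exp t)‖ₑ) (𝓝[<] 1) (𝓝 0)) :
    IsBoundaryFunction f g := by
  have hper : Function.Periodic (fun θ => g (Circle.exp θ)) (2 * Real.pi) := fun θ => by simp
  have hloc := locallyIntegrable_of_periodic hg hper hfin
  filter_upwards [ae_lebesgue_point hloc] with θ hθ
  intro α hα
  have hfin' : ∫⁻ u in Ioc (-Real.pi) Real.pi,
      ‖g (Circle.exp (θ + u)) - g (Circle.exp θ)‖ₑ < ⊤ := by
    have h1 : IntegrableOn (fun t => g (Circle.exp t) - g (Circle.exp θ))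
        (Icc (-Real.pi + θ) (Real.pi + θ)) :=
      (hloc.sub (locallyIntegrable_const _)).integrableOn_isCompact isCompact_Icc
    have h2 := (h1.mono_set Ioc_subset_Icc_self).2
    rw [HasFiniteIntegral, ← setLIntegral_Ioc_comp_add_right
      (fun t => ‖g (Circle.exp t) - g (Circle.exp θ)‖ₑ)] at h2
    simpa only [add_comm θ] using h2
  have hd : Tendsto (fun z : ℂ => 1 - ‖z‖) (𝓝[stolzAngle α (Circle.exp θ)] (Circle.exp θ : ℂ))
      (𝓝[>] 0) := by
    refine tendsto_nhdsWithin_iff.2 ⟨?_, ?_⟩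
    · have := (by fun_prop : Continuous fun z : ℂ => 1 - ‖z‖).tendsto (Circle.exp θ : ℂ)
      rw [Circle.norm_coe, sub_self] at this
      exact this.mono_left nhdsWithin_le_nhds
    · filter_upwards [self_mem_nhdsWithin] with z hz
      exact sub_pos.2 (mem_unitDisc.1 hz.1)
  have hm : Measurable fun u => ‖g (Circle.exp (θ + u)) - g (Circle.exp θ)‖ₑ :=
    ((hg.comp (measurable_const_add θ)).sub_const _).enorm
  have h3 := ENNReal.Tendsto.const_mul (a := ENNReal.ofReal (50 * α ^ 2))
    ((tendsto_setLIntegral_kernel hm hfin' hθ).comp hd) (Or.inr ENNReal.ofReal_ne_top)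
  rw [mul_zero] at h3
  rw [tendsto_iff_edist_tendsto_0]
  refine tendsto_of_tendsto_of_tendsto_of_le_of_le' tendsto_const_nhds h3
    (Eventually.of_forall fun z => zero_le) ?_
  filter_upwards [self_mem_nhdsWithin] with z hz
  rw [edist_eq_enorm_sub]
  exact enorm_sub_le_of_mem_stolzAngle hf hg hper hlim hα hz

/-! ### Uniqueness of boundary values and conclusion -/

theorem HasNontangentialLimit.tendsto_radial {f : ℂ → ℂ} {ζ : Circle} {L : ℂ}
    (h : HasNontangentialLimit f ζ L) :
    Tendsto (fun r : ℝ => f ((r : ℂ) * (ζ : ℂ))) (𝓝[<] 1) (𝓝 L) := by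
  refine (h 2 one_lt_two).comp (tendsto_nhdsWithin_iff.2 ⟨tendsto_real_mul_nhdsLT _, ?_⟩)
  filter_upwards [Ioo_mem_nhdsLT (zero_lt_one' ℝ)] with r hr
  refine ⟨real_mul_circle_mem_unitDisc hr ζ, ?_⟩
  have e : 1 - starRingEnd ℂ (ζ : ℂ) * ((r : ℂ) * (ζ : ℂ)) = ((1 - r : ℝ) : ℂ) := by
    rw [mul_left_comm, ← Complex.normSq_eq_conj_mul_self, Circle.normSq_coe]
    push_cast
    ring
  rw [e, norm_real_mul_circle, abs_of_pos hr.1, Complex.norm_real,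
    Real.norm_of_nonneg (by linarith [hr.2])]
  linarith [hr.2]

theorem IsBoundaryFunction.ae_eq {f : ℂ → ℂ} {g g' : Circle → ℂ} (h : IsBoundaryFunction f g)
    (h' : IsBoundaryFunction f g') :
    (fun θ : ℝ => g (Circle.exp θ)) =ᵐ[volume] fun θ => g' (Circle.exp θ) := by
  filter_upwards [h, h'] with θ h1 h2
  exact tendsto_nhds_unique h1.tendsto_radial h2.tendsto_radial

theorem MemQCircle.congr_ae {p s : ℝ} {g g' : Circle → ℂ}
    (h : (fun θ : ℝ => g (Circle.exp θ)) =ᵐ[volume] fun θ => g' (Circle.exp θ))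
    (hg : MemQCircle p s g) : MemQCircle p s g' := by
  obtain ⟨h1, h2⟩ := hg
  have e : ∀ a l, arcEnergy p s g a l = arcEnergy p s g' a l := by
    intro a l
    refine lintegral_congr_ae (ae_restrict_of_ae (h.mono fun θ hθ => ?_))
    refine lintegral_congr_ae (ae_restrict_of_ae (h.mono fun t ht => ?_))
    simp only at hθ ht ⊢
    rw [hθ, ht]
  simp only [e] at h2
  exact ⟨(memLp_congr_ae (ae_restrict_of_ae h)).1 h1, h2⟩

theorem corollary2p5 (p s : ℝ) (hp : 1 < p) (hs0 : 0 < s) (hs1 : s < 1)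
    (f : ℂ → ℂ) (hf : MemHardy 1 f) :
    (∃ g : Circle → ℂ, IsBoundaryFunction f g) ∧
      ∀ g : Circle → ℂ, IsBoundaryFunction f g →
        (MemQDisc p s f ↔ MemQCircle p s g) := by
  obtain ⟨g₀, hg₀, hfin, hlim⟩ := hf.exists_boundary_lintegral
  have hb := isBoundaryFunction_of_tendsto_lintegral hf.1 hg₀ hfin hlim
  refine ⟨⟨g₀, hb⟩, fun g hg => ⟨fun h => ?_, fun h => ?_⟩⟩
  · exact (memQCircle_of_memQDisc hp hs0 hs1 hg₀ (hb.mono fun θ hθ => hθ.tendsto_radial) h).congr_ae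
      (hb.ae_eq hg)
  · exact memQDisc_of_memQCircle hp hs0 hs1 hf.1 hg₀ hlim (h.congr_ae (hg.ae_eq hb))
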